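/- **Theorem (decomposition theorem for cyclic $A_\infty$-algebras).** Let $k$ be a field of characteristic zero (for example $k=\mathbb{C}$). *Definitions.* An $A_\infty$-algebra $(\mathcal H,\mathfrak m)$ is a $\mathbb Z$-graded $k$-vector space $\mathcal H=\bigoplus_{i\in\mathbb Z}\mathcal H^i$ with multilinear maps $m_n:\mathcal H^{\otimes n}\to\mathcal H$ ($n\ge 1$; $m_0=0$) of degree $+1$ such that for all $n\ge1$ and homogeneous $o_1,\dots,o_n$ $$\sum_{\substack{r+l=n+1\\ r,l\ge1}}\ \sum_{j=0}^{r-1}(-1)^{\deg o_1+\cdots+\deg o_j}\,m_r(o_1,\dots,o_j,m_l(o_{j+1},\dots,o_{j+l}),o_{j+l+1},\dots,o_n)=0 .$$ It is *cyclic* with respect to a bilinear form $\omega:\mathcal H\otimes\mathcal H\to k$ if $\omega$ is nondegenerate (for each $o\neq0$ there is $o'$ with $\omega(o,o')\ne0$), skew-symmetric, of degree $-1$ ($\omega(o,o')=0$ for homogeneous $o,o'$ unless $\deg o+\deg o'=1$), and for all $n\ge1$ and homogeneous $o_1,\dots,o_{n+1}$ $$\omega(o_1,m_n(o_2,\dots,o_{n+1}))=(-1)^{\deg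 o_2}\,\omega(o_2,m_n(o_3,\dots,o_{n+1},o_1)).$$ It is *minimal* if $m_1=0$, and *linear contractible* if $m_n=0$ for $n\ge2$ and $m_1$ has trivial cohomology. The direct sum of two cyclic $A_\infty$-algebras has the componentwise operations and the orthogonal direct sum of the two forms. An *$A_\infty$-morphism* $\mathcal F:(\mathcal H,\mathfrak m)\to(\mathcal H',\mathfrak m')$ is a family of multilinear maps $f_n:\mathcal H^{\otimes n}\to\mathcal H'$ ($n\ge1$) of degree $0$ such that for all $n\ge 1$ and homogeneous $o_1,\dots,o_n$ $$\sum_{i\ge1}\ \sum_{0=n_0<n_1<\cdots<n_i=n} m'_i\big(f_{n_1}(o_1,\dots,o_{n_1}),\dots,f_{n-n_{i-1}}(o_{n_{i-1}+1},\dots,o_n)\big)=\sum_{\substack{r+l=n+1\\ r,l\ge1}}\ \sum_{j=0}^{r-1}(-1)^{\deg o_1+\cdots+\deg o_j}f_r(o_1,\dots,o_j,m_l(o_{j+1},\dots,o_{j+l}),o_{j+l+1},\dots,o_n).$$ It is *cyclic* if $\omega'(f_1(o),f_1(o'))=\omega(o,o')$ for all $o,o'$, and $\sum_{r+l=n,\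 r,l\ge1}\omega'(f_r(o_1,\dots,o_r),f_l(o_{r+1},\dots,o_n))=0$ for all $n\ge3$ and all $o_1,\dots,o_n$. A *cyclic $A_\infty$-isomorphism* is a cyclic $A_\infty$-morphism with $f_1$ bijective. A *homotopy operator of $Q=m_1$ compatible with $\omega$* is a linear map $Q^+:\mathcal H\to\mathcal H$ of degree $-1$ such that $P:=1-QQ^+-Q^+Q$ satisfies $P^2=P$ and $QP=0$, and such that $\omega(P\mathcal H,Q^+Q\mathcal H)=\omega(Q^+Q\mathcal H,Q^+Q\mathcal H)=0$. *Statement.* Let $(\mathcal H,\omega,\mathfrak m)$ be a cyclic $A_\infty$-algebra over $k$. Assume that every $\mathcal H^i$ is finite-dimensional or that (with no restriction on dimensions) there is a homotopy operator of $m_1$ compatible with $\omega$. Then $(\mathcal H,\omega,\mathfrak m)$ is cyclic $A_\infty$-isomorphic to the direct sum of a minimal cyclic $A_\infty$-algebra and a linear contractible cyclic $A_\infty$-algebra. In particular the symplectic form is carried to the orthogonal direct sum of the symplectic forms of the two summands. -/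

import Mathlib

open scoped BigOperators

universe u v

section Families

variable {K : Type u} [Field K] {V : Type v} [AddCommGroup V] [Module K V]
variable {W : Type v} [AddCommGroup W] [Module K W]

/-- A family `(g_n)_{n ≥ 0}` of `K`-multilinear maps `g_n : V^{⊗ n} → W`. -/
abbrev MultFamily (K : Type u) [Field K] (V : Type v) [AddCommGroup V] [Module K V]
    (W : Type v) [AddCommGroup W] [Module K W] : Type v :=
  ∀ n : ℕ, MultilinearMap K (fun _ : Fin n => V) W

/-- The family `g` has degree `e`: `g_n(o_1, …, o_n)` is homogeneous of degree
`deg o_1 + ⋯ + deg o_n + e` for homogeneous `o_1, …, o_n`. -/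
def MultFamily.HasDegree (g : MultFamily K V W) (𝒱 : ℤ → Submodule K V)
    (𝒲 : ℤ → Submodule K W) (e : ℤ) : Prop :=
  ∀ (n : ℕ) (d : Fin n → ℤ) (o : Fin n → V), (∀ i, o i ∈ 𝒱 (d i)) →
    g n o ∈ 𝒲 ((∑ i, d i) + e)

/-- For a sequence `o_0, o_1, …` (only the first `n` entries matter) with degrees `d_0, d_1, …`,
the signed sum
`∑_{k + l = n + 1, l ≥ 1} ∑_{0 ≤ j ≤ k - 1} (-1)^{d_0 + ⋯ + d_{j-1}}
  g_k(o_0, …, o_{j-1}, m_l(o_j, …, o_{j+l-1}), o_{j+l}, …, o_{n-1})`. -/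
def insertionSum (g : MultFamily K V W) (m : MultFamily K V V) (n : ℕ)
    (d : ℕ → ℤ) (o : ℕ → V) : W :=
  ∑ l ∈ Finset.Icc 1 n, ∑ j ∈ Finset.range (n + 1 - l),
    ((-1 : K) ^ (∑ i ∈ Finset.range j, d i)) •
      g (n + 1 - l) (fun i : Fin (n + 1 - l) =>
        if (i : ℕ) < j then o i
        else if (i : ℕ) = j then m l (fun t : Fin l => o (j + t))
        else o (i + l - 1))

/-- The sum over all ways of cutting `o_0, …, o_{n-1}` into `i ≥ 1` consecutive nonempty blocks,
`∑ m'_i(f(block_1), …, f(block_i))`. -/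
def compositionSum (m' : MultFamily K W W) (f : MultFamily K V W) (n : ℕ) (o : ℕ → V) : W :=
  ∑ c : Composition n, m' c.length (fun i =>
    f (c.blocksFun i) (fun t => o (c.embedding i t : ℕ)))

end Families

/-- A (non-curved) `A_∞`-algebra over `K`, in the convention in which all `m_k` have degree `+1`. -/
structure AInftyAlgebra (K : Type u) [Field K] where
  carrier : Type v
  [addCommGroup : AddCommGroup carrier]
  [module : Module K carrier]
  /-- the homogeneous components `H^k`, `k ∈ ℤ` -/
  grading : ℤ → Submodule K carrier
  isInternal : DirectSum.IsInternal grading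
  m : MultFamily K carrier carrier
  m_zero : m 0 = 0
  m_degree : m.HasDegree grading grading 1
  relation : ∀ n : ℕ, 1 ≤ n → ∀ (d : ℕ → ℤ) (o : ℕ → carrier), (∀ i, o i ∈ grading (d i)) →
    insertionSum m m n d o = 0

attribute [instance] AInftyAlgebra.addCommGroup AInftyAlgebra.module

namespace AInftyAlgebra

variable {K : Type u} [Field K]

/-- The differential `Q = m_1` as a linear map. -/
def Q (A : AInftyAlgebra.{u, v} K) : A.carrier →ₗ[K] A.carrier where
  toFun o := A.m 1 (fun _ => o)
  map_add' x y := by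
    have h := (A.m 1).map_update_add (fun _ => 0) 0 x y
    have e : ∀ z : A.carrier, Function.update (fun _ : Fin 1 => (0 : A.carrier)) 0 z
        = fun _ => z := fun z => by
      funext i; rw [Subsingleton.elim i 0]; simp
    simpa only [e] using h
  map_smul' c x := by
    have h := (A.m 1).map_update_smul (fun _ => 0) 0 c x
    have e : ∀ z : A.carrier, Function.update (fun _ : Fin 1 => (0 : A.carrier)) 0 z
        = fun _ => z := fun z => by
      funext i; rw [Subsingleton.elim i 0]; simp
    simpa only [e, RingHom.id_apply] using h

/-- Minimal: `m_1 = 0`. -/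
def IsMinimal (A : AInftyAlgebra.{u, v} K) : Prop := A.m 1 = 0

/-- Linear contractible: `m_k = 0` for `k ≥ 2`, and `Q = m_1` has trivial cohomology. -/
def IsLinearContractible (A : AInftyAlgebra.{u, v} K) : Prop :=
  (∀ k, 2 ≤ k → A.m k = 0) ∧ ∀ o, A.Q o = 0 → ∃ o', A.Q o' = o

/-- An `A_∞`-morphism: a family of maps `f_k` of degree `0` with `f_0 = 0`, compatible with the
`A_∞`-structures. -/
structure Hom (A B : AInftyAlgebra.{u, v} K) where
  f : MultFamily K A.carrier B.carrier
  f_zero : f 0 = 0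
  f_degree : f.HasDegree A.grading B.grading 0
  relation : ∀ n : ℕ, 1 ≤ n → ∀ (d : ℕ → ℤ) (o : ℕ → A.carrier),
    (∀ i, o i ∈ A.grading (d i)) →
      compositionSum B.m f n o = insertionSum f A.m n d o

/-- An `A_∞`-morphism is an `A_∞`-isomorphism if its linear part `f_1` is bijective. -/
def Hom.IsIso {A B : AInftyAlgebra.{u, v} K} (F : Hom A B) : Prop :=
  Function.Bijective (fun o : A.carrier => F.f 1 (fun _ => o))

end AInftyAlgebra

/-- A cyclic `A_∞`-algebra: an `A_∞`-algebra with an odd constant symplectic structure `ω`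
(a nondegenerate skew-symmetric bilinear form of degree `-1`) for which all `m_k` are cyclic. -/
structure CyclicAInftyAlgebra (K : Type u) [Field K] extends AInftyAlgebra.{u, v} K where
  ω : carrier →ₗ[K] carrier →ₗ[K] K
  ω_degree : ∀ (a b : ℤ) (x y : carrier), x ∈ grading a → y ∈ grading b → a + b ≠ 1 → ω x y = 0
  ω_skew : ∀ x y : carrier, ω y x = - ω x y
  ω_nondegenerate : ∀ x : carrier, x ≠ 0 → ∃ y, ω x y ≠ 0
  /-- `ω(o_0, m_k(o_1, …, o_k)) = (-1)^{deg o_1} ω(o_1, m_k(o_2, …, o_k, o_0))` -/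
  cyclic : ∀ k : ℕ, 1 ≤ k → ∀ (d : ℕ → ℤ) (o : ℕ → carrier), (∀ i, o i ∈ grading (d i)) →
    ω (o 0) (m k (fun i => o (i + 1))) =
      (-1 : K) ^ (d 1) *
        ω (o 1) (m k (fun i => if (i : ℕ) + 1 = k then o 0 else o (i + 2)))

/-- A cyclic `A_∞`-morphism: an `A_∞`-morphism with `ω'(f_1 x, f_1 y) = ω(x, y)` and
`∑_{k + l = n, k, l ≥ 1} ω'(f_k(o_0, …, o_{k-1}), f_l(o_k, …, o_{n-1})) = 0` for `n ≥ 3`. -/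
structure CyclicAInftyAlgebra.Hom {K : Type u} [Field K] (A B : CyclicAInftyAlgebra.{u, v} K)
    extends AInftyAlgebra.Hom A.toAInftyAlgebra B.toAInftyAlgebra where
  map_ω : ∀ x y : A.carrier, B.ω (f 1 (fun _ => x)) (f 1 (fun _ => y)) = A.ω x y
  map_ω_higher : ∀ n : ℕ, 3 ≤ n → ∀ o : ℕ → A.carrier,
    ∑ k ∈ Finset.Ico 1 n,
      B.ω (f k (fun i => o i)) (f (n - k) (fun i => o (k + i))) = 0

section Product

variable {K : Type u} [Field K] {V : Type v} [AddCommGroup V] [Module K V]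
variable {W : Type v} [AddCommGroup W] [Module K W]

/-- The componentwise direct sum of two families of multilinear operations. -/
def MultFamily.prodFamily (m : MultFamily K V V) (m' : MultFamily K W W) :
    MultFamily K (V × W) (V × W) := fun n =>
  ((m n).compLinearMap (fun _ => LinearMap.fst K V W)).prod
    ((m' n).compLinearMap (fun _ => LinearMap.snd K V W))

theorem MultFamily.prodFamily_apply (m : MultFamily K V V) (m' : MultFamily K W W) (n : ℕ)
    (o : Fin n → V × W) :
    m.prodFamily m' n o = (m n (fun i => (o i).1), m' n (fun i => (o i).2)) := rfl

theorem insertionSum_prodFamily (m : MultFamily K V V) (m' : MultFamily K W W) (n : ℕ)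
    (d : ℕ → ℤ) (o : ℕ → V × W) :
    insertionSum (m.prodFamily m') (m.prodFamily m') n d o =
      (insertionSum m m n d (fun i => (o i).1), insertionSum m' m' n d (fun i => (o i).2)) := by
  unfold insertionSum
  ext
  · simp only [Prod.fst_sum, Prod.smul_fst, MultFamily.prodFamily_apply, apply_ite Prod.fst]
  · simp only [Prod.snd_sum, Prod.smul_snd, MultFamily.prodFamily_apply, apply_ite Prod.snd]

theorem isInternal_prod {𝒱 : ℤ → Submodule K V} {𝒲 : ℤ → Submodule K W}
    (hV : DirectSum.IsInternal 𝒱) (hW : DirectSum.IsInternal 𝒲) :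
    DirectSum.IsInternal (fun i => (𝒱 i).prod (𝒲 i)) := by
  rw [DirectSum.isInternal_submodule_iff_iSupIndep_and_iSup_eq_top] at hV hW ⊢
  refine ⟨fun i => ?_, ?_⟩
  · rw [Submodule.disjoint_def]
    rintro ⟨x, y⟩ ⟨hx, hy⟩ h
    have hle : (⨆ j, ⨆ (_ : j ≠ i), (𝒱 j).prod (𝒲 j)) ≤
        (⨆ j, ⨆ (_ : j ≠ i), 𝒱 j).prod (⨆ j, ⨆ (_ : j ≠ i), 𝒲 j) :=
      iSup₂_le fun j hj => Submodule.prod_mono (le_iSup₂_of_le j hj le_rfl)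
        (le_iSup₂_of_le j hj le_rfl)
    obtain ⟨h1, h2⟩ := hle h
    have e1 := Submodule.disjoint_def.1 (hV.1 i) x hx h1
    have e2 := Submodule.disjoint_def.1 (hW.1 i) y hy h2
    simp [e1, e2]
  · rw [eq_top_iff]
    rintro ⟨x, y⟩ -
    have hl : (⨆ i, 𝒱 i) ≤ (⨆ i, (𝒱 i).prod (𝒲 i)).comap (LinearMap.inl K V W) :=
      iSup_le fun i z hz => (le_iSup (fun i => (𝒱 i).prod (𝒲 i)) i) ⟨hz, (𝒲 i).zero_mem⟩
    have hr : (⨆ i, 𝒲 i) ≤ (⨆ i, (𝒱 i).prod (𝒲 i)).comap (LinearMap.inr K V W) :=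
      iSup_le fun i z hz => (le_iSup (fun i => (𝒱 i).prod (𝒲 i)) i) ⟨(𝒱 i).zero_mem, hz⟩
    have h1 := hl (x := x) (by rw [hV.2]; trivial)
    have h2 := hr (x := y) (by rw [hW.2]; trivial)
    simpa using Submodule.add_mem (⨆ i, (𝒱 i).prod (𝒲 i)) h1 h2

end Product

namespace CyclicAInftyAlgebra

variable {K : Type u} [Field K]

/-- The direct sum of two cyclic `A_∞`-algebras: underlying space `A × B`, operations componentwise,
and `ω` the orthogonal direct sum of the two symplectic forms. -/
def directSum (A B : CyclicAInftyAlgebra.{u, v} K) : CyclicAInftyAlgebra.{u, v} K where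
  carrier := A.carrier × B.carrier
  grading i := (A.grading i).prod (B.grading i)
  isInternal := isInternal_prod A.isInternal B.isInternal
  m := A.m.prodFamily B.m
  m_zero := by
    ext o
    · simp [MultFamily.prodFamily_apply, A.m_zero]
    · simp [MultFamily.prodFamily_apply, B.m_zero]
  m_degree n d o ho := ⟨A.m_degree n d _ fun i => (ho i).1, B.m_degree n d _ fun i => (ho i).2⟩
  relation n hn d o ho := by
    rw [insertionSum_prodFamily, A.relation n hn d _ fun i => (ho i).1,
      B.relation n hn d _ fun i => (ho i).2]
    rfl
  ω := A.ω.compl₁₂ (LinearMap.fst K _ _) (LinearMap.fst K _ _) +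
    B.ω.compl₁₂ (LinearMap.snd K _ _) (LinearMap.snd K _ _)
  ω_degree a b x y hx hy h := by
    simp [A.ω_degree a b _ _ hx.1 hy.1 h, B.ω_degree a b _ _ hx.2 hy.2 h]
  ω_skew x y := by
    simp [A.ω_skew x.1 y.1, B.ω_skew x.2 y.2, add_comm]
  ω_nondegenerate x hx := by
    by_cases h : x.1 = 0
    · have h2 : x.2 ≠ 0 := fun h2 => hx (Prod.ext h h2)
      obtain ⟨y, hy⟩ := B.ω_nondegenerate _ h2
      exact ⟨(0, y), by simpa using hy⟩
    · obtain ⟨y, hy⟩ := A.ω_nondegenerate _ h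
      exact ⟨(y, 0), by simpa using hy⟩
  cyclic k hk d o ho := by
    have hA := A.cyclic k hk d _ fun i => (ho i).1
    have hB := B.cyclic k hk d _ fun i => (ho i).2
    simp only [LinearMap.add_apply, LinearMap.compl₁₂_apply, LinearMap.fst_apply,
      LinearMap.snd_apply, MultFamily.prodFamily_apply, apply_ite Prod.fst, apply_ite Prod.snd,
      mul_add]
    rw [hA, hB]

/-- `Qp` is a homotopy operator of `Q = m_1` compatible with `ω`: it is linear of degree `-1`,
`P := 1 - Q Qp - Qp Q` satisfies `P² = P` and `Q P = 0`, and, with `H^p` the image of `P` and `H^u`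
the image of `Qp Q`, one has `ω(H^p, H^u) = ω(H^u, H^u) = 0`. -/
def IsCompatibleHomotopy (A : CyclicAInftyAlgebra.{u, v} K)
    (Qp : A.carrier →ₗ[K] A.carrier) : Prop :=
  (∀ i, ∀ x ∈ A.grading i, Qp x ∈ A.grading (i - 1)) ∧
  ∃ P : A.carrier →ₗ[K] A.carrier,
    A.Q ∘ₗ Qp + Qp ∘ₗ A.Q + P = LinearMap.id ∧ P ∘ₗ P = P ∧ A.Q ∘ₗ P = 0 ∧
    (∀ x y, A.ω (P x) (Qp (A.Q y)) = 0) ∧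
    (∀ x y, A.ω (Qp (A.Q x)) (Qp (A.Q y)) = 0)

end CyclicAInftyAlgebra

/-!
A cyclic `A∞`-structure is the same thing as an odd coderivation `D` of the tensor coalgebra with
`D * D = 0` that annihilates the form given by `ω` on two-letter words. Let `Q` be the linear part
of `D` and choose a homotopy `h`, compatible with `ω`, such that `Q h + h Q` is a self-adjoint
projection; the complementary projection has the harmonic vectors as its image. If the components
are finite-dimensional, `h` comes from averaging a generalized inverse of `Q` with its adjoint.

The nonlinear operations with a nonharmonic input or output are removed arity by arity. At the
lowest arity where they occur the Maurer–Cartan equation is linear, and Cartan's homotopy formula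
says that commuting with `h` and then with `Q` amounts to counting the nonharmonic inputs and
outputs. In characteristic zero the count can be inverted on the terms to be removed, so they are
`Q`-exact, and conjugating `D` by the exponential of an even cyclic coderivation kills them. The
infinite composition of these automorphisms stabilizes on words of bounded length. In the end all
nonlinear operations factor through the harmonic projection, so the harmonic vectors form a minimal
summand and their orthogonal complement a linear contractible one.
-/

namespace BarCoalgebra

section Deconcatenation

open TensorAlgebra TensorProduct

variable {K : Type u} [CommRing K] {V : Type v} [AddCommGroup V] [Module K V]
variable {X Y Z X' Y' U : Type*} [AddCommGroup X] [Module K X] [AddCommGroup Y] [Module K Y]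
  [AddCommGroup Z] [Module K Z] [AddCommGroup X'] [Module K X'] [AddCommGroup Y'] [Module K Y']
  [AddCommGroup U] [Module K U]
variable {D F G ρ : TensorAlgebra K V →ₗ[K] TensorAlgebra K V}

theorem induction_left {C : TensorAlgebra K V → Prop} (one : C 1)
    (mul : ∀ x w, C w → C (ι K x * w)) (add : ∀ a b, C a → C b → C (a + b))
    (smul : ∀ (c : K) a, C a → C (c • a)) (w : TensorAlgebra K V) : C w := by
  have mul_left (a) : ∀ w, C w → C (a * w) := by
    induction a using TensorAlgebra.induction with
    | algebraMap r => intro w hw; rw [← Algebra.smul_def]; exact smul r w hw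
    | ι x => exact mul x
    | mul a b ha hb => intro w hw; rw [mul_assoc]; exact ha _ (hb _ hw)
    | add a b ha hb => intro w hw; rw [add_mul]; exact add _ _ (ha w hw) (hb w hw)
  simpa using mul_left w 1 one

theorem linearMap_ext_left {A B : TensorAlgebra K V →ₗ[K] X} (one : A 1 = B 1)
    (mul : ∀ x w, A w = B w → A (ι K x * w) = B (ι K x * w)) : A = B := by
  ext w
  induction w using induction_left with
  | one => exact one
  | mul x w h => exact mul x w h
  | add a b ha hb => rw [map_add, map_add, ha, hb]
  | smul c a h => rw [map_smul, map_smul, h]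

/-- The step of the left recursion `leftRec`, acting on pairs of a word and its value. -/
def leftRecStep (φ : V →ₗ[K] TensorAlgebra K V →ₗ[K] X) (ψ : V →ₗ[K] Module.End K X) :
    V →ₗ[K] Module.End K (TensorAlgebra K V × X) :=
  LinearMap.mk₂ K (fun x p => (ι K x * p.1, φ x p.1 + ψ x p.2))
    (fun x y p => by ext <;> simp [add_mul]; abel)
    (fun c x p => by ext <;> simp)
    (fun x p q => by ext <;> simp [mul_add]; abel)
    (fun c x p => by ext <;> simp)

/-- The linear map `f` on the tensor algebra defined by primitive recursion on words:
`f 1 = s` and `f (x w) = φ x w + ψ x (f w)`. -/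
def leftRec (s : X) (φ : V →ₗ[K] TensorAlgebra K V →ₗ[K] X) (ψ : V →ₗ[K] Module.End K X) :
    TensorAlgebra K V →ₗ[K] X :=
  LinearMap.snd K _ _ ∘ₗ LinearMap.applyₗ (1, s) ∘ₗ
    (TensorAlgebra.lift K (leftRecStep φ ψ)).toLinearMap

@[simp] theorem leftRec_one (s : X) (φ : V →ₗ[K] TensorAlgebra K V →ₗ[K] X)
    (ψ : V →ₗ[K] Module.End K X) : leftRec s φ ψ 1 = s := by
  simp [leftRec]

@[simp] theorem leftRec_mul (s : X) (φ : V →ₗ[K] TensorAlgebra K V →ₗ[K] X)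
    (ψ : V →ₗ[K] Module.End K X) (x : V) (w : TensorAlgebra K V) :
    leftRec s φ ψ (ι K x * w) = φ x w + ψ x (leftRec s φ ψ w) := by
  have fst_eq : LinearMap.fst K _ _ ∘ₗ LinearMap.applyₗ ((1, s) : TensorAlgebra K V × X) ∘ₗ
      (TensorAlgebra.lift K (leftRecStep φ ψ)).toLinearMap = LinearMap.id :=
    linearMap_ext_left (by simp) fun x w h => by simp_all [leftRecStep]
  have fst_apply : (TensorAlgebra.lift K (leftRecStep φ ψ) w (1, s)).1 = w :=
    LinearMap.congr_fun fst_eq w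
  simp only [leftRecStep, leftRec, LinearMap.coe_comp, LinearMap.coe_snd, AlgHom.coe_toLinearMap,
    Function.comp_apply, map_mul, lift_ι_apply, LinearMap.applyₗ_apply_apply,
    Module.End.mul_apply, LinearMap.mk₂_apply, add_left_inj] at fst_apply ⊢
  rw [fst_apply]

/-- Left multiplication by a letter. -/
abbrev cons (x : V) : Module.End K (TensorAlgebra K V) :=
  LinearMap.mulLeft K (ι K x)

/-- The deconcatenation coproduct `w ↦ ∑ w' ⊗ w''` over all factorizations `w = w' w''`. -/
def comul : TensorAlgebra K V →ₗ[K] TensorAlgebra K V ⊗[K] TensorAlgebra K V :=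
  leftRec (1 ⊗ₜ 1) ((LinearMap.mul K _ ∘ₗ ι K).compr₂ (TensorProduct.mk K _ _ 1))
    (LinearMap.mul K _ ∘ₗ (TensorProduct.mk K _ _).flip 1 ∘ₗ ι K)

@[simp] theorem comul_one : comul (1 : TensorAlgebra K V) = 1 ⊗ₜ 1 :=
  leftRec_one _ _ _

theorem comul_mul (x : V) (w : TensorAlgebra K V) :
    comul (ι K x * w) = (ι K x ⊗ₜ 1) * comul w + 1 ⊗ₜ (ι K x * w) := by
  simp [comul, add_comm]

/-- The convolution `w ↦ ∑ β (A w') (B w'')` over all factorizations `w = w' w''`. -/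
def conv (β : X →ₗ[K] Y →ₗ[K] Z) :
    (TensorAlgebra K V →ₗ[K] X) →ₗ[K] (TensorAlgebra K V →ₗ[K] Y) →ₗ[K]
      (TensorAlgebra K V →ₗ[K] Z) :=
  LinearMap.mk₂ K (fun A B => TensorProduct.lift (β.compl₁₂ A B) ∘ₗ comul)
    (fun A A' B => by rw [← LinearMap.add_comp]; congr 1; ext; simp)
    (fun c A B => by rw [← LinearMap.smul_comp]; congr 1; ext; simp)
    (fun A B B' => by rw [← LinearMap.add_comp]; congr 1; ext; simp)
    (fun c A B => by rw [← LinearMap.smul_comp]; congr 1; ext; simp)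

theorem conv_eq_lift_comp (β : X →ₗ[K] Y →ₗ[K] Z) (A : TensorAlgebra K V →ₗ[K] X)
    (B : TensorAlgebra K V →ₗ[K] Y) :
    conv β A B = TensorProduct.lift (β.compl₁₂ A B) ∘ₗ comul := rfl

@[simp] theorem conv_one (β : X →ₗ[K] Y →ₗ[K] Z) (A : TensorAlgebra K V →ₗ[K] X)
    (B : TensorAlgebra K V →ₗ[K] Y) : conv β A B 1 = β (A 1) (B 1) := by
  simp [conv_eq_lift_comp]

theorem conv_congr {β : X →ₗ[K] Y →ₗ[K] Z} {A : TensorAlgebra K V →ₗ[K] X}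
    {B : TensorAlgebra K V →ₗ[K] Y} {β' : X' →ₗ[K] Y' →ₗ[K] Z}
    {A' : TensorAlgebra K V →ₗ[K] X'} {B' : TensorAlgebra K V →ₗ[K] Y'}
    (h : ∀ u v, β (A u) (B v) = β' (A' u) (B' v)) : conv β A B = conv β' A' B' := by
  rw [conv_eq_lift_comp, conv_eq_lift_comp,
    show β.compl₁₂ A B = β'.compl₁₂ A' B' from LinearMap.ext₂ h]

theorem comp_conv (φ : Z →ₗ[K] U) (β : X →ₗ[K] Y →ₗ[K] Z) (A : TensorAlgebra K V →ₗ[K] X)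
    (B : TensorAlgebra K V →ₗ[K] Y) : φ ∘ₗ conv β A B = conv (β.compr₂ φ) A B := by
  rw [conv_eq_lift_comp, conv_eq_lift_comp, ← LinearMap.comp_assoc]
  congr 1
  ext
  simp

theorem apply_conv {φ : Z →ₗ[K] U} {β : X →ₗ[K] Y →ₗ[K] Z} {β' : X' →ₗ[K] Y' →ₗ[K] U}
    {A : TensorAlgebra K V →ₗ[K] X} {B : TensorAlgebra K V →ₗ[K] Y}
    {A' : TensorAlgebra K V →ₗ[K] X'} {B' : TensorAlgebra K V →ₗ[K] Y'}
    (h : ∀ u v, φ (β (A u) (B v)) = β' (A' u) (B' v)) (w : TensorAlgebra K V) :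
    φ (conv β A B w) = conv β' A' B' w := by
  rw [← LinearMap.comp_apply, comp_conv]
  exact LinearMap.congr_fun (conv_congr h) w

theorem conv_mul (β : X →ₗ[K] Y →ₗ[K] Z) (A : TensorAlgebra K V →ₗ[K] X)
    (B : TensorAlgebra K V →ₗ[K] Y) (x : V) (w : TensorAlgebra K V) :
    conv β A B (ι K x * w) = conv β (A ∘ₗ cons x) B w + β (A 1) (B (ι K x * w)) := by
  simp only [conv_eq_lift_comp, LinearMap.comp_apply, comul_mul, map_add, TensorProduct.lift.tmul,
    LinearMap.compl₁₂_apply]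
  congr 1
  induction comul w using TensorProduct.induction_on with
  | zero => simp
  | tmul a b => simp
  | add a b ha hb => rw [mul_add, map_add, map_add, ha, hb]

theorem conv_assoc {W₁ W₂ : Type*} [AddCommGroup W₁] [Module K W₁] [AddCommGroup W₂] [Module K W₂]
    {β : W₁ →ₗ[K] Z →ₗ[K] U} {γ : X →ₗ[K] Y →ₗ[K] W₁}
    {β' : X →ₗ[K] W₂ →ₗ[K] U} {γ' : Y →ₗ[K] Z →ₗ[K] W₂}
    (h : ∀ a b c, β (γ a b) c = β' a (γ' b c))
    (A : TensorAlgebra K V →ₗ[K] X) (B : TensorAlgebra K V →ₗ[K] Y)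
    (C : TensorAlgebra K V →ₗ[K] Z) :
    conv β (conv γ A B) C = conv β' A (conv γ' B C) := by
  ext w
  induction w using induction_left generalizing A with
  | one => simp [h]
  | mul x w ih =>
    have conv_comp_cons : conv γ A B ∘ₗ cons x = conv γ (A ∘ₗ cons x) B + γ (A 1) ∘ₗ B ∘ₗ cons x :=
      LinearMap.ext fun w => conv_mul γ A B x w
    have pull_out : β' (A 1) (conv γ' (B ∘ₗ cons x) C w) = conv β (γ (A 1) ∘ₗ B ∘ₗ cons x) C w :=
      apply_conv (fun u v => by simp [h]) w
    rw [conv_mul, conv_mul, conv_comp_cons, map_add, LinearMap.add_apply, LinearMap.add_apply, ih,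
      ← pull_out, conv_one, h, conv_mul, map_add, add_assoc]
  | add a b ha hb => rw [map_add, map_add, ha, hb]
  | smul c a ha => rw [map_smul, map_smul, ha]

/-- The empty-word coefficient. -/
def counit : TensorAlgebra K V →ₗ[K] K :=
  (TensorAlgebra.algebraMapInv (R := K) (M := V)).toLinearMap

@[simp] theorem counit_one : counit (1 : TensorAlgebra K V) = 1 := by simp [counit]

theorem counit_mul (a b : TensorAlgebra K V) : counit (a * b) = counit a * counit b := by
  simp [counit]

@[simp] theorem counit_ι (x : V) : counit (ι K x) = 0 := by
  simp [counit, TensorAlgebra.algebraMapInv]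

/-- The one-letter part of a tensor. -/
def letter : TensorAlgebra K V →ₗ[K] V :=
  leftRec 0 ((LinearMap.lsmul K V).flip.compl₂ counit) 0

@[simp] theorem letter_one : letter (1 : TensorAlgebra K V) = 0 :=
  leftRec_one _ _ _

@[simp] theorem letter_ι_mul (x : V) (w : TensorAlgebra K V) :
    letter (ι K x * w) = counit w • x := by
  simp [letter]

@[simp] theorem letter_ι (x : V) : letter (ι K x) = x := by
  simpa using letter_ι_mul (K := K) x 1

theorem letter_mul (a b : TensorAlgebra K V) :
    letter (a * b) = counit a • letter b + counit b • letter a := by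
  induction a using induction_left with
  | one => simp
  | mul x w _ => simp [mul_assoc, counit_mul, mul_comm, mul_smul]
  | add a a' h h' => simp only [add_mul, map_add, h, h', add_smul, smul_add]; abel
  | smul c a h => simp only [smul_mul_assoc, map_smul, h, smul_add, smul_smul, smul_eq_mul,
      mul_comm]

/-- The concatenation product as a bilinear map. -/
abbrev concat : TensorAlgebra K V →ₗ[K] TensorAlgebra K V →ₗ[K] TensorAlgebra K V :=
  LinearMap.mul K (TensorAlgebra K V)

theorem counit_conv (B : TensorAlgebra K V →ₗ[K] Y) :
    conv (LinearMap.lsmul K Y) counit B = B := by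
  refine linearMap_ext_left (by simp) fun x w _ => ?_
  have counit_comp_cons : counit ∘ₗ cons x = (0 : TensorAlgebra K V →ₗ[K] K) := by
    ext w; simp [counit_mul]
  simp [conv_mul, counit_comp_cons]

theorem conv_counit (A : TensorAlgebra K V →ₗ[K] X) :
    conv (LinearMap.lsmul K X).flip A counit = A := by
  ext w
  induction w using induction_left generalizing A with
  | one => simp
  | mul x w ih => rw [conv_mul, ih]; simp [counit_mul]
  | add a b ha hb => simp only [map_add, ha, hb]
  | smul c a ha => simp only [map_smul, ha]

theorem conv_letter_mul (β : X →ₗ[K] Y →ₗ[K] Z) (φ : V →ₗ[K] X)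
    (B : TensorAlgebra K V →ₗ[K] Y) (x : V) (w : TensorAlgebra K V) :
    conv β (φ ∘ₗ letter) B (ι K x * w) = β (φ x) (B w) := by
  have := apply_conv (φ := β (φ x)) (β := LinearMap.lsmul K Y) (β' := β) (A := counit) (B := B)
    (A' := (φ ∘ₗ letter) ∘ₗ cons x) (B' := B) (fun u v => by simp) w
  rw [conv_mul, ← this, counit_conv]
  simp

theorem eq_counit_add_conv_letter (w : TensorAlgebra K V) :
    w = counit w • 1 + conv concat (ι K ∘ₗ letter) LinearMap.id w := by
  have h : LinearMap.id = LinearMap.toSpanSingleton K _ (1 : TensorAlgebra K V) ∘ₗ counit +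
      conv concat (ι K ∘ₗ letter) LinearMap.id :=
    linearMap_ext_left (by simp) fun x w _ => by simp [conv_letter_mul, counit_mul]
  simpa using LinearMap.congr_fun h w

/-- The endomorphism of the tensor algebra induced by a linear map. -/
def tmap (τ : V →ₗ[K] V) : TensorAlgebra K V →ₐ[K] TensorAlgebra K V :=
  TensorAlgebra.lift K (ι K ∘ₗ τ)

@[simp] theorem tmap_ι (τ : V →ₗ[K] V) (x : V) : tmap τ (ι K x) = ι K (τ x) := by
  simp [tmap]

theorem tmap_comp_cons (τ : V →ₗ[K] V) (x : V) :
    (tmap τ).toLinearMap ∘ₗ cons x = cons (τ x) ∘ₗ (tmap τ).toLinearMap := by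
  ext; simp

theorem tmap_id : tmap (LinearMap.id : V →ₗ[K] V) = AlgHom.id K _ := by
  ext x; simp

theorem tmap_comp (σ τ : V →ₗ[K] V) : tmap (σ ∘ₗ τ) = (tmap σ).comp (tmap τ) := by
  ext x; simp

/-- A counital coalgebra endomorphism of the bar coalgebra preserving the empty word. -/
structure IsCoalgHom (F : TensorAlgebra K V →ₗ[K] TensorAlgebra K V) : Prop where
  map_one : F 1 = 1
  counit_comp : counit ∘ₗ F = counit
  comul_comp : comul ∘ₗ F = TensorProduct.map F F ∘ₗ comul

/-- A coderivation relative to `ρ`, vanishing on the empty word: `Δ D = (D ⊗ 1 + ρ ⊗ D) Δ`. The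
twist `ρ` carries the Koszul signs of odd coderivations. -/
structure IsCoderivation (ρ D : TensorAlgebra K V →ₗ[K] TensorAlgebra K V) : Prop where
  map_one : D 1 = 0
  counit_comp : counit ∘ₗ D = 0
  comul_comp : comul ∘ₗ D =
    (TensorProduct.map D LinearMap.id + TensorProduct.map ρ D) ∘ₗ comul

theorem comul_eq_conv :
    comul = conv (TensorProduct.mk K (TensorAlgebra K V) _) LinearMap.id LinearMap.id := by
  have lift_mk :
      TensorProduct.lift ((TensorProduct.mk K (TensorAlgebra K V) (TensorAlgebra K V)).compl₁₂
        LinearMap.id LinearMap.id) = LinearMap.id :=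
    TensorProduct.ext' fun u v => by simp
  rw [conv_eq_lift_comp, lift_mk, LinearMap.id_comp]

theorem map_comp_comul (A : TensorAlgebra K V →ₗ[K] X) (B : TensorAlgebra K V →ₗ[K] Y) :
    TensorProduct.map A B ∘ₗ comul = conv (TensorProduct.mk K X Y) A B := by
  rw [comul_eq_conv, comp_conv]
  exact conv_congr fun u v => by simp

theorem isCoalgHom_id : IsCoalgHom (LinearMap.id : Module.End K (TensorAlgebra K V)) :=
  ⟨rfl, rfl, by simp⟩

theorem IsCoalgHom.comp (hF : IsCoalgHom F) (hG : IsCoalgHom G) : IsCoalgHom (F ∘ₗ G) :=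
  ⟨by simp [hG.map_one, hF.map_one],
    by rw [← LinearMap.comp_assoc, hF.counit_comp, hG.counit_comp],
    by rw [← LinearMap.comp_assoc, hF.comul_comp, LinearMap.comp_assoc, hG.comul_comp,
      ← LinearMap.comp_assoc, TensorProduct.map_comp]⟩

theorem IsCoalgHom.conv_comp (hF : IsCoalgHom F) (β : X →ₗ[K] Y →ₗ[K] Z)
    (A : TensorAlgebra K V →ₗ[K] X) (B : TensorAlgebra K V →ₗ[K] Y) :
    conv β A B ∘ₗ F = conv β (A ∘ₗ F) (B ∘ₗ F) := by
  rw [conv_eq_lift_comp, conv_eq_lift_comp, LinearMap.comp_assoc, hF.comul_comp,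
    ← LinearMap.comp_assoc]
  congr 1
  ext
  simp

theorem IsCoderivation.conv_comp (hD : IsCoderivation ρ D) (β : X →ₗ[K] Y →ₗ[K] Z)
    (A : TensorAlgebra K V →ₗ[K] X) (B : TensorAlgebra K V →ₗ[K] Y) :
    conv β A B ∘ₗ D = conv β (A ∘ₗ D) B + conv β (A ∘ₗ ρ) (B ∘ₗ D) := by
  simp only [conv_eq_lift_comp]
  rw [LinearMap.comp_assoc, hD.comul_comp, ← LinearMap.comp_assoc, ← LinearMap.add_comp]
  congr 1
  ext
  simp

theorem IsCoalgHom.eq_conv (hF : IsCoalgHom F) (x : V) (w : TensorAlgebra K V) :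
    F (ι K x * w) = conv concat (ι K ∘ₗ letter ∘ₗ F) F (ι K x * w) := by
  have h := eq_counit_add_conv_letter (F (ι K x * w))
  rwa [show counit (F (ι K x * w)) = 0 by
      simpa [counit_mul] using LinearMap.congr_fun hF.counit_comp (ι K x * w),
    zero_smul, zero_add, ← LinearMap.comp_apply, hF.conv_comp] at h

theorem tmul_one_mul_conv (y : V) (A B : Module.End K (TensorAlgebra K V))
    (w : TensorAlgebra K V) :
    (ι K y ⊗ₜ 1) * conv (TensorProduct.mk K _ _) A B w =
      conv (TensorProduct.mk K _ _) (cons y ∘ₗ A) B w :=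
  apply_conv (φ := LinearMap.mulLeft K (ι K y ⊗ₜ[K] (1 : TensorAlgebra K V)))
    (fun u v => by simp) w

theorem isCoalgHom_tmap (τ : V →ₗ[K] V) : IsCoalgHom (tmap τ).toLinearMap := by
  refine ⟨by simp, linearMap_ext_left (by simp) fun x w _ => by simp [counit_mul], ?_⟩
  rw [map_comp_comul]
  refine linearMap_ext_left (by simp) fun x w h => ?_
  rw [LinearMap.comp_apply, AlgHom.toLinearMap_apply] at h ⊢
  rw [map_mul, tmap_ι, comul_mul, h, conv_mul, tmul_one_mul_conv, tmap_comp_cons]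
  simp

theorem IsCoderivation.conj (hD : IsCoderivation ρ D) (hF : IsCoalgHom F) (hG : IsCoalgHom G)
    (hFG : F ∘ₗ G = LinearMap.id) (hρ : F ∘ₗ ρ = ρ ∘ₗ F) : IsCoderivation ρ (F ∘ₗ D ∘ₗ G) := by
  refine ⟨by simp [hG.map_one, hD.map_one], ?_, ?_⟩
  · rw [← LinearMap.comp_assoc, hF.counit_comp, ← LinearMap.comp_assoc, hD.counit_comp,
      LinearMap.zero_comp]
  · rw [LinearMap.add_comp, map_comp_comul, map_comp_comul, ← LinearMap.comp_assoc, hF.comul_comp,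
      map_comp_comul, ← LinearMap.comp_assoc, hD.conv_comp, LinearMap.add_comp, hG.conv_comp,
      hG.conv_comp, hFG, hρ, LinearMap.comp_assoc G F ρ, hFG, LinearMap.comp_id]
    simp only [LinearMap.comp_assoc]

/-- The map `w ↦ ∑ g(w') w''` over all factorizations `w = w' w''`. -/
def prefixInsertion (g : TensorAlgebra K V →ₗ[K] V) : Module.End K (TensorAlgebra K V) :=
  conv concat (ι K ∘ₗ g) LinearMap.id

theorem counit_comp_prefixInsertion (g : TensorAlgebra K V →ₗ[K] V) :
    counit ∘ₗ prefixInsertion g = 0 := by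
  rw [prefixInsertion, comp_conv, ← LinearMap.map_zero₂ (conv (concat.compr₂ counit))
    (LinearMap.id : Module.End K (TensorAlgebra K V))]
  exact conv_congr fun u v => by simp [counit_mul]

theorem comul_prefixInsertion (g : TensorAlgebra K V →ₗ[K] V) (w : TensorAlgebra K V) :
    comul (prefixInsertion g w) =
      conv (TensorProduct.mk K _ _) (prefixInsertion g) LinearMap.id w +
        1 ⊗ₜ prefixInsertion g w := by
  have cut_suffix : conv (TensorProduct.mk K _ _) (prefixInsertion g) LinearMap.id =
      conv (LinearMap.mul K _ ∘ₗ (TensorProduct.mk K _ _).flip 1) (ι K ∘ₗ g) comul := by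
    rw [comul_eq_conv]
    exact conv_assoc (fun a b c => by simp) _ _ _
  have comul_comp : comul ∘ₗ prefixInsertion g =
      conv (LinearMap.mul K _ ∘ₗ (TensorProduct.mk K _ _).flip 1) (ι K ∘ₗ g) comul +
        TensorProduct.mk K _ _ 1 ∘ₗ prefixInsertion g := by
    rw [prefixInsertion, comp_conv, comp_conv, conv_eq_lift_comp, conv_eq_lift_comp,
      conv_eq_lift_comp, ← LinearMap.add_comp]
    congr 1
    refine TensorProduct.ext' fun u v => ?_
    simp [comul_mul]
  rw [cut_suffix]
  exact LinearMap.congr_fun comul_comp w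

/-- The coderivation relative to `tmap τ` with corestriction `g`, that is
`w ↦ ∑ τ(w') g(w'') w'''` over all factorizations `w = w' w'' w'''`. -/
def coderivation (τ : V →ₗ[K] V) (g : TensorAlgebra K V →ₗ[K] V) :
    Module.End K (TensorAlgebra K V) :=
  conv concat (tmap τ).toLinearMap (prefixInsertion g)

theorem coderivation_one (τ : V →ₗ[K] V) {g : TensorAlgebra K V →ₗ[K] V} (hg : g 1 = 0) :
    coderivation τ g 1 = 0 := by
  simp [coderivation, prefixInsertion, hg]

theorem coderivation_mul (τ : V →ₗ[K] V) (g : TensorAlgebra K V →ₗ[K] V) (x : V)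
    (w : TensorAlgebra K V) :
    coderivation τ g (ι K x * w) =
      ι K (τ x) * coderivation τ g w + prefixInsertion g (ι K x * w) := by
  have cons_conv : ι K (τ x) * conv concat (tmap τ).toLinearMap (prefixInsertion g) w =
      conv concat ((tmap τ).toLinearMap ∘ₗ cons x) (prefixInsertion g) w :=
    apply_conv (φ := cons (τ x)) (fun u v => by simp [mul_assoc]) w
  rw [coderivation, conv_mul, cons_conv]
  simp

theorem letter_comp_coderivation (τ : V →ₗ[K] V) (g : TensorAlgebra K V →ₗ[K] V) :
    letter ∘ₗ coderivation τ g = g := by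
  ext w
  have counit_prefixInsertion (v) : counit (prefixInsertion g v) = 0 :=
    LinearMap.congr_fun (counit_comp_prefixInsertion g) v
  rw [LinearMap.comp_apply, coderivation, apply_conv (β' := LinearMap.lsmul K V) (A' := counit)
    (B' := letter ∘ₗ prefixInsertion g) (fun u v => ?_), counit_conv, LinearMap.comp_apply,
    prefixInsertion, apply_conv (β' := (LinearMap.lsmul K V).flip) (A' := g) (B' := counit)
    (fun u v => by simp), conv_counit]
  have counit_tmap : counit (tmap τ u) = counit u :=
    LinearMap.congr_fun (isCoalgHom_tmap τ).counit_comp u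
  simp [letter_mul, counit_prefixInsertion, counit_tmap]

theorem isCoderivation_coderivation (τ : V →ₗ[K] V) {g : TensorAlgebra K V →ₗ[K] V}
    (hg : g 1 = 0) : IsCoderivation (tmap τ).toLinearMap (coderivation τ g) := by
  set D := coderivation τ g with hD
  have D_one : D 1 = 0 := coderivation_one τ hg
  refine ⟨D_one, ?_, ?_⟩
  · rw [hD, coderivation, comp_conv, ← map_zero (conv (concat.compr₂ counit) (tmap τ).toLinearMap)]
    refine conv_congr fun u v => ?_
    simp [counit_mul, show counit (prefixInsertion g v) = 0 from
      LinearMap.congr_fun (counit_comp_prefixInsertion g) v]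
  · rw [LinearMap.add_comp, map_comp_comul, map_comp_comul]
    refine linearMap_ext_left (by simp [D_one]) fun x w ih => ?_
    have D_comp_cons : D ∘ₗ cons x = cons (τ x) ∘ₗ D + prefixInsertion g ∘ₗ cons x :=
      LinearMap.ext fun w => coderivation_mul τ g x w
    have prefixInsertion_one : prefixInsertion g 1 = 0 := by simp [prefixInsertion, hg]
    simp only [LinearMap.comp_apply, LinearMap.add_apply] at ih ⊢
    rw [show D (ι K x * w) = _ from coderivation_mul τ g x w, map_add, comul_mul, ih,
      comul_prefixInsertion, conv_mul, conv_mul, conv_mul, D_comp_cons, tmap_comp_cons, mul_add,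
      tmul_one_mul_conv, tmul_one_mul_conv, show D (ι K x * w) = _ from coderivation_mul τ g x w]
    simp only [prefixInsertion_one, map_zero, LinearMap.id_coe, id_eq, LinearMap.zero_apply,
      add_zero, map_add, LinearMap.add_apply, D_one, AlgHom.toLinearMap_apply, map_one,
      TensorProduct.mk_apply]
    abel

theorem letter_comp_tmap (τ : V →ₗ[K] V) : letter ∘ₗ (tmap τ).toLinearMap = τ ∘ₗ letter := by
  refine linearMap_ext_left (by simp) fun x w _ => ?_
  have := LinearMap.congr_fun (isCoalgHom_tmap τ).counit_comp w
  simp_all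

theorem IsCoderivation.eq_coderivation {τ : V →ₗ[K] V}
    (hD : IsCoderivation (tmap τ).toLinearMap D) : D = coderivation τ (letter ∘ₗ D) := by
  have first_letter : D = prefixInsertion (letter ∘ₗ D) + conv concat ((ι K ∘ₗ τ) ∘ₗ letter) D := by
    ext w
    have h := eq_counit_add_conv_letter (D w)
    rw [show counit (D w) = 0 from LinearMap.congr_fun hD.counit_comp w, zero_smul, zero_add,
      ← LinearMap.comp_apply, hD.conv_comp] at h
    rw [h, LinearMap.comp_assoc (tmap τ).toLinearMap, letter_comp_tmap]
    rfl
  refine linearMap_ext_left ?_ fun x w ih => ?_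
  · rw [hD.map_one, coderivation_one _ (by simp [hD.map_one])]
  · conv_lhs => rw [first_letter]
    rw [LinearMap.add_apply, conv_letter_mul, ih, coderivation_mul, add_comm]
    rfl

end Deconcatenation

section Words

open TensorAlgebra

variable {K : Type u} [CommRing K] {V : Type v} [AddCommGroup V] [Module K V]
variable {X Y Z : Type*} [AddCommGroup X] [Module K X] [AddCommGroup Y] [Module K Y]
  [AddCommGroup Z] [Module K Z]
variable {F : TensorAlgebra K V →ₗ[K] TensorAlgebra K V}

/-- The word `o_0 ⋯ o_{n-1}`; the letters with index `≥ n` are ignored. -/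
def word (K : Type u) [CommRing K] {V : Type v} [AddCommGroup V] [Module K V]
    (n : ℕ) (o : ℕ → V) : TensorAlgebra K V :=
  tprod K V n fun i => o i

@[simp] theorem word_zero (o : ℕ → V) : word K 0 o = 1 := by
  simp [word]

theorem word_succ (n : ℕ) (o : ℕ → V) :
    word K (n + 1) o = ι K (o 0) * word K n (fun i => o (i + 1)) := by
  simp [word, tprod_apply, List.ofFn_succ]

theorem word_congr {n : ℕ} {o o' : ℕ → V} (h : ∀ i < n, o i = o' i) :
    word K n o = word K n o' :=
  congrArg (tprod K V n) (funext fun i => h i i.2)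

theorem word_one (o : ℕ → V) : word K 1 o = ι K (o 0) := by
  simp [word_succ]

theorem word_eq_zero {n i : ℕ} (hi : i < n) {o : ℕ → V} (h : o i = 0) : word K n o = 0 :=
  (tprod K V n).map_coord_zero ⟨i, hi⟩ h

theorem word_mul_word (j m : ℕ) (o o' : ℕ → V) :
    word K j o * word K m o' = word K (j + m) fun i => if i < j then o i else o' (i - j) := by
  induction j generalizing o with
  | zero => simp
  | succ j ih => simp [word_succ, mul_assoc, ih, Nat.add_right_comm j 1 m]

theorem ι_mul_word (x : V) (n : ℕ) (o : ℕ → V) :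
    ι K x * word K n o = word K (n + 1) fun i => if i = 0 then x else o (i - 1) := by
  simp [word_succ]

theorem exists_word_eq_tprod (n : ℕ) (x : Fin n → V) : ∃ o, word K n o = tprod K V n x :=
  ⟨fun i => if h : i < n then x ⟨i, h⟩ else 0, congrArg (tprod K V n) (by ext i; simp)⟩

theorem tmap_tprod (τ : V →ₗ[K] V) (n : ℕ) (x : Fin n → V) :
    tmap τ (tprod K V n x) = tprod K V n fun i => τ (x i) := by
  simp [tprod_apply, map_list_prod, List.map_ofFn, Function.comp_def]

theorem tmap_word (τ : V →ₗ[K] V) (n : ℕ) (o : ℕ → V) :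
    tmap τ (word K n o) = word K n (fun i => τ (o i)) :=
  tmap_tprod τ n fun i => o i

theorem span_words :
    Submodule.span K {w | ∃ n, ∃ o : ℕ → V, w = word K n o} = ⊤ := by
  set p := Submodule.span K {w | ∃ n, ∃ o : ℕ → V, w = word K n o} with hp
  have cons_mem (x : V) : p ≤ p.comap (cons x) := by
    conv_lhs => rw [hp]
    rw [Submodule.span_le]
    rintro _ ⟨n, o, rfl⟩
    exact Submodule.subset_span ⟨n + 1, _, ι_mul_word x n o⟩
  refine (Submodule.eq_top_iff'.2 fun w => ?_)
  induction w using induction_left with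
  | one => exact Submodule.subset_span ⟨0, fun _ => 0, by simp⟩
  | mul x w ih => exact cons_mem x ih
  | add a b ha hb => exact p.add_mem ha hb
  | smul c a ha => exact p.smul_mem c ha

theorem word_mem_span_words {s : Set V} (h0 : (0 : V) ∈ s) (hs : Submodule.span K s = ⊤) (n : ℕ)
    (o : ℕ → V) :
    word K n o ∈ Submodule.span K {w | ∃ o' : ℕ → V, (∀ i, o' i ∈ s) ∧ w = word K n o'} := by
  induction n generalizing o with
  | zero => exact Submodule.subset_span ⟨fun _ => 0, fun _ => h0, by simp⟩
  | succ n ih =>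
    set p := Submodule.span K {w | ∃ o' : ℕ → V, (∀ i, o' i ∈ s) ∧ w = word K (n + 1) o'}
    have cons_mem {x w} (hx : x ∈ s)
        (hw : w ∈ Submodule.span K {w | ∃ o' : ℕ → V, (∀ i, o' i ∈ s) ∧ w = word K n o'}) :
        ι K x * w ∈ p := by
      refine (Submodule.span_le (p := p.comap (cons x))).2 ?_ hw
      rintro _ ⟨o', ho', rfl⟩
      refine Submodule.subset_span ⟨_, fun i => ?_, ι_mul_word x n o'⟩
      split_ifs
      exacts [hx, ho' _]
    have head_mem : o 0 ∈ Submodule.span K s := by rw [hs]; trivial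
    have tail_mem := ih fun i => o (i + 1)
    rw [word_succ]
    generalize word K n (fun i => o (i + 1)) = w at tail_mem ⊢
    generalize o 0 = x at head_mem ⊢
    induction head_mem using Submodule.span_induction with
    | mem x hx => exact cons_mem hx tail_mem
    | zero => simp
    | add a b _ _ ha hb => rw [map_add, add_mul]; exact p.add_mem ha hb
    | smul c a _ ha => rw [map_smul, smul_mul_assoc]; exact p.smul_mem c ha

theorem apply_word_eq_of_span {A B : TensorAlgebra K V →ₗ[K] X} {s : Set V} {n : ℕ}
    (h0 : (0 : V) ∈ s) (hs : Submodule.span K s = ⊤)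
    (h : ∀ o : ℕ → V, (∀ i, o i ∈ s) → A (word K n o) = B (word K n o)) (o : ℕ → V) :
    A (word K n o) = B (word K n o) := by
  refine LinearMap.eqOn_span ?_ (word_mem_span_words h0 hs n o)
  rintro _ ⟨o', ho', rfl⟩
  exact h o' ho'

theorem ext_words {A B : TensorAlgebra K V →ₗ[K] X}
    (h : ∀ n (o : ℕ → V), A (word K n o) = B (word K n o)) : A = B := by
  apply LinearMap.ext_on span_words
  rintro _ ⟨n, o, rfl⟩
  exact h n o

theorem ext_words_of_span {A B : TensorAlgebra K V →ₗ[K] X} {s : Set V} (h0 : (0 : V) ∈ s)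
    (hs : Submodule.span K s = ⊤)
    (h : ∀ n (o : ℕ → V), (∀ i, o i ∈ s) → A (word K n o) = B (word K n o)) : A = B :=
  ext_words fun n => apply_word_eq_of_span h0 hs (h n)

/-- The linear map on the tensor algebra assembled from multilinear maps in all arities. -/
def ofFamily (g : ∀ n : ℕ, MultilinearMap K (fun _ : Fin n => V) X) : TensorAlgebra K V →ₗ[K] X :=
  DirectSum.toModule K ℕ X (fun n => PiTensorProduct.lift (g n)) ∘ₗ
    (TensorAlgebra.toDirectSum (R := K) (M := V)).toLinearMap

theorem ofFamily_tprod (g : ∀ n : ℕ, MultilinearMap K (fun _ : Fin n => V) X) (n : ℕ)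
    (x : Fin n → V) : ofFamily g (tprod K V n x) = g n x := by
  simp only [ofFamily, LinearMap.comp_apply, AlgHom.toLinearMap_apply,
    toDirectSum_tensorPower_tprod]
  rw [← DirectSum.lof_eq_of K, DirectSum.toModule_lof, PiTensorProduct.lift.tprod]

theorem ofFamily_word (g : ∀ n : ℕ, MultilinearMap K (fun _ : Fin n => V) X) (n : ℕ)
    (o : ℕ → V) : ofFamily g (word K n o) = g n (fun i => o i) :=
  ofFamily_tprod g n _

theorem conv_word (β : X →ₗ[K] Y →ₗ[K] Z) (A : TensorAlgebra K V →ₗ[K] X)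
    (B : TensorAlgebra K V →ₗ[K] Y) (n : ℕ) (o : ℕ → V) :
    conv β A B (word K n o) = ∑ k ∈ Finset.range (n + 1),
      β (A (word K k o)) (B (word K (n - k) fun i => o (k + i))) := by
  induction n generalizing A o with
  | zero => simp
  | succ n ih =>
    rw [word_succ n o, conv_mul, ih, Finset.sum_range_succ' _ (n + 1), ← word_succ n o]
    congr 1
    · refine Finset.sum_congr rfl fun k _ => ?_
      simp [word_succ k o, Nat.add_right_comm k 1, add_assoc]
    · simp

theorem prefixInsertion_word {g : TensorAlgebra K V →ₗ[K] V} (hg : g 1 = 0) (n : ℕ)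
    (o : ℕ → V) : prefixInsertion g (word K n o) = ∑ l ∈ Finset.Icc 1 n,
      ι K (g (word K l o)) * word K (n - l) fun i => o (l + i) := by
  rw [prefixInsertion, conv_word, Finset.sum_range_succ', ← Finset.Ico_add_one_right_eq_Icc,
    Finset.sum_Ico_eq_sum_range]
  simp [hg, add_comm]

theorem coderivation_word (τ : V →ₗ[K] V) {g : TensorAlgebra K V →ₗ[K] V} (hg : g 1 = 0) (n : ℕ)
    (o : ℕ → V) :
    coderivation τ g (word K n o) = ∑ l ∈ Finset.Icc 1 n, ∑ j ∈ Finset.range (n + 1 - l),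
      word K (n + 1 - l) (fun i => if i < j then τ (o i)
        else if i = j then g (word K l fun t => o (j + t)) else o (i + l - 1)) := by
  have insert_word {l j : ℕ} (hlj : j + l ≤ n) (hl : 1 ≤ l) :
      tmap τ (word K j o) * (ι K (g (word K l fun t => o (j + t))) *
        word K (n - j - l) fun i => o (j + (l + i))) =
      word K (n + 1 - l) (fun i => if i < j then τ (o i)
        else if i = j then g (word K l fun t => o (j + t)) else o (i + l - 1)) := by
    rw [tmap_word, ι_mul_word, word_mul_word, show n + 1 - l = j + (n - j - l + 1) by omega]
    refine word_congr fun i _ => ?_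
    rcases lt_trichotomy i j with h | rfl | h
    · simp [h]
    · simp
    · obtain ⟨k, rfl⟩ := Nat.exists_eq_add_of_lt h
      simp [show ¬j + k + 1 < j by omega, show j + k + 1 ≠ j by omega,
        show j + k + 1 - j = k + 1 by omega, show j + k + 1 + l - 1 = j + (l + k) by omega]
  simp only [coderivation, conv_word, prefixInsertion_word hg, map_sum]
  rw [Finset.sum_comm' (t' := Finset.Icc 1 n) (s' := fun l => Finset.range (n + 1 - l))
    fun j l => by simp only [Finset.mem_range, Finset.mem_Icc]; omega]
  refine Finset.sum_congr rfl fun l hl => Finset.sum_congr rfl fun j hj => ?_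
  rw [Finset.mem_range] at hj
  exact insert_word (by omega) (Finset.mem_Icc.1 hl).1

/-- The product of the letters `f(b)`, where `b` runs through the consecutive blocks of a word
with prescribed lengths. -/
def blockProd (f : TensorAlgebra K V →ₗ[K] V) : List ℕ → (ℕ → V) → TensorAlgebra K V
  | [], _ => 1
  | b :: l, o => ι K (f (word K b o)) * blockProd f l (fun i => o (b + i))

theorem tprod_eq_blockProd (f : TensorAlgebra K V →ₗ[K] V) (l : List ℕ) (o : ℕ → V) :
    tprod K V l.length (fun i => f (word K (l.get i) fun t => o ((l.take i).sum + t))) =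
      blockProd f l o := by
  induction l generalizing o with
  | nil => simp [blockProd]
  | cons b l ih =>
    rw [blockProd, ← ih, tprod_apply, tprod_apply]
    simp [List.ofFn_succ, add_assoc]

theorem sum_composition_succ {M : Type*} [AddCommMonoid M] (n : ℕ) (φ : List ℕ → M) :
    ∑ c : Composition (n + 1), φ c.blocks =
      ∑ k ∈ Finset.range (n + 1), ∑ c : Composition (n - k), φ ((k + 1) :: c.blocks) := by
  rw [Finset.sum_sigma']
  symm
  refine Finset.sum_bij (fun p hp => ⟨(p.1 + 1) :: p.2.blocks, ?_, ?_⟩) ?_ ?_ ?_ ?_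
  · intro i hi
    rcases List.mem_cons.1 hi with rfl | hi
    exacts [Nat.succ_pos _, p.2.blocks_pos hi]
  · have := Finset.mem_range.1 (Finset.mem_sigma.1 hp).1
    rw [List.sum_cons, p.2.blocks_sum]
    omega
  · intros; simp
  · rintro ⟨k, c⟩ _ ⟨k', c'⟩ _ h
    simp only [Composition.mk.injEq, List.cons.injEq, Nat.add_right_cancel_iff] at h
    obtain ⟨rfl, h⟩ := h
    rw [Composition.ext h]
  · rintro ⟨_ | ⟨a, b⟩, hb, hs⟩ _
    · simp at hs
    · have ha : 0 < a := hb (by simp)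
      rw [List.sum_cons] at hs
      refine ⟨⟨a - 1, ⟨b, fun hi => hb (List.mem_cons_of_mem _ hi), by omega⟩⟩, ?_, ?_⟩
      · simp; omega
      · ext1
        simp; omega
  · intros; rfl

theorem IsCoalgHom.word_eq_sum_blockProd (hF : IsCoalgHom F) (n : ℕ) (o : ℕ → V) :
    F (word K n o) = ∑ c : Composition n, blockProd (letter ∘ₗ F) c.blocks o := by
  induction n using Nat.strong_induction_on generalizing o with
  | _ n ih =>
    cases n with
    | zero =>
      have blocks_eq_nil (c : Composition 0) : c.blocks = [] := c.blocks_eq_nil.2 rfl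
      have : Subsingleton (Composition 0) :=
        ⟨fun c c' => Composition.ext (by rw [blocks_eq_nil, blocks_eq_nil])⟩
      rw [Fintype.sum_subsingleton _ (Composition.ones 0), blocks_eq_nil, word_zero, hF.map_one]
      rfl
    | succ n =>
      rw [sum_composition_succ n fun l => blockProd (letter ∘ₗ F) l o, word_succ, hF.eq_conv,
        ← word_succ, conv_word, Finset.sum_range_succ']
      simp only [LinearMap.comp_apply, word_zero, hF.map_one, letter_one, map_zero,
        LinearMap.zero_apply, add_zero, LinearMap.mul_apply']
      refine Finset.sum_congr rfl fun k _ => ?_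
      rw [Nat.add_sub_add_right, ih (n - k) (by omega), Finset.mul_sum]
      rfl

theorem IsCoalgHom.word_eq_sum_tprod (hF : IsCoalgHom F) (n : ℕ) (o : ℕ → V) :
    F (word K n o) = ∑ c : Composition n, tprod K V c.length (fun i =>
      letter (F (tprod K V (c.blocksFun i) fun t => o (c.embedding i t : ℕ)))) := by
  rw [hF.word_eq_sum_blockProd]
  exact Finset.sum_congr rfl fun c _ => (tprod_eq_blockProd (letter ∘ₗ F) c.blocks o).symm

/-- The span of the words of length at most `n`. -/
def wordsLE (K : Type u) [CommRing K] (V : Type v) [AddCommGroup V] [Module K V] (n : ℕ) :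
    Submodule K (TensorAlgebra K V) :=
  Submodule.span K {w | ∃ k ≤ n, ∃ o : ℕ → V, w = word K k o}

theorem word_mem_wordsLE {k n : ℕ} (h : k ≤ n) (o : ℕ → V) : word K k o ∈ wordsLE K V n :=
  Submodule.subset_span ⟨k, h, o, rfl⟩

theorem wordsLE_mono {k n : ℕ} (h : k ≤ n) : wordsLE K V k ≤ wordsLE K V n := by
  refine Submodule.span_mono ?_
  rintro _ ⟨j, hj, o, rfl⟩
  exact ⟨j, hj.trans h, o, rfl⟩

theorem one_mem_wordsLE (n : ℕ) : (1 : TensorAlgebra K V) ∈ wordsLE K V n := by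
  simpa using word_mem_wordsLE (K := K) (Nat.zero_le n) (fun _ => (0 : V))

theorem ι_mem_wordsLE {n : ℕ} (hn : 1 ≤ n) (x : V) : ι K x ∈ wordsLE K V n := by
  simpa only [word_one] using word_mem_wordsLE (K := K) hn fun _ => x

theorem exists_mem_wordsLE (w : TensorAlgebra K V) : ∃ n, w ∈ wordsLE K V n := by
  have directed : Directed (· ≤ ·) (wordsLE K V) := Monotone.directed_le fun _ _ => wordsLE_mono
  rw [← Submodule.mem_iSup_of_directed _ directed]
  have hw : w ∈ (⊤ : Submodule K (TensorAlgebra K V)) := trivial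
  rw [← span_words] at hw
  refine Submodule.span_le.2 ?_ hw
  rintro _ ⟨n, o, rfl⟩
  exact Submodule.mem_iSup_of_mem n (word_mem_wordsLE le_rfl o)

theorem eqOn_wordsLE {A B : TensorAlgebra K V →ₗ[K] X} {n : ℕ}
    (h : ∀ k ≤ n, ∀ o : ℕ → V, A (word K k o) = B (word K k o)) :
    ∀ w ∈ wordsLE K V n, A w = B w := by
  refine LinearMap.eqOn_span ?_
  rintro _ ⟨k, hk, o, rfl⟩
  exact h k hk o

theorem eq_counit_add_ι_letter :
    ∀ w ∈ wordsLE K V 1, w = counit w • 1 + ι K (letter w) := by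
  refine eqOn_wordsLE (A := LinearMap.id)
    (B := LinearMap.toSpanSingleton K (TensorAlgebra K V) 1 ∘ₗ counit + ι K ∘ₗ letter)
    fun k hk o => ?_
  interval_cases k <;> simp [word_one]

theorem map_mem_of_words {A : TensorAlgebra K V →ₗ[K] X} {n : ℕ} {p : Submodule K X}
    (h : ∀ k ≤ n, ∀ o : ℕ → V, A (word K k o) ∈ p) : ∀ w ∈ wordsLE K V n, A w ∈ p := by
  refine (Submodule.span_le (p := p.comap A)).2 ?_
  rintro _ ⟨k, hk, o, rfl⟩
  exact h k hk o

theorem ext_wordsLE {A B : TensorAlgebra K V →ₗ[K] X}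
    (h : ∀ n, ∀ w ∈ wordsLE K V n, A w = B w) : A = B :=
  ext_words fun n o => h n _ (word_mem_wordsLE le_rfl o)

theorem conv_eqOn_wordsLE (β : X →ₗ[K] Y →ₗ[K] Z) {A A' : TensorAlgebra K V →ₗ[K] X}
    {B B' : TensorAlgebra K V →ₗ[K] Y} {n : ℕ} (hA : ∀ w ∈ wordsLE K V n, A w = A' w)
    (hB : ∀ w ∈ wordsLE K V n, B w = B' w) :
    ∀ w ∈ wordsLE K V n, conv β A B w = conv β A' B' w := by
  refine eqOn_wordsLE fun k hk o => ?_
  rw [conv_word, conv_word]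
  refine Finset.sum_congr rfl fun j hj => ?_
  have := Finset.mem_range.1 hj
  rw [hA _ (word_mem_wordsLE (by omega) _), hB _ (word_mem_wordsLE (by omega) _)]

theorem IsCoalgHom.map_mem_wordsLE (hF : IsCoalgHom F) {n : ℕ} :
    ∀ w ∈ wordsLE K V n, F w ∈ wordsLE K V n := by
  refine map_mem_of_words fun k hk o => ?_
  rw [hF.word_eq_sum_tprod]
  refine Submodule.sum_mem _ fun c _ => ?_
  obtain ⟨o', ho'⟩ := exists_word_eq_tprod (K := K) c.length fun i =>
    letter (F (tprod K V (c.blocksFun i) fun t => o (c.embedding i t : ℕ)))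
  rw [← ho']
  exact word_mem_wordsLE (c.length_le.trans hk) _

theorem coderivation_mem_wordsLE (τ : V →ₗ[K] V) {g : TensorAlgebra K V →ₗ[K] V} {p n : ℕ}
    (hg : ∀ w ∈ wordsLE K V p, g w = 0) :
    ∀ w ∈ wordsLE K V (n + p), coderivation τ g w ∈ wordsLE K V n := by
  refine map_mem_of_words fun k hk o => ?_
  rw [coderivation_word τ (hg 1 (one_mem_wordsLE p))]
  refine Submodule.sum_mem _ fun l hl => Submodule.sum_mem _ fun j hj => ?_
  rw [Finset.mem_Icc] at hl
  rcases le_or_gt l p with hlp | hlp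
  · rw [word_eq_zero (Finset.mem_range.1 hj) (by simp [hg _ (word_mem_wordsLE hlp _)])]
    exact Submodule.zero_mem _
  · exact word_mem_wordsLE (by omega) _

theorem coderivation_eq_zero_of_vanish (τ : V →ₗ[K] V) {g : TensorAlgebra K V →ₗ[K] V} {n : ℕ}
    (hg : ∀ w ∈ wordsLE K V n, g w = 0) : ∀ w ∈ wordsLE K V n, coderivation τ g w = 0 := by
  refine eqOn_wordsLE (B := 0) fun k hk o => ?_
  rw [coderivation_word τ (hg 1 (one_mem_wordsLE n))]
  refine Finset.sum_eq_zero fun l hl => Finset.sum_eq_zero fun j hj => ?_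
  exact word_eq_zero (Finset.mem_range.1 hj)
    (by simp [hg _ (word_mem_wordsLE ((Finset.mem_Icc.1 hl).2.trans hk) _)])

theorem coderivation_eq_ι_of_vanish (τ : V →ₗ[K] V) {g : TensorAlgebra K V →ₗ[K] V} {n : ℕ}
    (hg : ∀ w ∈ wordsLE K V n, g w = 0) :
    ∀ w ∈ wordsLE K V (n + 1), coderivation τ g w = ι K (g w) := by
  intro w hw
  have hg1 : g 1 = 0 := hg 1 (one_mem_wordsLE n)
  have counit_eq : counit (coderivation τ g w) = 0 :=
    LinearMap.congr_fun (isCoderivation_coderivation τ hg1).counit_comp w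
  have letter_eq : letter (coderivation τ g w) = g w :=
    LinearMap.congr_fun (letter_comp_coderivation τ g) w
  rw [eq_counit_add_ι_letter _ (coderivation_mem_wordsLE τ hg w (by rwa [add_comm 1])), counit_eq,
    letter_eq, zero_smul, zero_add]

end Words

section LocalNilpotence

open TensorAlgebra TensorProduct

variable {K : Type u} [CommRing K]
variable {M N : Type*} [AddCommGroup M] [Module K M] [AddCommGroup N] [Module K N]

/-- Every vector is annihilated by some power of `A`, so that the exponential series of `A`
terminates on every vector. -/
def IsLocallyNilpotent (A : Module.End K M) : Prop :=
  ∀ x, ∃ n, (A ^ n) x = 0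

namespace IsLocallyNilpotent

variable {A B : Module.End K M}

theorem zero : IsLocallyNilpotent (0 : Module.End K M) :=
  fun _ => ⟨1, rfl⟩

theorem neg (hA : IsLocallyNilpotent A) : IsLocallyNilpotent (-A) := fun x => by
  obtain ⟨n, hn⟩ := hA x
  exact ⟨n, by rw [neg_pow, Module.End.mul_apply, hn, map_zero]⟩

theorem exists_isNilpotent_restrict (hA : IsLocallyNilpotent A) (hB : IsLocallyNilpotent B)
    (h : Commute A B) (x : M) :
    ∃ (S : Submodule K M) (hAS : ∀ y ∈ S, A y ∈ S) (hBS : ∀ y ∈ S, B y ∈ S), x ∈ S ∧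
      IsNilpotent (A.restrict hAS) ∧ IsNilpotent (B.restrict hBS) := by
  obtain ⟨n, hn⟩ := hA x
  obtain ⟨m, hm⟩ := hB x
  have mapsTo {C C' : Module.End K M} (hC : Commute C C') (k : ℕ) {y : M}
      (hy : y ∈ LinearMap.ker (C' ^ k)) : C y ∈ LinearMap.ker (C' ^ k) := by
    rw [LinearMap.mem_ker, ← Module.End.mul_apply, ← (hC.pow_right k).eq, Module.End.mul_apply,
      LinearMap.mem_ker.1 hy, map_zero]
  have stable_A : ∀ y ∈ LinearMap.ker (A ^ n) ⊓ LinearMap.ker (B ^ m),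
      A y ∈ LinearMap.ker (A ^ n) ⊓ LinearMap.ker (B ^ m) :=
    fun y hy => ⟨mapsTo (Commute.refl A) n hy.1, mapsTo h m hy.2⟩
  have stable_B : ∀ y ∈ LinearMap.ker (A ^ n) ⊓ LinearMap.ker (B ^ m),
      B y ∈ LinearMap.ker (A ^ n) ⊓ LinearMap.ker (B ^ m) :=
    fun y hy => ⟨mapsTo h.symm n hy.1, mapsTo (Commute.refl B) m hy.2⟩
  refine ⟨_, stable_A, stable_B, ⟨hn, hm⟩, ⟨n, ?_⟩, ⟨m, ?_⟩⟩
  · rw [Module.End.pow_restrict]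
    exact LinearMap.ext fun y => Subtype.ext y.2.1
  · rw [Module.End.pow_restrict]
    exact LinearMap.ext fun y => Subtype.ext y.2.2

theorem add (hA : IsLocallyNilpotent A) (hB : IsLocallyNilpotent B) (h : Commute A B) :
    IsLocallyNilpotent (A + B) := fun x => by
  obtain ⟨S, hAS, hBS, hx, hA', hB'⟩ := hA.exists_isNilpotent_restrict hB h x
  have comm : Commute (A.restrict hAS) (B.restrict hBS) := LinearMap.restrict_commute h hAS hBS
  have nilpotent : IsNilpotent ((A + B).restrict (p := S) (q := S)
      fun y hy => S.add_mem (hAS y hy) (hBS y hy)) := comm.isNilpotent_add hA' hB'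
  obtain ⟨n, hn⟩ := nilpotent
  refine ⟨n, ?_⟩
  rw [Module.End.pow_restrict] at hn
  exact congrArg Subtype.val (LinearMap.congr_fun hn ⟨x, hx⟩)

variable (N) in
theorem rTensor (hA : IsLocallyNilpotent A) : IsLocallyNilpotent (A.rTensor N) := fun t => by
  induction t using TensorProduct.induction_on with
  | zero => exact ⟨0, map_zero _⟩
  | tmul x y =>
    obtain ⟨n, hn⟩ := hA x
    exact ⟨n, by rw [LinearMap.rTensor_pow, LinearMap.rTensor_tmul, hn, zero_tmul]⟩
  | add s t hs ht =>
    obtain ⟨n, hn⟩ := hs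
    obtain ⟨m, hm⟩ := ht
    exact ⟨max n m, by rw [map_add, Module.End.pow_map_zero_of_le (le_max_left n m) hn,
      Module.End.pow_map_zero_of_le (le_max_right n m) hm, add_zero]⟩

variable (N) in
theorem lTensor (hA : IsLocallyNilpotent A) : IsLocallyNilpotent (A.lTensor N) := fun t => by
  induction t using TensorProduct.induction_on with
  | zero => exact ⟨0, map_zero _⟩
  | tmul x y =>
    obtain ⟨n, hn⟩ := hA y
    exact ⟨n, by rw [LinearMap.lTensor_pow, LinearMap.lTensor_tmul, hn, tmul_zero]⟩
  | add s t hs ht =>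
    obtain ⟨n, hn⟩ := hs
    obtain ⟨m, hm⟩ := ht
    exact ⟨max n m, by rw [map_add, Module.End.pow_map_zero_of_le (le_max_left n m) hn,
      Module.End.pow_map_zero_of_le (le_max_right n m) hm, add_zero]⟩

end IsLocallyNilpotent

variable {V : Type v} [AddCommGroup V] [Module K V] {g : TensorAlgebra K V →ₗ[K] V}

theorem isCoderivation_coderivation_id (hg : g 1 = 0) :
    IsCoderivation LinearMap.id (coderivation LinearMap.id g) := by
  have h := isCoderivation_coderivation LinearMap.id hg
  rwa [tmap_id] at h

theorem isLocallyNilpotent_coderivation (τ : V →ₗ[K] V) (hg : ∀ w ∈ wordsLE K V 1, g w = 0) :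
    IsLocallyNilpotent (coderivation τ g) := fun w => by
  obtain ⟨n, hn⟩ := exists_mem_wordsLE w
  refine ⟨n + 1, ?_⟩
  induction n generalizing w with
  | zero => simpa using coderivation_eq_zero_of_vanish τ hg w (wordsLE_mono zero_le_one hn)
  | succ n ih =>
    rw [pow_succ, Module.End.mul_apply]
    exact ih _ (coderivation_mem_wordsLE τ hg w hn)

end LocalNilpotence

section Exponential

open TensorAlgebra TensorProduct

variable {K : Type u} [Field K]
variable {M N : Type*} [AddCommGroup M] [Module K M] [AddCommGroup N] [Module K N]

namespace IsLocallyNilpotent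

variable {A B : Module.End K M} {E : Module.End K N}

theorem finite_support (hA : IsLocallyNilpotent A) (x : M) :
    (Function.support fun i => (i.factorial : K)⁻¹ • (A ^ i) x).Finite := by
  obtain ⟨n, hn⟩ := hA x
  refine (Finset.range n).finite_toSet.subset fun i hi => ?_
  contrapose! hi
  simp only [Finset.coe_range, Set.mem_Iio, not_lt] at hi
  simp [Module.End.pow_map_zero_of_le hi hn]

/-- The exponential of a locally nilpotent endomorphism. -/
noncomputable def exp (hA : IsLocallyNilpotent A) : Module.End K M where
  toFun x := ∑ᶠ i, (i.factorial : K)⁻¹ • (A ^ i) x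
  map_add' x y := by
    simp only [map_add, smul_add]
    exact finsum_add_distrib (hA.finite_support x) (hA.finite_support y)
  map_smul' c x := by
    simp only [map_smul, smul_comm _ c, RingHom.id_apply]
    exact (smul_finsum c _).symm

theorem exp_apply (hA : IsLocallyNilpotent A) {n : ℕ} {x : M} (hx : (A ^ n) x = 0) :
    hA.exp x = ∑ i ∈ Finset.range n, (i.factorial : K)⁻¹ • (A ^ i) x := by
  refine finsum_eq_sum_of_support_subset _ fun i hi => ?_
  contrapose! hi
  simp only [Finset.coe_range, Set.mem_Iio, not_lt] at hi
  simp [Module.End.pow_map_zero_of_le hi hx]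

theorem exp_apply_of_sq_eq_zero (hA : IsLocallyNilpotent A) {x : M} (hx : A (A x) = 0) :
    hA.exp x = x + A x := by
  rw [hA.exp_apply (n := 2) (by simpa [pow_two] using hx)]
  simp [Finset.sum_range_succ]

theorem comp_exp (hA : IsLocallyNilpotent A) (hE : IsLocallyNilpotent E) {φ : M →ₗ[K] N}
    (h : φ ∘ₗ A = E ∘ₗ φ) : φ ∘ₗ hA.exp = hE.exp ∘ₗ φ := by
  have comp_pow (i : ℕ) : φ ∘ₗ (A ^ i) = (E ^ i) ∘ₗ φ :=
    (Module.End.commute_pow_left_of_commute h.symm i).symm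
  ext x
  obtain ⟨n, hn⟩ := hA x
  have hn' : (E ^ n) (φ x) = 0 := by
    rw [← LinearMap.comp_apply, ← comp_pow, LinearMap.comp_apply, hn, map_zero]
  rw [LinearMap.comp_apply, LinearMap.comp_apply, hA.exp_apply hn, hE.exp_apply hn', map_sum]
  refine Finset.sum_congr rfl fun i _ => ?_
  rw [map_smul, ← LinearMap.comp_apply, comp_pow, LinearMap.comp_apply]

theorem exp_zero : (zero (K := K) (M := M)).exp = 1 :=
  LinearMap.ext fun x => by rw [exp_apply_of_sq_eq_zero _ rfl]; simp

theorem comp_exp_of_comp_eq_zero (hA : IsLocallyNilpotent A) {φ : M →ₗ[K] N}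
    (h : φ ∘ₗ A = 0) : φ ∘ₗ hA.exp = φ := by
  rw [hA.comp_exp zero (by rw [h, LinearMap.zero_comp]), exp_zero]
  rfl

theorem exp_mem (hA : IsLocallyNilpotent A) {p : Submodule K M} (h : ∀ x ∈ p, A x ∈ p) :
    ∀ x ∈ p, hA.exp x ∈ p := by
  intro x hx
  obtain ⟨n, hn⟩ := hA x
  rw [hA.exp_apply hn]
  exact p.sum_mem fun i _ => p.smul_mem _ (Module.End.pow_apply_mem_of_forall_mem i h x hx)

theorem exp_add [CharZero K] (hA : IsLocallyNilpotent A) (hB : IsLocallyNilpotent B)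
    (h : Commute A B) : (hA.add hB h).exp = hA.exp * hB.exp := by
  ext x
  obtain ⟨S, hAS, hBS, hx, hA', hB'⟩ := hA.exists_isNilpotent_restrict hB h x
  let _ : Module ℚ (Module.End K S) := Module.compHom _ (algebraMap ℚ K)
  have exp_restrict {C : Module.End K M} (hC : IsLocallyNilpotent C) (hCS : ∀ y ∈ S, C y ∈ S)
      (hC' : IsNilpotent (C.restrict hCS)) (y : S) :
      (IsNilpotent.exp (C.restrict hCS) y : M) = hC.exp y := by
    obtain ⟨n, hn⟩ := hC'
    have hy : (C ^ n) y = 0 := by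
      rw [Module.End.pow_restrict] at hn
      exact congrArg Subtype.val (LinearMap.congr_fun hn y)
    rw [IsNilpotent.exp_eq_sum hn, hC.exp_apply hy, LinearMap.sum_apply, Submodule.coe_sum]
    refine Finset.sum_congr rfl fun i _ => ?_
    rw [Module.End.pow_restrict]
    change algebraMap ℚ K _ • (C ^ i) (y : M) = _
    simp
  have comm : Commute (A.restrict hAS) (B.restrict hBS) := LinearMap.restrict_commute h hAS hBS
  have key := congrArg Subtype.val (LinearMap.congr_fun
    (IsNilpotent.exp_add_of_commute comm hA' hB') ⟨x, hx⟩)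
  have h_add : IsNilpotent ((A + B).restrict (p := S) (q := S)
      fun y hy => S.add_mem (hAS y hy) (hBS y hy)) := comm.isNilpotent_add hA' hB'
  rw [Module.End.mul_apply, exp_restrict hA hAS hA', exp_restrict hB hBS hB'] at key
  rw [Module.End.mul_apply, ← key, ← exp_restrict (hA.add hB h) _ h_add ⟨x, hx⟩]
  rfl

theorem exp_mul_exp_neg [CharZero K] (hA : IsLocallyNilpotent A) :
    hA.exp * hA.neg.exp = 1 := by
  rw [← hA.exp_add hA.neg (Commute.refl A).neg_right, ← exp_zero]
  congr 1
  exact add_neg_cancel A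

variable (N) in
theorem exp_rTensor (hA : IsLocallyNilpotent A) :
    (hA.rTensor N).exp = hA.exp.rTensor N := by
  refine TensorProduct.ext' fun x y => ?_
  have comm : (TensorProduct.mk K M N).flip y ∘ₗ A =
      A.rTensor N ∘ₗ (TensorProduct.mk K M N).flip y := rfl
  exact (LinearMap.congr_fun (hA.comp_exp (hA.rTensor N) comm) x).symm

variable (N) in
theorem exp_lTensor (hA : IsLocallyNilpotent A) :
    (hA.lTensor N).exp = hA.exp.lTensor N := by
  refine TensorProduct.ext' fun y x => ?_
  have comm : TensorProduct.mk K N M y ∘ₗ A = A.lTensor N ∘ₗ TensorProduct.mk K N M y := rfl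
  exact (LinearMap.congr_fun (hA.comp_exp (hA.lTensor N) comm) x).symm

end IsLocallyNilpotent

variable {V : Type v} [AddCommGroup V] [Module K V] {g : TensorAlgebra K V →ₗ[K] V}

/-- Deconcatenation intertwines `D` with `D ⊗ 1 + 1 ⊗ D`, a sum of commuting endomorphisms. -/
theorem isCoalgHom_exp [CharZero K] {D : Module.End K (TensorAlgebra K V)}
    (hD : IsCoderivation LinearMap.id D) (hD' : IsLocallyNilpotent D) : IsCoalgHom hD'.exp := by
  have comm : Commute (D.rTensor (TensorAlgebra K V)) (D.lTensor (TensorAlgebra K V)) :=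
    TensorProduct.ext' fun _ _ => rfl
  refine ⟨?_, hD'.comp_exp_of_comp_eq_zero hD.counit_comp, ?_⟩
  · rw [hD'.exp_apply_of_sq_eq_zero (by simp [hD.map_one]), hD.map_one, add_zero]
  · have hR := hD'.rTensor (TensorAlgebra K V)
    have hL := hD'.lTensor (TensorAlgebra K V)
    rw [hD'.comp_exp (hR.add hL comm) hD.comul_comp, hR.exp_add hL comm,
      hD'.exp_rTensor (TensorAlgebra K V), hD'.exp_lTensor (TensorAlgebra K V)]
    congr 1
    exact LinearMap.rTensor_comp_lTensor _ hD'.exp hD'.exp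

theorem exp_coderivation_eq_self (hg : ∀ w ∈ wordsLE K V 1, g w = 0) (τ : V →ₗ[K] V) {n : ℕ}
    (hgn : ∀ w ∈ wordsLE K V n, g w = 0) :
    ∀ w ∈ wordsLE K V n, (isLocallyNilpotent_coderivation τ hg).exp w = w := by
  intro w hw
  have vanish := coderivation_eq_zero_of_vanish τ hgn w hw
  rw [IsLocallyNilpotent.exp_apply_of_sq_eq_zero _ (by rw [vanish, map_zero]), vanish, add_zero]

theorem exp_coderivation_eq_add (hg : ∀ w ∈ wordsLE K V 1, g w = 0) (τ : V →ₗ[K] V) {n : ℕ}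
    (hgn : ∀ w ∈ wordsLE K V n, g w = 0) :
    ∀ w ∈ wordsLE K V (n + 1),
      (isLocallyNilpotent_coderivation τ hg).exp w = w + ι K (g w) := by
  intro w hw
  have eq_ι := coderivation_eq_ι_of_vanish τ hgn w hw
  have sq_eq_zero : coderivation τ g (coderivation τ g w) = 0 := by
    rw [eq_ι, ← word_one fun _ => g w]
    exact coderivation_eq_zero_of_vanish τ hg _ (word_mem_wordsLE le_rfl _)
  rw [IsLocallyNilpotent.exp_apply_of_sq_eq_zero _ sq_eq_zero, eq_ι]

end Exponential

section Grading

open TensorAlgebra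

variable {K : Type u} [CommRing K]
variable {X Y Z : Type*} [AddCommGroup X] [Module K X] [AddCommGroup Y] [Module K Y]
  [AddCommGroup Z] [Module K Z]
variable {𝒳 : ℤ → Submodule K X} {𝒴 : ℤ → Submodule K Y} {𝒵 : ℤ → Submodule K Z}

/-- The linear map `φ` is homogeneous of degree `e` for the families `𝒳` and `𝒴` of homogeneous
components. -/
def HasDegree (𝒳 : ℤ → Submodule K X) (𝒴 : ℤ → Submodule K Y) (e : ℤ) (φ : X →ₗ[K] Y) : Prop :=
  ∀ i, ∀ x ∈ 𝒳 i, φ x ∈ 𝒴 (i + e)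

theorem hasDegree_id : HasDegree 𝒳 𝒳 0 LinearMap.id := fun i x hx => by
  rwa [add_zero]

namespace HasDegree

variable {a b d : ℤ} {φ ψ : X →ₗ[K] Y} {χ : Y →ₗ[K] Z}

theorem comp (hχ : HasDegree 𝒴 𝒵 b χ) (hφ : HasDegree 𝒳 𝒴 a φ) (h : a + b = d) :
    HasDegree 𝒳 𝒵 d (χ ∘ₗ φ) := fun i x hx => by
  rw [← h, ← add_assoc]
  exact hχ _ _ (hφ i x hx)

theorem add (hφ : HasDegree 𝒳 𝒴 a φ) (hψ : HasDegree 𝒳 𝒴 a ψ) : HasDegree 𝒳 𝒴 a (φ + ψ) :=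
  fun i x hx => (𝒴 _).add_mem (hφ i x hx) (hψ i x hx)

theorem smul (c : K) (hφ : HasDegree 𝒳 𝒴 a φ) : HasDegree 𝒳 𝒴 a (c • φ) :=
  fun i x hx => (𝒴 _).smul_mem c (hφ i x hx)

theorem neg (hφ : HasDegree 𝒳 𝒴 a φ) : HasDegree 𝒳 𝒴 a (-φ) :=
  fun i x hx => (𝒴 _).neg_mem (hφ i x hx)

theorem sub (hφ : HasDegree 𝒳 𝒴 a φ) (hψ : HasDegree 𝒳 𝒴 a ψ) : HasDegree 𝒳 𝒴 a (φ - ψ) :=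
  fun i x hx => (𝒴 _).sub_mem (hφ i x hx) (hψ i x hx)

end HasDegree

variable {V : Type v} [AddCommGroup V] [Module K V] {𝒱 : ℤ → Submodule K V}

theorem bijective_coeLinearMap (h𝒱 : DirectSum.IsInternal 𝒱) :
    Function.Bijective (DirectSum.coeLinearMap 𝒱) := h𝒱

/-- A linear map assembled from its restrictions to the homogeneous components. -/
noncomputable def assemble (h𝒱 : DirectSum.IsInternal 𝒱) (φ : ∀ i, 𝒱 i →ₗ[K] X) : V →ₗ[K] X :=
  DirectSum.toModule K ℤ X φ ∘ₗ
    (LinearEquiv.ofBijective _ (bijective_coeLinearMap h𝒱)).symm.toLinearMap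

theorem assemble_apply (h𝒱 : DirectSum.IsInternal 𝒱) (φ : ∀ i, 𝒱 i →ₗ[K] X) {i : ℤ} {x : V}
    (hx : x ∈ 𝒱 i) : assemble h𝒱 φ x = φ i ⟨x, hx⟩ := by
  have symm_apply : (LinearEquiv.ofBijective _ (bijective_coeLinearMap h𝒱)).symm x =
      DirectSum.lof K ℤ (fun i => 𝒱 i) i ⟨x, hx⟩ := by
    rw [LinearEquiv.symm_apply_eq]
    simp
  simp only [assemble, LinearMap.comp_apply, LinearEquiv.coe_coe, symm_apply,
    DirectSum.toModule_lof]

theorem span_homogeneous (h𝒱 : DirectSum.IsInternal 𝒱) :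
    Submodule.span K {x | ∃ i, x ∈ 𝒱 i} = ⊤ := by
  rw [eq_top_iff, ← h𝒱.submodule_iSup_eq_top]
  exact iSup_le fun i x hx => Submodule.subset_span ⟨i, hx⟩

theorem ext_homogeneous (h𝒱 : DirectSum.IsInternal 𝒱) {A B : V →ₗ[K] X}
    (h : ∀ i, ∀ x ∈ 𝒱 i, A x = B x) : A = B := by
  apply LinearMap.ext_on (span_homogeneous h𝒱)
  rintro x ⟨i, hx⟩
  exact h i x hx

theorem ext_homogeneous_words (h𝒱 : DirectSum.IsInternal 𝒱) {A B : TensorAlgebra K V →ₗ[K] X}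
    (h : ∀ n (d : ℕ → ℤ) (o : ℕ → V), (∀ i, o i ∈ 𝒱 (d i)) → A (word K n o) = B (word K n o)) :
    A = B := by
  refine ext_words_of_span (s := {x | ∃ i, x ∈ 𝒱 i}) ⟨0, Submodule.zero_mem _⟩
    (span_homogeneous h𝒱) fun n o ho => ?_
  choose d hd using ho
  exact h n d o hd

/-- The homogeneous components of the tensor algebra for the total degree of words. -/
def wordsOfDegree (𝒱 : ℤ → Submodule K V) (e : ℤ) : Submodule K (TensorAlgebra K V) :=
  Submodule.span K {w | ∃ (n : ℕ) (d : ℕ → ℤ) (o : ℕ → V),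
    (∀ i, o i ∈ 𝒱 (d i)) ∧ ∑ i ∈ Finset.range n, d i = e ∧ w = word K n o}

theorem word_mem_wordsOfDegree {n : ℕ} {d : ℕ → ℤ} {o : ℕ → V} (ho : ∀ i, o i ∈ 𝒱 (d i)) :
    word K n o ∈ wordsOfDegree 𝒱 (∑ i ∈ Finset.range n, d i) :=
  Submodule.subset_span ⟨n, d, o, ho, rfl, rfl⟩

theorem hasDegree_of_words {g : TensorAlgebra K V →ₗ[K] X} {e : ℤ}
    (h : ∀ n (d : ℕ → ℤ) (o : ℕ → V), (∀ i, o i ∈ 𝒱 (d i)) →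
      g (word K n o) ∈ 𝒳 ((∑ i ∈ Finset.range n, d i) + e)) :
    HasDegree (wordsOfDegree 𝒱) 𝒳 e g := fun i => by
  refine (Submodule.span_le (p := (𝒳 (i + e)).comap g)).2 ?_
  rintro _ ⟨n, d, o, ho, rfl, rfl⟩
  exact h n d o ho

theorem HasDegree.apply_word {g : TensorAlgebra K V →ₗ[K] X} {e : ℤ}
    (hg : HasDegree (wordsOfDegree 𝒱) 𝒳 e g) (n : ℕ) {d : ℕ → ℤ} {o : ℕ → V}
    (ho : ∀ i, o i ∈ 𝒱 (d i)) : g (word K n o) ∈ 𝒳 ((∑ i ∈ Finset.range n, d i) + e) :=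
  hg _ _ (word_mem_wordsOfDegree ho)

theorem mul_mem_wordsOfDegree {a b : ℤ} {u w : TensorAlgebra K V} (hu : u ∈ wordsOfDegree 𝒱 a)
    (hw : w ∈ wordsOfDegree 𝒱 b) : u * w ∈ wordsOfDegree 𝒱 (a + b) := by
  have h := Submodule.mul_mem_mul hu hw
  rw [wordsOfDegree, wordsOfDegree, Submodule.span_mul_span] at h
  refine Submodule.span_mono ?_ h
  rintro _ ⟨_, ⟨j, d, o, ho, rfl, rfl⟩, _, ⟨m, d', o', ho', rfl, rfl⟩, rfl⟩
  refine ⟨j + m, fun i => if i < j then d i else d' (i - j), _, fun i => ?_, ?_,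
    word_mul_word j m o o'⟩
  · dsimp only
    split_ifs
    exacts [ho i, ho' _]
  · rw [Finset.sum_range_add]
    refine congrArg₂ _ (Finset.sum_congr rfl fun i hi => ?_) (by simp)
    rw [if_pos (Finset.mem_range.1 hi)]

theorem HasDegree.conv {β : X →ₗ[K] Y →ₗ[K] Z} {A : TensorAlgebra K V →ₗ[K] X}
    {B : TensorAlgebra K V →ₗ[K] Y} {a b e : ℤ}
    (hβ : ∀ i j, ∀ x ∈ 𝒳 i, ∀ y ∈ 𝒴 j, β x y ∈ 𝒵 (i + j))
    (hA : HasDegree (wordsOfDegree 𝒱) 𝒳 a A) (hB : HasDegree (wordsOfDegree 𝒱) 𝒴 b B)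
    (h : a + b = e) : HasDegree (wordsOfDegree 𝒱) 𝒵 e (conv β A B) := by
  refine hasDegree_of_words fun n d o ho => ?_
  rw [conv_word]
  refine Submodule.sum_mem _ fun k hk => ?_
  have mem := hβ _ _ _ (hA.apply_word k ho) _ (hB.apply_word (n - k) fun i => ho (k + i))
  have sum_eq : ∑ i ∈ Finset.range n, d i =
      ∑ i ∈ Finset.range k, d i + ∑ i ∈ Finset.range (n - k), d (k + i) := by
    rw [← Finset.sum_range_add, Nat.add_sub_cancel' (Nat.lt_succ_iff.1 (Finset.mem_range.1 hk))]
  rwa [sum_eq, ← h, add_add_add_comm]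

theorem hasDegree_ι : HasDegree 𝒱 (wordsOfDegree 𝒱) 0 (ι K) := fun i x hx => by
  simpa [word_one] using word_mem_wordsOfDegree (n := 1) (d := fun _ => i) fun _ => hx

theorem hasDegree_letter : HasDegree (wordsOfDegree 𝒱) 𝒱 0 letter := by
  refine hasDegree_of_words fun n d o ho => ?_
  match n with
  | 0 => simp
  | 1 => simpa [word_one] using ho 0
  | n + 2 => simp [word_succ, counit_mul]

theorem hasDegree_tmap {τ : V →ₗ[K] V} (hτ : HasDegree 𝒱 𝒱 0 τ) :
    HasDegree (wordsOfDegree 𝒱) (wordsOfDegree 𝒱) 0 (tmap τ).toLinearMap := by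
  refine hasDegree_of_words fun n d o ho => ?_
  rw [AlgHom.toLinearMap_apply, tmap_word, add_zero]
  exact word_mem_wordsOfDegree fun i => by simpa using hτ _ _ (ho i)

theorem hasDegree_coderivation {τ : V →ₗ[K] V} {g : TensorAlgebra K V →ₗ[K] V} {e : ℤ}
    (hτ : HasDegree 𝒱 𝒱 0 τ) (hg : HasDegree (wordsOfDegree 𝒱) 𝒱 e g) :
    HasDegree (wordsOfDegree 𝒱) (wordsOfDegree 𝒱) e (coderivation τ g) :=
  (hasDegree_tmap hτ).conv (fun _ _ _ hx _ hy => mul_mem_wordsOfDegree hx hy)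
    ((hasDegree_ι.comp hg (add_zero e)).conv
      (fun _ _ _ hx _ hy => mul_mem_wordsOfDegree hx hy) hasDegree_id (add_zero e)) (zero_add e)

end Grading

section Parity

variable {K : Type u} [Field K]
variable {V : Type v} [AddCommGroup V] [Module K V] {𝒱 : ℤ → Submodule K V}

theorem HasDegree.exp {M : Type*} [AddCommGroup M] [Module K M] {ℳ : ℤ → Submodule K M}
    {A : Module.End K M} (hA : IsLocallyNilpotent A) (h : HasDegree ℳ ℳ 0 A) :
    HasDegree ℳ ℳ 0 hA.exp := fun i x hx => by
  simp only [HasDegree, add_zero] at h ⊢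
  exact hA.exp_mem (h i) x hx

/-- The parity operator, acting on the component of degree `i` as `(-1) ^ i`. -/
noncomputable def parity (h𝒱 : DirectSum.IsInternal 𝒱) : Module.End K V :=
  assemble h𝒱 fun i => (-1 : K) ^ i • (𝒱 i).subtype

theorem parity_apply (h𝒱 : DirectSum.IsInternal 𝒱) {i : ℤ} {x : V} (hx : x ∈ 𝒱 i) :
    parity h𝒱 x = (-1 : K) ^ i • x := by
  simp [parity, assemble_apply h𝒱 _ hx]

theorem parity_mul_self (h𝒱 : DirectSum.IsInternal 𝒱) : parity h𝒱 * parity h𝒱 = 1 := by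
  refine ext_homogeneous h𝒱 fun i x hx => ?_
  simp [parity_apply h𝒱 hx, smul_smul, ← mul_zpow]

theorem hasDegree_parity (h𝒱 : DirectSum.IsInternal 𝒱) : HasDegree 𝒱 𝒱 0 (parity h𝒱) :=
  fun i x hx => by
    rw [parity_apply h𝒱 hx, add_zero]
    exact (𝒱 i).smul_mem _ hx

/-- The parity operator of the tensor algebra for the total degree of words. -/
noncomputable def tparity (h𝒱 : DirectSum.IsInternal 𝒱) : Module.End K (TensorAlgebra K V) :=
  (tmap (parity h𝒱)).toLinearMap

theorem tparity_apply (h𝒱 : DirectSum.IsInternal 𝒱) {e : ℤ} :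
    ∀ w ∈ wordsOfDegree 𝒱 e, tparity h𝒱 w = (-1 : K) ^ e • w := by
  refine LinearMap.eqOn_span (f := tparity h𝒱) (g := (-1 : K) ^ e • LinearMap.id) ?_
  rintro _ ⟨n, d, o, ho, rfl, rfl⟩
  induction n generalizing d o with
  | zero => simp [tparity]
  | succ n ih =>
    have ih := ih (fun i => d (i + 1)) (fun i => o (i + 1)) fun i => ho (i + 1)
    simp only [tparity, AlgHom.toLinearMap_apply, LinearMap.smul_apply, LinearMap.id_apply] at ih ⊢
    rw [word_succ, map_mul, ih, tmap_ι, parity_apply h𝒱 (ho 0), Finset.sum_range_succ',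
      zpow_add₀ (by simp), map_smul, smul_mul_smul_comm, mul_comm]

theorem parity_comp (h𝒱 : DirectSum.IsInternal 𝒱) {φ : Module.End K V} {e : ℤ}
    (hφ : HasDegree 𝒱 𝒱 e φ) : parity h𝒱 ∘ₗ φ = (-1 : K) ^ e • (φ ∘ₗ parity h𝒱) := by
  refine ext_homogeneous h𝒱 fun i x hx => ?_
  simp [parity_apply h𝒱 hx, parity_apply h𝒱 (hφ i x hx), zpow_add₀, smul_smul, mul_comm]

theorem parity_comp_of_words (h𝒱 : DirectSum.IsInternal 𝒱) {g : TensorAlgebra K V →ₗ[K] V}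
    {e : ℤ} (hg : HasDegree (wordsOfDegree 𝒱) 𝒱 e g) :
    parity h𝒱 ∘ₗ g = (-1 : K) ^ e • (g ∘ₗ tparity h𝒱) := by
  refine ext_homogeneous_words h𝒱 fun n d o ho => ?_
  simp [parity_apply h𝒱 (hg.apply_word n ho), tparity_apply h𝒱 _ (word_mem_wordsOfDegree ho),
    zpow_add₀, smul_smul, mul_comm]

theorem tparity_comp (h𝒱 : DirectSum.IsInternal 𝒱) {F : Module.End K (TensorAlgebra K V)}
    {e : ℤ} (hF : HasDegree (wordsOfDegree 𝒱) (wordsOfDegree 𝒱) e F) :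
    tparity h𝒱 ∘ₗ F = (-1 : K) ^ e • (F ∘ₗ tparity h𝒱) := by
  refine ext_homogeneous_words h𝒱 fun n d o ho => ?_
  simp [tparity_apply h𝒱 _ (hF.apply_word n ho), tparity_apply h𝒱 _ (word_mem_wordsOfDegree ho),
    zpow_add₀, smul_smul, mul_comm]

end Parity

section LinearCoderivation

open TensorAlgebra

variable {K : Type u} [CommRing K] {V : Type v} [AddCommGroup V] [Module K V]
variable {τ φ ψ : Module.End K V}

theorem coderivation_add (τ : V →ₗ[K] V) (g g' : TensorAlgebra K V →ₗ[K] V) :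
    coderivation τ (g + g') = coderivation τ g + coderivation τ g' := by
  simp only [coderivation, prefixInsertion, LinearMap.comp_add, map_add, LinearMap.add_apply]

theorem coderivation_neg (τ : V →ₗ[K] V) (g : TensorAlgebra K V →ₗ[K] V) :
    coderivation τ (-g) = -coderivation τ g := by
  simp only [coderivation, prefixInsertion, LinearMap.comp_neg, map_neg, LinearMap.neg_apply]

/-- The `τ`-coderivation of the tensor coalgebra extending the linear map `φ`. -/
def linearCoderivation (τ φ : Module.End K V) : Module.End K (TensorAlgebra K V) :=
  coderivation τ (φ ∘ₗ letter)

@[simp]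
theorem linearCoderivation_one (τ φ : Module.End K V) : linearCoderivation τ φ 1 = 0 :=
  coderivation_one τ (by simp)

theorem linearCoderivation_ι_mul (τ φ : Module.End K V) (x : V) (w : TensorAlgebra K V) :
    linearCoderivation τ φ (ι K x * w) =
      ι K (τ x) * linearCoderivation τ φ w + ι K (φ x) * w := by
  rw [linearCoderivation, coderivation_mul, prefixInsertion, ← LinearMap.comp_assoc,
    conv_letter_mul]
  rfl

theorem letter_comp_linearCoderivation (τ φ : Module.End K V) :
    letter ∘ₗ linearCoderivation τ φ = φ ∘ₗ letter :=
  letter_comp_coderivation τ _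

theorem isCoderivation_linearCoderivation (τ φ : Module.End K V) :
    IsCoderivation (tmap τ).toLinearMap (linearCoderivation τ φ) :=
  isCoderivation_coderivation τ (by simp)

theorem linearCoderivation_mem_wordsLE (τ φ : Module.End K V) {n : ℕ} :
    ∀ w ∈ wordsLE K V n, linearCoderivation τ φ w ∈ wordsLE K V n := by
  refine coderivation_mem_wordsLE τ (p := 0) (eqOn_wordsLE (B := 0) fun k hk o => ?_)
  simp [Nat.le_zero.1 hk]

theorem linearCoderivation_mul_self (hφ : φ * φ = 0) (hτ : τ * φ = -(φ * τ)) :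
    linearCoderivation τ φ * linearCoderivation τ φ = 0 := by
  refine linearMap_ext_left (by simp) fun x w ih => ?_
  have square x : φ (φ x) = 0 := LinearMap.congr_fun hφ x
  have anticomm x : τ (φ x) = -φ (τ x) := LinearMap.congr_fun hτ x
  simp only [Module.End.mul_apply, LinearMap.zero_apply] at ih
  simp [linearCoderivation_ι_mul, ih, square, anticomm]

theorem linearCoderivation_anticommutator (hτ : τ * τ = 1) (hφ : τ * φ = -(φ * τ))
    (hψ : τ * ψ = -(ψ * τ)) :
    linearCoderivation τ φ * linearCoderivation τ ψ +
      linearCoderivation τ ψ * linearCoderivation τ φ =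
        linearCoderivation LinearMap.id (φ * ψ + ψ * φ) := by
  refine linearMap_ext_left (by simp) fun x w ih => ?_
  have involutive x : τ (τ x) = x := LinearMap.congr_fun hτ x
  have anticomm_φ x : τ (φ x) = -φ (τ x) := LinearMap.congr_fun hφ x
  have anticomm_ψ x : τ (ψ x) = -ψ (τ x) := LinearMap.congr_fun hψ x
  simp only [Module.End.mul_apply, LinearMap.add_apply] at ih
  simp only [LinearMap.add_apply, Module.End.mul_apply, LinearMap.id_apply,
    linearCoderivation_ι_mul, map_add, involutive, anticomm_φ, anticomm_ψ, ← ih, map_neg, neg_mul,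
    mul_add, add_mul]
  abel

theorem hasDegree_linearCoderivation {𝒱 : ℤ → Submodule K V} {e : ℤ} (hτ : HasDegree 𝒱 𝒱 0 τ)
    (hφ : HasDegree 𝒱 𝒱 e φ) :
    HasDegree (wordsOfDegree 𝒱) (wordsOfDegree 𝒱) e (linearCoderivation τ φ) :=
  hasDegree_coderivation hτ (hφ.comp hasDegree_letter (zero_add e))

theorem tmap_comp_linearCoderivation_eq_zero {π : Module.End K V} (h : π * φ = 0) :
    (tmap π).toLinearMap ∘ₗ linearCoderivation τ φ = 0 := by
  refine linearMap_ext_left (by simp) fun x w ih => ?_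
  have vanish x : π (φ x) = 0 := LinearMap.congr_fun h x
  simp only [LinearMap.comp_apply, AlgHom.toLinearMap_apply, LinearMap.zero_apply] at ih ⊢
  simp [linearCoderivation_ι_mul, ih, vanish]

end LinearCoderivation

section RootPolynomial

open Polynomial

variable {K : Type u} [Field K]

theorem aeval_mul_of_mul_eq_smul {A : Type*} [Ring A] [Algebra K A] {a x : A} {c : K}
    (h : a * x = c • x) (p : K[X]) : aeval a p * x = p.eval c • x := by
  induction p using Polynomial.induction_on' with
  | add p q hp hq => rw [map_add, add_mul, hp, hq, eval_add, add_smul]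
  | monomial n r =>
    have power : a ^ n * x = c ^ n • x := by
      induction n with
      | zero => simp
      | succ n ih => rw [pow_succ', mul_assoc, ih, mul_smul_comm, h, smul_smul, pow_succ]
    rw [aeval_monomial, mul_assoc, power, eval_monomial, mul_smul, ← Algebra.smul_def]

theorem aeval_idempotent_add_smul_one {A : Type*} [Ring A] [Algebra K A] {e : A}
    (he : IsIdempotentElem e) (c : K) (p : K[X]) :
    aeval (e + c • 1) p = p.eval c • (1 - e) + p.eval (c + 1) • e := by
  have complement : (e + c • 1) * (1 - e) = c • (1 - e) := by
    rw [add_mul, mul_sub, he.eq, mul_one, sub_self, zero_add, smul_one_mul]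
  have image : (e + c • 1) * e = (c + 1) • e := by
    rw [add_mul, he.eq, smul_one_mul, add_smul, one_smul, add_comm]
  rw [← aeval_mul_of_mul_eq_smul complement, ← aeval_mul_of_mul_eq_smul image, ← mul_add,
    sub_add_cancel, mul_one]

theorem comp_aeval {M M' : Type*} [AddCommGroup M] [Module K M] [AddCommGroup M'] [Module K M']
    {N : Module.End K M} {N' : Module.End K M'} {φ : M →ₗ[K] M'} (h : φ ∘ₗ N = N' ∘ₗ φ)
    (p : K[X]) : φ ∘ₗ aeval N p = aeval N' p ∘ₗ φ := by
  induction p using Polynomial.induction_on' with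
  | add p q hp hq => rw [map_add, map_add, LinearMap.comp_add, hp, hq, LinearMap.add_comp]
  | monomial n r =>
    have power : φ ∘ₗ (N ^ n) = (N' ^ n) ∘ₗ φ :=
      (Module.End.commute_pow_left_of_commute h.symm n).symm
    rw [← C_mul_X_pow_eq_monomial, ← smul_eq_C_mul]
    simp only [map_smul, map_pow, aeval_X, LinearMap.comp_smul, LinearMap.smul_comp, power]

/-- The polynomial `∏_{1 ≤ l ≤ n} (1 - X / l)`, which singles out the eigenvalue `0` among the
eigenvalues `0, 1, …, n` of a number operator. -/
noncomputable def rootPoly (K : Type u) [Field K] (n : ℕ) : K[X] :=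
  ∏ l ∈ Finset.range n, (1 - C ((l + 1 : K)⁻¹) * X)

theorem rootPoly_eval_zero (n : ℕ) : (rootPoly K n).eval 0 = 1 := by
  simp [rootPoly, eval_prod]

theorem rootPoly_eval_natCast_add_one [CharZero K] {n j : ℕ} (hj : j < n) :
    (rootPoly K n).eval (j + 1 : K) = 0 := by
  rw [rootPoly, eval_prod]
  refine Finset.prod_eq_zero (Finset.mem_range.2 hj) ?_
  simp [inv_mul_cancel₀ (Nat.cast_add_one_ne_zero (R := K) j)]

theorem exists_one_sub_rootPoly_eq (n : ℕ) : ∃ r : K[X], 1 - rootPoly K n = r * X := by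
  have : X ∣ 1 - rootPoly K n := by
    rw [X_dvd_iff, coeff_zero_eq_eval_zero]
    simp [rootPoly_eval_zero]
  obtain ⟨r, hr⟩ := this
  exact ⟨r, hr.trans (mul_comm _ _)⟩

end RootPolynomial

section Hodge

open TensorAlgebra

variable {K : Type u} [Field K] {V : Type v} [AddCommGroup V] [Module K V]
  {𝒱 : ℤ → Submodule K V}

/-- A Hodge homotopy `h` for the differential `Q`, both compatible with the bilinear form `ω`:
then `Q * h + h * Q` is the projection onto an acyclic complement of the harmonic part. -/
structure IsHodge (h𝒱 : DirectSum.IsInternal 𝒱) (ω : V →ₗ[K] V →ₗ[K] K)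
    (Q h : Module.End K V) : Prop where
  hasDegree_Q : HasDegree 𝒱 𝒱 1 Q
  hasDegree_h : HasDegree 𝒱 𝒱 (-1) h
  Q_mul_Q : Q * Q = 0
  h_mul_h : h * h = 0
  Q_mul_h_mul_Q : Q * h * Q = Q
  h_mul_Q_mul_h : h * Q * h = h
  form_Q_left : ∀ x y, ω (Q x) y = -ω (parity h𝒱 x) (Q y)
  form_h_left : ∀ x y, ω (h x) y = ω (parity h𝒱 x) (h y)

/-- The number operator `Q h + h Q` of a Hodge homotopy. -/
def numOp (Q h : Module.End K V) : Module.End K V := Q * h + h * Q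

/-- The harmonic projection `1 - (Q h + h Q)`. -/
def harm (Q h : Module.End K V) : Module.End K V := 1 - numOp Q h

theorem harm_add_numOp (Q h : Module.End K V) : harm Q h + numOp Q h = 1 :=
  sub_add_cancel 1 _

theorem parity_parity (h𝒱 : DirectSum.IsInternal 𝒱) (x : V) :
    parity h𝒱 (parity h𝒱 x) = x :=
  LinearMap.congr_fun (parity_mul_self h𝒱) x

theorem parity_mul_of_odd (h𝒱 : DirectSum.IsInternal 𝒱) {φ : Module.End K V} {e : ℤ}
    (he : Odd e) (hφ : HasDegree 𝒱 𝒱 e φ) : parity h𝒱 * φ = -(φ * parity h𝒱) := by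
  rw [Module.End.mul_eq_comp, parity_comp h𝒱 hφ, he.neg_one_zpow, neg_one_smul]
  rfl

namespace IsHodge

variable {h𝒱 : DirectSum.IsInternal 𝒱} {ω : V →ₗ[K] V →ₗ[K] K} {Q h : Module.End K V}

theorem parity_mul_Q (H : IsHodge h𝒱 ω Q h) : parity h𝒱 * Q = -(Q * parity h𝒱) :=
  parity_mul_of_odd h𝒱 odd_one H.hasDegree_Q

theorem parity_mul_h (H : IsHodge h𝒱 ω Q h) : parity h𝒱 * h = -(h * parity h𝒱) :=
  parity_mul_of_odd h𝒱 (by decide) H.hasDegree_h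

theorem Q_mul_numOp (H : IsHodge h𝒱 ω Q h) : Q * numOp Q h = Q := by
  rw [numOp, mul_add, ← mul_assoc, H.Q_mul_Q, zero_mul, zero_add, ← mul_assoc, H.Q_mul_h_mul_Q]

theorem numOp_mul_Q (H : IsHodge h𝒱 ω Q h) : numOp Q h * Q = Q := by
  rw [numOp, add_mul, H.Q_mul_h_mul_Q, mul_assoc, H.Q_mul_Q, mul_zero, add_zero]

theorem h_mul_numOp (H : IsHodge h𝒱 ω Q h) : h * numOp Q h = h := by
  rw [numOp, mul_add, ← mul_assoc, ← mul_assoc, H.h_mul_h, zero_mul, add_zero, H.h_mul_Q_mul_h]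

theorem numOp_mul_h (H : IsHodge h𝒱 ω Q h) : numOp Q h * h = h := by
  rw [numOp, add_mul, mul_assoc, H.h_mul_h, mul_zero, zero_add, H.h_mul_Q_mul_h]

theorem isIdempotentElem_numOp (H : IsHodge h𝒱 ω Q h) : IsIdempotentElem (numOp Q h) := by
  rw [IsIdempotentElem]
  nth_rw 1 [numOp]
  rw [add_mul, mul_assoc, H.h_mul_numOp, mul_assoc, H.Q_mul_numOp, numOp]

theorem isIdempotentElem_harm (H : IsHodge h𝒱 ω Q h) : IsIdempotentElem (harm Q h) :=
  H.isIdempotentElem_numOp.one_sub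

theorem harm_mul_numOp (H : IsHodge h𝒱 ω Q h) : harm Q h * numOp Q h = 0 :=
  H.isIdempotentElem_numOp.one_sub_mul_self

theorem numOp_mul_harm (H : IsHodge h𝒱 ω Q h) : numOp Q h * harm Q h = 0 :=
  H.isIdempotentElem_numOp.mul_one_sub_self

theorem harm_mul_Q (H : IsHodge h𝒱 ω Q h) : harm Q h * Q = 0 := by
  rw [harm, sub_mul, H.numOp_mul_Q, one_mul, sub_self]

theorem Q_mul_harm (H : IsHodge h𝒱 ω Q h) : Q * harm Q h = 0 := by
  rw [harm, mul_sub, H.Q_mul_numOp, mul_one, sub_self]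

theorem harm_mul_h (H : IsHodge h𝒱 ω Q h) : harm Q h * h = 0 := by
  rw [harm, sub_mul, H.numOp_mul_h, one_mul, sub_self]

theorem h_mul_harm (H : IsHodge h𝒱 ω Q h) : h * harm Q h = 0 := by
  rw [harm, mul_sub, H.h_mul_numOp, mul_one, sub_self]

theorem hasDegree_numOp (H : IsHodge h𝒱 ω Q h) : HasDegree 𝒱 𝒱 0 (numOp Q h) :=
  (H.hasDegree_Q.comp H.hasDegree_h (by norm_num)).add
    (H.hasDegree_h.comp H.hasDegree_Q (by norm_num))

theorem hasDegree_harm (H : IsHodge h𝒱 ω Q h) : HasDegree 𝒱 𝒱 0 (harm Q h) :=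
  hasDegree_id.sub H.hasDegree_numOp

theorem form_Q_right (H : IsHodge h𝒱 ω Q h) (x y : V) :
    ω x (Q y) = -ω (Q (parity h𝒱 x)) y := by
  rw [H.form_Q_left, parity_parity, neg_neg]

theorem form_h_right (H : IsHodge h𝒱 ω Q h) (x y : V) :
    ω x (h y) = ω (h (parity h𝒱 x)) y := by
  rw [H.form_h_left, parity_parity]

theorem form_numOp (H : IsHodge h𝒱 ω Q h) (x y : V) :
    ω (numOp Q h x) y = ω x (numOp Q h y) := by
  have parity_Q : parity h𝒱 (Q x) = -Q (parity h𝒱 x) := LinearMap.congr_fun H.parity_mul_Q x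
  have parity_h : parity h𝒱 (h x) = -h (parity h𝒱 x) := LinearMap.congr_fun H.parity_mul_h x
  simp only [numOp, LinearMap.add_apply, Module.End.mul_apply, map_add]
  rw [H.form_Q_right x (h y), H.form_h_right x (Q y), H.form_Q_left (h x), H.form_h_left (Q x),
    parity_h, parity_Q]
  simp [add_comm]

theorem form_harm (H : IsHodge h𝒱 ω Q h) (x y : V) :
    ω (harm Q h x) y = ω x (harm Q h y) := by
  simp [harm, H.form_numOp]

end IsHodge

end Hodge

section LinearActions

open TensorAlgebra

variable {K : Type u} [CommRing K] {V : Type v} [AddCommGroup V] [Module K V]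
  {ω : V →ₗ[K] V →ₗ[K] K} {τ : Module.End K V} {g μ : TensorAlgebra K V →ₗ[K] V}

/-- The linear form on the bar coalgebra given by `ω` on two-letter words. An endomorphism of the
bar coalgebra is cyclic if it preserves this form. -/
def pairing (ω : V →ₗ[K] V →ₗ[K] K) : TensorAlgebra K V →ₗ[K] K :=
  conv ω letter letter

/-- The maps from words to letters whose `τ`-coderivation annihilates `pairing ω`. -/
def invariantMaps (ω : V →ₗ[K] V →ₗ[K] K) (τ : Module.End K V) :
    Submodule K (TensorAlgebra K V →ₗ[K] V) :=
  LinearMap.ker ((conv ω).flip letter + conv ω (τ ∘ₗ letter))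

theorem mem_invariantMaps :
    g ∈ invariantMaps ω τ ↔ conv ω g letter + conv ω (τ ∘ₗ letter) g = 0 :=
  Iff.rfl

theorem IsCoderivation.pairing_comp_eq_zero_iff {D : Module.End K (TensorAlgebra K V)}
    (hD : IsCoderivation (tmap τ).toLinearMap D) :
    pairing ω ∘ₗ D = 0 ↔ letter ∘ₗ D ∈ invariantMaps ω τ := by
  rw [pairing, hD.conv_comp, letter_comp_tmap, mem_invariantMaps]

/-- The part of `μ` with inputs and output in the image of the projection `P`. -/
def compress (P : Module.End K V) (μ : TensorAlgebra K V →ₗ[K] V) : TensorAlgebra K V →ₗ[K] V :=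
  P ∘ₗ μ ∘ₗ (tmap P).toLinearMap

theorem compress_mem_invariantMaps {P : Module.End K V} (hP : ∀ x y, ω (P x) y = ω x (P y))
    (hτ : τ ∘ₗ P = P ∘ₗ τ) (hμ : μ ∈ invariantMaps ω τ) :
    compress P μ ∈ invariantMaps ω τ := by
  have left : conv ω (compress P μ) letter = conv ω μ letter ∘ₗ (tmap P).toLinearMap := by
    rw [(isCoalgHom_tmap P).conv_comp, letter_comp_tmap]
    exact conv_congr fun u v => hP _ _
  have right : conv ω (τ ∘ₗ letter) (compress P μ) =
      conv ω (τ ∘ₗ letter) μ ∘ₗ (tmap P).toLinearMap := by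
    rw [(isCoalgHom_tmap P).conv_comp, LinearMap.comp_assoc, letter_comp_tmap,
      ← LinearMap.comp_assoc, hτ]
    exact conv_congr fun u v => (hP _ _).symm
  rw [mem_invariantMaps, left, right, ← LinearMap.add_comp, mem_invariantMaps.1 hμ,
    LinearMap.zero_comp]

/-- The commutator of maps from words to letters with the `τ`-coderivation extending `φ`. -/
def commutatorAction (τ φ : Module.End K V) : Module.End K (TensorAlgebra K V →ₗ[K] V) :=
  φ.compRight K - LinearMap.lcomp K V (linearCoderivation τ φ)

theorem commutatorAction_apply (τ φ : Module.End K V) (g : TensorAlgebra K V →ₗ[K] V) :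
    commutatorAction τ φ g = φ ∘ₗ g - g ∘ₗ linearCoderivation τ φ :=
  rfl

/-- The operator counting, for a projection `e`, the number of inputs in the image of `e`, plus one
if the output lies there. -/
def numberAction (e : Module.End K V) : Module.End K (TensorAlgebra K V →ₗ[K] V) :=
  e.compRight K + LinearMap.lcomp K V (linearCoderivation LinearMap.id e)

theorem numberAction_apply (e : Module.End K V) (g : TensorAlgebra K V →ₗ[K] V) :
    numberAction e g = e ∘ₗ g + g ∘ₗ linearCoderivation LinearMap.id e :=
  rfl

theorem numberAction_mem_invariantMaps {e : Module.End K V} (he : ∀ x y, ω (e x) y = ω x (e y))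
    (hg : g ∈ invariantMaps ω LinearMap.id) :
    numberAction e g ∈ invariantMaps ω LinearMap.id := by
  set N := linearCoderivation LinearMap.id e
  have coder : IsCoderivation LinearMap.id N := by
    simpa [tmap_id] using isCoderivation_linearCoderivation LinearMap.id e
  have letter_N : letter ∘ₗ N = e ∘ₗ letter := letter_comp_linearCoderivation _ _
  have left : conv ω (e ∘ₗ g) letter = conv ω g (e ∘ₗ letter) := conv_congr fun u v => he _ _
  have right : conv ω letter (e ∘ₗ g) = conv ω (e ∘ₗ letter) g :=
    conv_congr fun u v => (he _ _).symm
  have key := congrArg (· ∘ₗ N) (mem_invariantMaps.1 hg)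
  simp only [LinearMap.id_comp, LinearMap.add_comp, LinearMap.zero_comp, coder.conv_comp,
    LinearMap.comp_id, letter_N] at key
  rw [mem_invariantMaps, numberAction_apply, LinearMap.id_comp, map_add, map_add,
    LinearMap.add_apply, left, right, ← key]
  abel

theorem exists_eigenvalue_word {e : Module.End K V} (n : ℕ) {o : ℕ → V}
    (ho : ∀ i, e (o i) = 0 ∨ e (o i) = o i) :
    ∃ j ≤ n, linearCoderivation LinearMap.id e (word K n o) = (j : K) • word K n o ∧
      tmap (1 - e) (word K n o) = if j = 0 then word K n o else 0 := by
  induction n generalizing o with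
  | zero => exact ⟨0, le_rfl, by simp⟩
  | succ n ih =>
    obtain ⟨j, hj, eigen, proj⟩ := ih fun i => ho (i + 1)
    rcases ho 0 with h | h
    · refine ⟨j, by omega, ?_, ?_⟩
      · simp [word_succ, linearCoderivation_ι_mul, eigen, h]
      · rw [word_succ, map_mul, proj, tmap_ι]
        split_ifs <;> simp [h]
    · refine ⟨j + 1, by omega, ?_, ?_⟩
      · simp [word_succ, linearCoderivation_ι_mul, eigen, h, add_smul]
      · simp [word_succ, h]

theorem span_eigenvectors {e : Module.End K V} (he : IsIdempotentElem e) :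
    Submodule.span K {x | e x = 0 ∨ e x = x} = ⊤ := by
  have idem x : e (e x) = e x := LinearMap.congr_fun he x
  refine Submodule.eq_top_iff'.2 fun x => ?_
  rw [← sub_add_cancel x (e x)]
  exact Submodule.add_mem _ (Submodule.subset_span (Or.inl (by simp [idem])))
    (Submodule.subset_span (Or.inr (idem x)))

end LinearActions

section Gauge

open TensorAlgebra Polynomial

variable {K : Type u} [Field K] {V : Type v} [AddCommGroup V] [Module K V]
  {ω : V →ₗ[K] V →ₗ[K] K} {g μ : TensorAlgebra K V →ₗ[K] V}

theorem aeval_numberAction_rootPoly [CharZero K] {e : Module.End K V} (he : IsIdempotentElem e)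
    (g : TensorAlgebra K V →ₗ[K] V) (n : ℕ) :
    ∀ w ∈ wordsLE K V n,
      aeval (numberAction e) (rootPoly K (n + 1)) g w = compress (1 - e) g w := by
  refine eqOn_wordsLE fun k hk => apply_word_eq_of_span (Or.inl (map_zero e))
    (span_eigenvectors he) fun o ho => ?_
  obtain ⟨j, hj, eigen, proj⟩ := exists_eigenvalue_word k ho
  have intertwine : LinearMap.applyₗ (word K k o) ∘ₗ numberAction e =
      (e + (j : K) • 1) ∘ₗ LinearMap.applyₗ (word K k o) := by
    ext f
    simp [numberAction_apply, eigen]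
  have evaluate := LinearMap.congr_fun (comp_aeval intertwine (rootPoly K (n + 1))) g
  rw [aeval_idempotent_add_smul_one he, rootPoly_eval_natCast_add_one (by omega)] at evaluate
  simp only [LinearMap.comp_apply, LinearMap.applyₗ_apply_apply] at evaluate
  rw [evaluate, compress, LinearMap.comp_apply, LinearMap.comp_apply, AlgHom.toLinearMap_apply,
    proj]
  rcases j with _ | j
  · simp [rootPoly_eval_zero]
  · rw [Nat.cast_succ, rootPoly_eval_natCast_add_one (by omega)]
    simp

namespace IsHodge

variable {𝒱 : ℤ → Submodule K V} {h𝒱 : DirectSum.IsInternal 𝒱} {Q h : Module.End K V}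

theorem linearCoderivation_Q_mul_self (H : IsHodge h𝒱 ω Q h) :
    linearCoderivation (parity h𝒱) Q * linearCoderivation (parity h𝒱) Q = 0 :=
  linearCoderivation_mul_self H.Q_mul_Q H.parity_mul_Q

theorem linearCoderivation_numOp (H : IsHodge h𝒱 ω Q h) :
    linearCoderivation LinearMap.id (numOp Q h) =
      linearCoderivation (parity h𝒱) Q * linearCoderivation (parity h𝒱) h +
        linearCoderivation (parity h𝒱) h * linearCoderivation (parity h𝒱) Q :=
  (linearCoderivation_anticommutator (parity_mul_self h𝒱) H.parity_mul_Q H.parity_mul_h).symm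

/-- Cartan's homotopy formula: on solutions of the linearised Maurer–Cartan equation the last
bracket vanishes. -/
theorem commutatorAction_commutatorAction (H : IsHodge h𝒱 ω Q h)
    (g : TensorAlgebra K V →ₗ[K] V) :
    commutatorAction (parity h𝒱) Q (commutatorAction (parity h𝒱) h g) = numberAction (numOp Q h) g -
      (h ∘ₗ (Q ∘ₗ g + g ∘ₗ linearCoderivation (parity h𝒱) Q) +
        (Q ∘ₗ g + g ∘ₗ linearCoderivation (parity h𝒱) Q) ∘ₗ
          linearCoderivation (parity h𝒱) h) := by
  rw [numberAction_apply, H.linearCoderivation_numOp]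
  ext w
  simp only [commutatorAction_apply, LinearMap.sub_apply, LinearMap.comp_apply, map_sub, numOp,
    LinearMap.add_apply, Module.End.mul_apply, map_add]
  abel

theorem commute_numberAction (H : IsHodge h𝒱 ω Q h) :
    Commute (commutatorAction (parity h𝒱) Q) (numberAction (numOp Q h)) := by
  set Q' := linearCoderivation (parity h𝒱) Q with hQ'
  have comm : Commute Q' (linearCoderivation LinearMap.id (numOp Q h)) := by
    rw [Commute, SemiconjBy, H.linearCoderivation_numOp, ← hQ', mul_add, add_mul, ← mul_assoc,
      mul_assoc _ Q' Q', H.linearCoderivation_Q_mul_self]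
    simp [mul_assoc]
  refine LinearMap.ext fun g => LinearMap.ext fun w => ?_
  have comm_apply := LinearMap.congr_fun comm.eq w
  have Q_numOp x := LinearMap.congr_fun (H.Q_mul_numOp.trans H.numOp_mul_Q.symm) x
  simp only [Module.End.mul_apply] at comm_apply Q_numOp
  simp only [Module.End.mul_apply, numberAction_apply, commutatorAction_apply, ← hQ',
    LinearMap.sub_apply, LinearMap.comp_apply, LinearMap.add_apply, map_add, map_sub, Q_numOp,
    comm_apply]
  abel

theorem commutatorAction_h_mem_invariantMaps (H : IsHodge h𝒱 ω Q h)
    (hdeg : HasDegree (wordsOfDegree 𝒱) 𝒱 1 g) (hg : g ∈ invariantMaps ω (parity h𝒱)) :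
    commutatorAction (parity h𝒱) h g ∈ invariantMaps ω LinearMap.id := by
  set h' := linearCoderivation (parity h𝒱) h
  have coder : IsCoderivation (tmap (parity h𝒱)).toLinearMap h' :=
    isCoderivation_linearCoderivation _ _
  have g_parity : g ∘ₗ (tmap (parity h𝒱)).toLinearMap = -(parity h𝒱 ∘ₗ g) := by
    rw [parity_comp_of_words h𝒱 hdeg, zpow_one, neg_one_smul, neg_neg]
    rfl
  have letter_h' : letter ∘ₗ h' = h ∘ₗ letter := letter_comp_linearCoderivation _ _
  have parity_letter_h' : (parity h𝒱 ∘ₗ letter) ∘ₗ h' = -((h ∘ₗ parity h𝒱) ∘ₗ letter) := by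
    rw [LinearMap.comp_assoc, letter_h', ← LinearMap.comp_assoc, ← LinearMap.neg_comp]
    exact congrArg (· ∘ₗ letter) H.parity_mul_h
  have parity_letter_parity :
      (parity h𝒱 ∘ₗ letter) ∘ₗ (tmap (parity h𝒱)).toLinearMap = letter := by
    rw [LinearMap.comp_assoc, letter_comp_tmap]
    ext w
    exact parity_parity h𝒱 _
  have left : conv ω (h ∘ₗ g) letter = conv ω (parity h𝒱 ∘ₗ g) (h ∘ₗ letter) :=
    conv_congr fun u v => H.form_h_left _ _
  have right : conv ω letter (h ∘ₗ g) = conv ω ((h ∘ₗ parity h𝒱) ∘ₗ letter) g :=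
    conv_congr fun u v => H.form_h_right _ _
  have key := congrArg (· ∘ₗ h') (mem_invariantMaps.1 hg)
  simp only [LinearMap.add_comp, LinearMap.zero_comp, coder.conv_comp, letter_h', g_parity,
    parity_letter_h', parity_letter_parity, map_neg, LinearMap.neg_apply] at key
  rw [mem_invariantMaps, commutatorAction_apply, LinearMap.id_comp, map_sub, map_sub,
    LinearMap.sub_apply, left, right, ← neg_eq_zero, ← key]
  abel

end IsHodge

/-- The Lie algebra of infinitesimal cyclic gauge transformations of degree `0` that change only
components of arity greater than `n`. -/
def gaugeAlgebra (𝒱 : ℤ → Submodule K V) (ω : V →ₗ[K] V →ₗ[K] K) (n : ℕ) :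
    Submodule K (TensorAlgebra K V →ₗ[K] V) where
  carrier := {g | HasDegree (wordsOfDegree 𝒱) 𝒱 0 g ∧ g ∈ invariantMaps ω LinearMap.id ∧
    ∀ w ∈ wordsLE K V n, g w = 0}
  zero_mem' := ⟨fun _ _ _ => Submodule.zero_mem _, Submodule.zero_mem _, fun _ _ => rfl⟩
  add_mem' ha hb := ⟨ha.1.add hb.1, Submodule.add_mem _ ha.2.1 hb.2.1, fun w hw => by
    rw [LinearMap.add_apply, ha.2.2 w hw, hb.2.2 w hw, add_zero]⟩
  smul_mem' c g hg := ⟨hg.1.smul c, Submodule.smul_mem _ c hg.2.1, fun w hw => by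
    rw [LinearMap.smul_apply, hg.2.2 w hw, smul_zero]⟩

variable {𝒱 : ℤ → Submodule K V} {n : ℕ}

theorem numberAction_mem_gaugeAlgebra {e : Module.End K V} (hdeg : HasDegree 𝒱 𝒱 0 e)
    (he : ∀ x y, ω (e x) y = ω x (e y)) (hg : g ∈ gaugeAlgebra 𝒱 ω n) :
    numberAction e g ∈ gaugeAlgebra 𝒱 ω n := by
  refine ⟨(hdeg.comp hg.1 (zero_add 0)).add
    (hg.1.comp (hasDegree_linearCoderivation hasDegree_id hdeg) (zero_add 0)),
    numberAction_mem_invariantMaps he hg.2.1, fun w hw => ?_⟩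
  have stable := linearCoderivation_mem_wordsLE LinearMap.id e w hw
  simp [numberAction_apply, hg.2.2 w hw, hg.2.2 _ stable]

theorem IsHodge.commutatorAction_h_mem_gaugeAlgebra {h𝒱 : DirectSum.IsInternal 𝒱}
    {Q h : Module.End K V} (H : IsHodge h𝒱 ω Q h) (hdeg : HasDegree (wordsOfDegree 𝒱) 𝒱 1 g)
    (hg : g ∈ invariantMaps ω (parity h𝒱)) (hgn : ∀ w ∈ wordsLE K V n, g w = 0) :
    commutatorAction (parity h𝒱) h g ∈ gaugeAlgebra 𝒱 ω n := by
  refine ⟨(H.hasDegree_h.comp hdeg (by norm_num)).sub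
    (hdeg.comp (hasDegree_linearCoderivation (hasDegree_parity h𝒱) H.hasDegree_h) (by norm_num)),
    H.commutatorAction_h_mem_invariantMaps hdeg hg, fun w hw => ?_⟩
  have stable := linearCoderivation_mem_wordsLE (parity h𝒱) h w hw
  simp [commutatorAction_apply, hgn w hw, hgn _ stable]

end Gauge

section CyclicDifferential

open TensorAlgebra

variable {K : Type u} [Field K] {V : Type v} [AddCommGroup V] [Module K V]
  {𝒱 : ℤ → Submodule K V} {h𝒱 : DirectSum.IsInternal 𝒱} {ω : V →ₗ[K] V →ₗ[K] K}
  {Q h : Module.End K V} {D : Module.End K (TensorAlgebra K V)}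

/-- The differential `D` of the bar coalgebra of a cyclic `A_∞`-algebra with linear part `Q`. -/
structure IsCyclicDifferential (h𝒱 : DirectSum.IsInternal 𝒱) (ω : V →ₗ[K] V →ₗ[K] K)
    (Q : Module.End K V) (D : Module.End K (TensorAlgebra K V)) : Prop where
  isCoderivation : IsCoderivation (tparity h𝒱) D
  hasDegree : HasDegree (wordsOfDegree 𝒱) (wordsOfDegree 𝒱) 1 D
  mul_self : D * D = 0
  pairing_comp : pairing ω ∘ₗ D = 0
  map_ι : ∀ x, D (ι K x) = ι K (Q x)

/-- The higher operations `m_n`, `n ≥ 2`, of a bar differential with linear part `Q`. -/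
def nonlin (Q : Module.End K V) (D : Module.End K (TensorAlgebra K V)) :
    TensorAlgebra K V →ₗ[K] V :=
  letter ∘ₗ D - Q ∘ₗ letter

theorem letter_comp_eq_add_nonlin (Q : Module.End K V) (D : Module.End K (TensorAlgebra K V)) :
    letter ∘ₗ D = Q ∘ₗ letter + nonlin Q D :=
  (add_sub_cancel _ _).symm

namespace IsCyclicDifferential

theorem nonlin_eq_zero (hD : IsCyclicDifferential h𝒱 ω Q D) :
    ∀ w ∈ wordsLE K V 1, nonlin Q D w = 0 := fun w hw => by
  rw [eq_counit_add_ι_letter w hw]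
  simp [nonlin, hD.isCoderivation.map_one, hD.map_ι]

theorem eq_linearCoderivation_add (hD : IsCyclicDifferential h𝒱 ω Q D) :
    D = linearCoderivation (parity h𝒱) Q + coderivation (parity h𝒱) (nonlin Q D) := by
  rw [linearCoderivation, ← coderivation_add, ← letter_comp_eq_add_nonlin]
  exact hD.isCoderivation.eq_coderivation

theorem map_mem_wordsLE (hD : IsCyclicDifferential h𝒱 ω Q D) {n : ℕ} :
    ∀ w ∈ wordsLE K V n, D w ∈ wordsLE K V n := by
  rw [hD.isCoderivation.eq_coderivation]
  refine coderivation_mem_wordsLE _ (p := 0) (eqOn_wordsLE (B := 0) fun k hk o => ?_)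
  obtain rfl : k = 0 := by omega
  simp [hD.isCoderivation.map_one]

theorem hasDegree_nonlin (hD : IsCyclicDifferential h𝒱 ω Q D) (hQ : HasDegree 𝒱 𝒱 1 Q) :
    HasDegree (wordsOfDegree 𝒱) 𝒱 1 (nonlin Q D) :=
  (hasDegree_letter.comp hD.hasDegree (add_zero 1)).sub (hQ.comp hasDegree_letter (zero_add 1))

theorem nonlin_mem_invariantMaps (hD : IsCyclicDifferential h𝒱 ω Q D)
    (hQ : ∀ x y, ω (Q x) y = -ω (parity h𝒱 x) (Q y)) :
    nonlin Q D ∈ invariantMaps ω (parity h𝒱) := by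
  refine Submodule.sub_mem _ (hD.isCoderivation.pairing_comp_eq_zero_iff.1 hD.pairing_comp) ?_
  rw [mem_invariantMaps, ← eq_neg_iff_add_eq_zero, ← map_neg]
  exact conv_congr fun u v => by simp [hQ]

/-- The Maurer–Cartan equation. -/
theorem nonlin_comp_coderivation (hD : IsCyclicDifferential h𝒱 ω Q D) (hQ : Q * Q = 0) :
    Q ∘ₗ nonlin Q D + nonlin Q D ∘ₗ linearCoderivation (parity h𝒱) Q =
      -(nonlin Q D ∘ₗ coderivation (parity h𝒱) (nonlin Q D)) := by
  have square : letter ∘ₗ D ∘ₗ D = 0 := by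
    rw [show D ∘ₗ D = 0 from hD.mul_self, LinearMap.comp_zero]
  have Q_comp_Q : Q ∘ₗ Q = 0 := hQ
  have expand : letter ∘ₗ D ∘ₗ D = Q ∘ₗ nonlin Q D +
      (nonlin Q D ∘ₗ linearCoderivation (parity h𝒱) Q +
        nonlin Q D ∘ₗ coderivation (parity h𝒱) (nonlin Q D)) := by
    rw [← LinearMap.comp_assoc, letter_comp_eq_add_nonlin Q D, LinearMap.add_comp,
      LinearMap.comp_assoc, letter_comp_eq_add_nonlin Q D, LinearMap.comp_add,
      ← LinearMap.comp_assoc, Q_comp_Q, LinearMap.zero_comp, zero_add, ← LinearMap.comp_add,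
      ← hD.eq_linearCoderivation_add]
  rw [eq_neg_iff_add_eq_zero, add_assoc, ← expand, square]

end IsCyclicDifferential

/-- The operations given by `μ` of arity at most `n` are supported on the image of the
projection `P`. -/
def IsSplitUpTo (P : Module.End K V) (μ : TensorAlgebra K V →ₗ[K] V) (n : ℕ) : Prop :=
  ∀ w ∈ wordsLE K V n, μ w = compress P μ w

end CyclicDifferential

section GaugeStep

open TensorAlgebra Polynomial

variable {K : Type u} [Field K] {V : Type v} [AddCommGroup V] [Module K V]
  {𝒱 : ℤ → Submodule K V} {h𝒱 : DirectSum.IsInternal 𝒱} {ω : V →ₗ[K] V →ₗ[K] K}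
  {P Q h : Module.End K V} {D : Module.End K (TensorAlgebra K V)}
  {μ κ : TensorAlgebra K V →ₗ[K] V} {n : ℕ}

theorem comp_compress (e P : Module.End K V) (μ : TensorAlgebra K V →ₗ[K] V) :
    e ∘ₗ compress P μ = (e * P) ∘ₗ μ ∘ₗ (tmap P).toLinearMap := rfl

theorem compress_comp_tmap (P e : Module.End K V) (μ : TensorAlgebra K V →ₗ[K] V) :
    compress P μ ∘ₗ (tmap e).toLinearMap = P ∘ₗ μ ∘ₗ (tmap (P * e)).toLinearMap := by
  rw [Module.End.mul_eq_comp, tmap_comp, AlgHom.comp_toLinearMap]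
  rfl

theorem compress_compress (hP : IsIdempotentElem P) (μ : TensorAlgebra K V →ₗ[K] V) :
    compress P (compress P μ) = compress P μ := by
  rw [compress, compress_comp_tmap, hP.eq, ← LinearMap.comp_assoc, ← Module.End.mul_eq_comp, hP.eq,
    compress]

theorem compress_sub (P : Module.End K V) (μ κ : TensorAlgebra K V →ₗ[K] V) :
    compress P (μ - κ) = compress P μ - compress P κ := by
  ext w
  simp [compress]

theorem compress_eqOn_wordsLE (h : ∀ w ∈ wordsLE K V n, μ w = κ w) :
    ∀ w ∈ wordsLE K V n, compress P μ w = compress P κ w := fun w hw => by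
  have stable := (isCoalgHom_tmap P).map_mem_wordsLE w hw
  simp only [compress, LinearMap.comp_apply, h _ stable]

theorem compress_comp_linearCoderivation_eq_zero {φ : Module.End K V} (h : P * φ = 0)
    (τ : Module.End K V) (μ : TensorAlgebra K V →ₗ[K] V) :
    compress P μ ∘ₗ linearCoderivation τ φ = 0 := by
  rw [compress, LinearMap.comp_assoc, LinearMap.comp_assoc,
    tmap_comp_linearCoderivation_eq_zero h, LinearMap.comp_zero, LinearMap.comp_zero]

theorem tmap_comp_conv (A B : TensorAlgebra K V →ₗ[K] TensorAlgebra K V) :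
    (tmap P).toLinearMap ∘ₗ conv concat A B =
      conv concat ((tmap P).toLinearMap ∘ₗ A) ((tmap P).toLinearMap ∘ₗ B) := by
  rw [comp_conv]
  exact conv_congr fun u v => by simp

theorem comp_coderivation_eqOn_wordsLE (τ : Module.End K V) (hμ : ∀ w ∈ wordsLE K V 1, μ w = 0)
    (hκ : ∀ w ∈ wordsLE K V 1, κ w = 0) (h : ∀ w ∈ wordsLE K V n, μ w = κ w) :
    ∀ w ∈ wordsLE K V (n + 1), μ (coderivation τ μ w) = κ (coderivation τ κ w) := by
  intro w hw
  have difference : coderivation τ μ w = coderivation τ κ w + ι K ((μ - κ) w) := by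
    rw [← coderivation_eq_ι_of_vanish τ (n := n) (fun w hw => by simp [h w hw]) w hw,
      ← LinearMap.add_apply, ← coderivation_add, add_sub_cancel]
  rw [h _ (coderivation_mem_wordsLE τ hμ w hw), difference, map_add,
    hκ _ (ι_mem_wordsLE le_rfl _), add_zero]

theorem aeval_numberAction_eqOn_wordsLE (e : Module.End K V) (p : K[X])
    (h : ∀ w ∈ wordsLE K V n, μ w = κ w) :
    ∀ w ∈ wordsLE K V n, aeval (numberAction e) p μ w = aeval (numberAction e) p κ w := by
  set q := LinearMap.ker (LinearMap.domRestrict' (M₂ := V) (wordsLE K V n)) with hq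
  have mem_q (f : TensorAlgebra K V →ₗ[K] V) : f ∈ q ↔ ∀ w ∈ wordsLE K V n, f w = 0 := by
    rw [hq, LinearMap.mem_ker, LinearMap.ext_iff]
    simp
  have stable : q ≤ q.comap (numberAction e) := fun f hf => by
    rw [Submodule.mem_comap, mem_q]
    intro w hw
    have mem := linearCoderivation_mem_wordsLE LinearMap.id e w hw
    simp [numberAction_apply, (mem_q f).1 hf _ hw, (mem_q f).1 hf _ mem]
  have difference : μ - κ ∈ q := (mem_q _).2 fun w hw => sub_eq_zero.2 (h w hw)
  intro w hw
  have key := (mem_q _).1 (aeval_apply_smul_mem_of_le_comap difference p _ stable) w hw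
  rwa [map_sub, LinearMap.sub_apply, sub_eq_zero] at key

theorem exists_aeval_numberAction_inverse [CharZero K] {e : Module.End K V}
    (he : IsIdempotentElem e) (hμ : compress (1 - e) μ = 0) (n : ℕ) :
    ∃ r : K[X], ∀ w ∈ wordsLE K V n,
      aeval (numberAction e) r (numberAction e μ) w = μ w := by
  obtain ⟨r, hr⟩ := exists_one_sub_rootPoly_eq (K := K) (n + 1)
  have factor : aeval (numberAction e) r * numberAction e =
      1 - aeval (numberAction e) (rootPoly K (n + 1)) := by
    rw [← map_one (aeval (R := K) (numberAction e)), ← map_sub, hr, map_mul, aeval_X]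
  refine ⟨r, fun w hw => ?_⟩
  rw [← Module.End.mul_apply, factor, LinearMap.sub_apply, LinearMap.sub_apply,
    Module.End.one_apply, aeval_numberAction_rootPoly he _ _ w hw, hμ, LinearMap.zero_apply,
    sub_zero]

namespace IsHodge

/-- The component of arity `≤ n + 1` of the Maurer–Cartan equation involves, in its quadratic part,
only the operations of arity `≤ n`, so that `μ - κ` is closed up to this quadratic part. -/
theorem linearized_maurerCartan (H : IsHodge h𝒱 ω Q h) (hD : IsCyclicDifferential h𝒱 ω Q D)
    (hs : IsSplitUpTo (harm Q h) (nonlin Q D) n) :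
    ∀ w ∈ wordsLE K V (n + 1),
      Q ((nonlin Q D - compress (harm Q h) (nonlin Q D)) w) +
        (nonlin Q D - compress (harm Q h) (nonlin Q D)) (linearCoderivation (parity h𝒱) Q w) =
      -compress (harm Q h) (nonlin Q D)
        (coderivation (parity h𝒱) (compress (harm Q h) (nonlin Q D)) w) := by
  intro w hw
  set κ := compress (harm Q h) (nonlin Q D) with hκ
  have κ_vanish : ∀ w ∈ wordsLE K V 1, κ w = 0 := fun w hw => by
    rw [hκ, compress_eqOn_wordsLE (κ := 0) hD.nonlin_eq_zero w hw, compress]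
    simp
  have Q_κ : Q (κ w) = 0 := LinearMap.congr_fun H.Q_mul_harm _
  have κ_Q : κ (linearCoderivation (parity h𝒱) Q w) = 0 :=
    LinearMap.congr_fun (compress_comp_linearCoderivation_eq_zero H.harm_mul_Q _ _) w
  have maurerCartan := LinearMap.congr_fun (hD.nonlin_comp_coderivation H.Q_mul_Q) w
  simp only [LinearMap.add_apply, LinearMap.neg_apply, LinearMap.comp_apply] at maurerCartan
  simp only [LinearMap.sub_apply, map_sub, Q_κ, κ_Q, sub_zero]
  rw [maurerCartan, comp_coderivation_eqOn_wordsLE _ hD.nonlin_eq_zero κ_vanish hs w hw]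

theorem compress_harm_comp_coderivation (H : IsHodge h𝒱 ω Q h) (μ : TensorAlgebra K V →ₗ[K] V) :
    compress (harm Q h) μ ∘ₗ coderivation (parity h𝒱) (compress (harm Q h) μ) ∘ₗ
      linearCoderivation (parity h𝒱) h = 0 := by
  set π := (tmap (harm Q h)).toLinearMap with hπ
  set h' := linearCoderivation (parity h𝒱) h with hh'
  set κ := compress (harm Q h) μ with hκ
  have π_h' : π ∘ₗ h' = 0 := tmap_comp_linearCoderivation_eq_zero H.harm_mul_h
  have κ_h' : κ ∘ₗ h' = 0 := compress_comp_linearCoderivation_eq_zero H.harm_mul_h _ _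
  have parity_h' : tparity h𝒱 ∘ₗ h' = -(h' ∘ₗ tparity h𝒱) := by
    rw [tparity_comp h𝒱 (hasDegree_linearCoderivation (hasDegree_parity h𝒱) H.hasDegree_h),
      zpow_neg_one, inv_neg_one]
    exact neg_one_smul K (h' ∘ₗ tparity h𝒱)
  have π_parity_h' : (π ∘ₗ tparity h𝒱) ∘ₗ h' = 0 := by
    rw [LinearMap.comp_assoc, parity_h', LinearMap.comp_neg, ← LinearMap.comp_assoc, π_h',
      LinearMap.zero_comp, neg_zero]
  have π_ι_κ_h' : (π ∘ₗ ι K ∘ₗ κ) ∘ₗ h' = 0 := by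
    rw [LinearMap.comp_assoc, LinearMap.comp_assoc, κ_h', LinearMap.comp_zero, LinearMap.comp_zero]
  have coder := isCoderivation_linearCoderivation (parity h𝒱) h
  have key : π ∘ₗ coderivation (parity h𝒱) κ ∘ₗ h' = 0 := by
    rw [← LinearMap.comp_assoc, coderivation, prefixInsertion, hπ, tmap_comp_conv,
      tmap_comp_conv, ← hπ, coder.conv_comp, coder.conv_comp, ← hh', LinearMap.comp_id, π_ι_κ_h',
      π_h']
    change conv concat ((π ∘ₗ tparity h𝒱) ∘ₗ h') _ + _ = 0
    simp [π_parity_h']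
  nth_rw 1 [hκ]
  rw [compress, LinearMap.comp_assoc, LinearMap.comp_assoc, key, LinearMap.comp_zero,
    LinearMap.comp_zero]

theorem homotopy_linearized_maurerCartan (H : IsHodge h𝒱 ω Q h)
    (hD : IsCyclicDifferential h𝒱 ω Q D) (hs : IsSplitUpTo (harm Q h) (nonlin Q D) n)
    {c : TensorAlgebra K V →ₗ[K] V}
    (hc : c = Q ∘ₗ (nonlin Q D - compress (harm Q h) (nonlin Q D)) +
      (nonlin Q D - compress (harm Q h) (nonlin Q D)) ∘ₗ linearCoderivation (parity h𝒱) Q) :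
    ∀ w ∈ wordsLE K V (n + 1), h (c w) + c (linearCoderivation (parity h𝒱) h w) = 0 := by
  intro w hw
  set κ := compress (harm Q h) (nonlin Q D)
  have closed : ∀ w ∈ wordsLE K V (n + 1), c w = -κ (coderivation (parity h𝒱) κ w) := by
    rw [hc]
    exact H.linearized_maurerCartan hD hs
  have h_κ x : h (κ x) = 0 := LinearMap.congr_fun H.h_mul_harm _
  have κ_h' := LinearMap.congr_fun (H.compress_harm_comp_coderivation (nonlin Q D)) w
  rw [closed w hw, closed _ (linearCoderivation_mem_wordsLE _ _ w hw), map_neg, h_κ, neg_zero,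
    zero_add]
  exact neg_eq_zero.2 κ_h'

theorem sub_compress_harm_mem_invariantMaps (H : IsHodge h𝒱 ω Q h)
    (hμ : μ ∈ invariantMaps ω (parity h𝒱)) :
    μ - compress (harm Q h) μ ∈ invariantMaps ω (parity h𝒱) := by
  have parity_harm : parity h𝒱 ∘ₗ harm Q h = harm Q h ∘ₗ parity h𝒱 := by
    rw [parity_comp h𝒱 H.hasDegree_harm, zpow_zero, one_smul]
  exact Submodule.sub_mem _ hμ (compress_mem_invariantMaps H.form_harm parity_harm hμ)

theorem hasDegree_sub_compress_harm (H : IsHodge h𝒱 ω Q h) {d : ℤ}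
    (hμ : HasDegree (wordsOfDegree 𝒱) 𝒱 d μ) :
    HasDegree (wordsOfDegree 𝒱) 𝒱 d (μ - compress (harm Q h) μ) :=
  hμ.sub (H.hasDegree_harm.comp (hμ.comp (hasDegree_tmap H.hasDegree_harm) (zero_add d))
    (add_zero d))

/-- The infinitesimal gauge transformation removing the nonharmonic operations of arity `n + 1`. It
is the homotopy `h` applied to them, divided by the number operator. -/
theorem exists_infinitesimal_gauge [CharZero K] (H : IsHodge h𝒱 ω Q h)
    (hD : IsCyclicDifferential h𝒱 ω Q D) (hs : IsSplitUpTo (harm Q h) (nonlin Q D) n) :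
    ∃ g ∈ gaugeAlgebra 𝒱 ω n, ∀ w ∈ wordsLE K V (n + 1),
      commutatorAction (parity h𝒱) Q g w =
        nonlin Q D w - compress (harm Q h) (nonlin Q D) w := by
  set N := numberAction (K := K) (numOp Q h)
  set μ := nonlin Q D - compress (harm Q h) (nonlin Q D) with hμ
  set c := Q ∘ₗ μ + μ ∘ₗ linearCoderivation (parity h𝒱) Q with hc
  set h' := linearCoderivation (parity h𝒱) h
  have compress_μ : compress (1 - numOp Q h) μ = 0 := by
    rw [← harm, hμ, compress_sub, compress_compress H.isIdempotentElem_harm, sub_self]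
  obtain ⟨r, hr⟩ := exists_aeval_numberAction_inverse H.isIdempotentElem_numOp compress_μ (n + 1)
  refine ⟨aeval N r (commutatorAction (parity h𝒱) h μ), ?_, fun w hw => ?_⟩
  · refine aeval_apply_smul_mem_of_le_comap ?_ r N fun g hg =>
      numberAction_mem_gaugeAlgebra H.hasDegree_numOp H.form_numOp hg
    exact H.commutatorAction_h_mem_gaugeAlgebra
      (H.hasDegree_sub_compress_harm (hD.hasDegree_nonlin H.hasDegree_Q))
      (H.sub_compress_harm_mem_invariantMaps (hD.nonlin_mem_invariantMaps H.form_Q_left))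
      fun w hw => sub_eq_zero.2 (hs w hw)
  · have correction : aeval N r (h ∘ₗ c + c ∘ₗ h') w = 0 := by
      simpa using aeval_numberAction_eqOn_wordsLE (numOp Q h) r
        (μ := h ∘ₗ c + c ∘ₗ h') (κ := 0) (H.homotopy_linearized_maurerCartan hD hs hc) w hw
    rw [← LinearMap.comp_apply, comp_aeval H.commute_numberAction.eq, LinearMap.comp_apply,
      H.commutatorAction_commutatorAction, map_sub, LinearMap.sub_apply, correction, hr w hw,
      sub_zero]
    rfl

end IsHodge

end GaugeStep

section GaugeGroup

open TensorAlgebra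

variable {K : Type u} [Field K] {V : Type v} [AddCommGroup V] [Module K V]
  {𝒱 : ℤ → Submodule K V} {h𝒱 : DirectSum.IsInternal 𝒱} {ω : V →ₗ[K] V →ₗ[K] K}
  {Q h : Module.End K V} {D : Module.End K (TensorAlgebra K V)} {g : TensorAlgebra K V →ₗ[K] V}
  {n : ℕ}

/-- The cyclic coalgebra endomorphisms of degree `0` with identity linear part. -/
def gaugeMonoid (𝒱 : ℤ → Submodule K V) (ω : V →ₗ[K] V →ₗ[K] K) :
    Submonoid (Module.End K (TensorAlgebra K V)) where
  carrier := {F | IsCoalgHom F ∧ HasDegree (wordsOfDegree 𝒱) (wordsOfDegree 𝒱) 0 F ∧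
    pairing ω ∘ₗ F = pairing ω ∧ ∀ x, F (ι K x) = ι K x}
  one_mem' := ⟨isCoalgHom_id, hasDegree_id, rfl, fun _ => rfl⟩
  mul_mem' hF hG := ⟨hF.1.comp hG.1, hF.2.1.comp hG.2.1 (add_zero 0),
    by rw [Module.End.mul_eq_comp, ← LinearMap.comp_assoc, hF.2.2.1, hG.2.2.1],
    fun x => by rw [Module.End.mul_apply, hG.2.2.2, hF.2.2.2]⟩

/-- The group of cyclic coalgebra automorphisms of degree `0` with identity linear part. It acts on
cyclic bar differentials by conjugation. -/
abbrev gaugeGroup (𝒱 : ℤ → Submodule K V) (ω : V →ₗ[K] V →ₗ[K] K) :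
    Subgroup (Module.End K (TensorAlgebra K V))ˣ :=
  (gaugeMonoid 𝒱 ω).units

variable {F : (Module.End K (TensorAlgebra K V))ˣ}

theorem inv_apply_apply (F : (Module.End K (TensorAlgebra K V))ˣ) (w : TensorAlgebra K V) :
    F⁻¹.val (F.val w) = w :=
  LinearMap.congr_fun F.inv_mul w

theorem IsCyclicDifferential.conj (hD : IsCyclicDifferential h𝒱 ω Q D)
    (hF : F ∈ gaugeGroup 𝒱 ω) :
    IsCyclicDifferential h𝒱 ω Q (F.val * D * F⁻¹.val) := by
  obtain ⟨coalg, degree, pairing_F, F_ι⟩ := Submonoid.val_mem_of_mem_units _ hF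
  obtain ⟨coalg', degree', -, inv_ι⟩ := Submonoid.inv_val_mem_of_mem_units _ hF
  refine ⟨hD.isCoderivation.conj coalg coalg' F.mul_inv ?_,
    (degree.comp hD.hasDegree (add_zero 1)).comp degree' (zero_add 1), ?_, ?_, fun x => ?_⟩
  · rw [tparity_comp h𝒱 degree, zpow_zero, one_smul]
  · rw [mul_assoc, mul_assoc, ← mul_assoc F⁻¹.val, ← mul_assoc F⁻¹.val, F.inv_mul, one_mul,
      ← mul_assoc D, hD.mul_self, zero_mul, mul_zero]
  · rw [mul_assoc, Module.End.mul_eq_comp, ← LinearMap.comp_assoc, pairing_F,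
      Module.End.mul_eq_comp, ← LinearMap.comp_assoc, hD.pairing_comp, LinearMap.zero_comp]
  · rw [Module.End.mul_apply, Module.End.mul_apply, inv_ι, hD.map_ι, F_ι]

section Exponential

variable [CharZero K]

theorem exp_mem_gaugeMonoid (hg : g ∈ gaugeAlgebra 𝒱 ω n) (hn : 1 ≤ n)
    (hA : IsLocallyNilpotent (coderivation LinearMap.id g)) : hA.exp ∈ gaugeMonoid 𝒱 ω := by
  obtain ⟨degree, invariant, vanish⟩ := hg
  have coder := isCoderivation_coderivation_id (vanish 1 (one_mem_wordsLE n))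
  have pairing_coder : pairing ω ∘ₗ coderivation LinearMap.id g = 0 := by
    rw [pairing, coder.conv_comp, letter_comp_coderivation, LinearMap.comp_id]
    exact invariant
  refine ⟨isCoalgHom_exp coder hA, (hasDegree_coderivation hasDegree_id degree).exp hA,
    hA.comp_exp_of_comp_eq_zero pairing_coder, fun x => ?_⟩
  exact exp_coderivation_eq_self (fun w hw => vanish w (wordsLE_mono hn hw)) _ vanish _
    (ι_mem_wordsLE hn x)

theorem exists_mem_gaugeGroup_eq_add (hg : g ∈ gaugeAlgebra 𝒱 ω n) (hn : 1 ≤ n) :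
    ∃ F ∈ gaugeGroup 𝒱 ω, ∀ w ∈ wordsLE K V (n + 1),
      F.val w = w + ι K (g w) ∧ F⁻¹.val w = w - ι K (g w) := by
  have vanish : ∀ w ∈ wordsLE K V 1, g w = 0 := fun w hw => hg.2.2 w (wordsLE_mono hn hw)
  have hA := isLocallyNilpotent_coderivation LinearMap.id vanish
  let F : (Module.End K (TensorAlgebra K V))ˣ := ⟨hA.exp, hA.neg.exp, hA.exp_mul_exp_neg,
    by simpa only [neg_neg] using hA.neg.exp_mul_exp_neg⟩
  have inv_mem : hA.neg.exp ∈ gaugeMonoid 𝒱 ω := by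
    simpa only [coderivation_neg] using exp_mem_gaugeMonoid (neg_mem hg) hn
      (by simpa only [coderivation_neg] using hA.neg)
  have mem : F ∈ gaugeGroup 𝒱 ω :=
    Submonoid.mem_units_of_val_mem_inv_val_mem _ (exp_mem_gaugeMonoid hg hn hA) inv_mem
  have F_eq : ∀ w ∈ wordsLE K V (n + 1), F.val w = w + ι K (g w) :=
    exp_coderivation_eq_add vanish _ hg.2.2
  refine ⟨F, mem, fun w hw => ⟨F_eq w hw, ?_⟩⟩
  have F_ι := (Submonoid.val_mem_of_mem_units _ mem).2.2.2
  rw [← inv_apply_apply F (w - ι K (g w)), map_sub, F_eq w hw, F_ι, add_sub_cancel_right]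

end Exponential

namespace IsCyclicDifferential

theorem nonlin_conj_eq (hD : IsCyclicDifferential h𝒱 ω Q D) (hF : F ∈ gaugeGroup 𝒱 ω)
    (hg : ∀ w ∈ wordsLE K V n, g w = 0)
    (hFg : ∀ w ∈ wordsLE K V (n + 1), F.val w = w + ι K (g w) ∧ F⁻¹.val w = w - ι K (g w)) :
    ∀ w ∈ wordsLE K V (n + 1), nonlin Q (F.val * D * F⁻¹.val) w =
      nonlin Q D w - commutatorAction (parity h𝒱) Q g w := by
  intro w hw
  have F_ι := (Submonoid.val_mem_of_mem_units _ hF).2.2.2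
  have g_D : g (D w) = g (linearCoderivation (parity h𝒱) Q w) := by
    conv_lhs => rw [hD.eq_linearCoderivation_add]
    rw [LinearMap.add_apply, map_add,
      hg _ (coderivation_mem_wordsLE _ hD.nonlin_eq_zero w hw), add_zero]
  have conj_eq : F.val (D (F⁻¹.val w)) = D w + ι K (g (D w)) - ι K (Q (g w)) := by
    rw [(hFg w hw).2, map_sub, hD.map_ι, map_sub, F_ι, (hFg _ (hD.map_mem_wordsLE w hw)).1]
  simp only [nonlin, LinearMap.sub_apply, LinearMap.comp_apply, Module.End.mul_apply, conj_eq,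
    g_D, map_sub, map_add, letter_ι, commutatorAction_apply]
  abel

end IsCyclicDifferential

theorem IsHodge.exists_gauge_step [CharZero K] (H : IsHodge h𝒱 ω Q h)
    (hD : IsCyclicDifferential h𝒱 ω Q D) (hn : 1 ≤ n)
    (hs : IsSplitUpTo (harm Q h) (nonlin Q D) n) :
    ∃ F ∈ gaugeGroup 𝒱 ω,
      IsSplitUpTo (harm Q h) (nonlin Q (F.val * D * F⁻¹.val)) (n + 1) ∧
      ∀ w ∈ wordsLE K V n, F.val w = w ∧ F⁻¹.val w = w := by
  obtain ⟨g, hg, hgD⟩ := H.exists_infinitesimal_gauge hD hs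
  obtain ⟨F, hF, hFg⟩ := exists_mem_gaugeGroup_eq_add hg hn
  have nonlin_eq : ∀ w ∈ wordsLE K V (n + 1),
      nonlin Q (F.val * D * F⁻¹.val) w = compress (harm Q h) (nonlin Q D) w := fun w hw => by
    rw [hD.nonlin_conj_eq hF hg.2.2 hFg w hw, hgD w hw, sub_sub_cancel]
  refine ⟨F, hF, fun w hw => ?_, fun w hw => ?_⟩
  · rw [compress_eqOn_wordsLE nonlin_eq w hw, compress_compress H.isIdempotentElem_harm,
      nonlin_eq w hw]
  · simpa [hg.2.2 w hw] using hFg w (wordsLE_mono (Nat.le_succ n) hw)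

end GaugeGroup

section WordLimit

open TensorAlgebra

variable {K : Type u} [Field K] {V : Type v} [AddCommGroup V] [Module K V]
  {𝒱 : ℤ → Submodule K V} {ω : V →ₗ[K] V →ₗ[K] K}

/-- The limit of a sequence of endomorphisms of the bar coalgebra that stabilizes on words of
bounded length. -/
noncomputable def wordLimit (F : ℕ → Module.End K (TensorAlgebra K V)) :
    Module.End K (TensorAlgebra K V) :=
  ofFamily fun n => (F n).compMultilinearMap (tprod K V n)

variable {F G : ℕ → Module.End K (TensorAlgebra K V)}

theorem wordLimit_apply (hF : ∀ n, ∀ w ∈ wordsLE K V n, F (n + 1) w = F n w) (n : ℕ) :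
    ∀ w ∈ wordsLE K V n, wordLimit F w = F n w := by
  refine eqOn_wordsLE fun k hk o => ?_
  rw [wordLimit, ofFamily_word]
  change F k (word K k o) = _
  induction n, hk using Nat.le_induction with
  | base => rfl
  | succ n hkn ih => rw [ih, hF n _ (word_mem_wordsLE hkn o)]

theorem wordLimit_mem_gaugeMonoid (hF : ∀ n, F n ∈ gaugeMonoid 𝒱 ω)
    (hstable : ∀ n, ∀ w ∈ wordsLE K V n, F (n + 1) w = F n w) :
    wordLimit F ∈ gaugeMonoid 𝒱 ω := by
  have limit := wordLimit_apply hstable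
  refine ⟨⟨?_, ext_wordsLE fun n w hw => ?_, ext_wordsLE fun n w hw => ?_⟩, fun d w hw => ?_,
    ext_wordsLE fun n w hw => ?_, fun x => ?_⟩
  · rw [limit 0 1 (one_mem_wordsLE 0), (hF 0).1.map_one]
  · rw [LinearMap.comp_apply, limit n w hw]
    exact LinearMap.congr_fun (hF n).1.counit_comp w
  · rw [map_comp_comul, LinearMap.comp_apply, limit n w hw,
      conv_eqOn_wordsLE _ (limit n) (limit n) w hw, ← map_comp_comul]
    exact LinearMap.congr_fun (hF n).1.comul_comp w
  · obtain ⟨n, hn⟩ := exists_mem_wordsLE w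
    rw [limit n w hn]
    exact (hF n).2.1 d w hw
  · rw [LinearMap.comp_apply, limit n w hw]
    exact LinearMap.congr_fun (hF n).2.2.1 w
  · rw [limit 1 _ (ι_mem_wordsLE le_rfl x), (hF 1).2.2.2]

theorem wordLimit_mul_wordLimit_eq_one (hF : ∀ n, ∀ w ∈ wordsLE K V n, F (n + 1) w = F n w)
    (hG : ∀ n, ∀ w ∈ wordsLE K V n, G (n + 1) w = G n w) (hGn : ∀ n, IsCoalgHom (G n))
    (hFG : ∀ n, F n * G n = 1) : wordLimit F * wordLimit G = 1 :=
  ext_wordsLE fun n w hw => by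
    rw [Module.End.mul_apply, wordLimit_apply hG n w hw,
      wordLimit_apply hF n _ ((hGn n).map_mem_wordsLE w hw)]
    exact LinearMap.congr_fun (hFG n) w

theorem exists_wordLimit_mem_gaugeGroup {F : ℕ → (Module.End K (TensorAlgebra K V))ˣ}
    (hF : ∀ n, F n ∈ gaugeGroup 𝒱 ω)
    (hstable : ∀ n, ∀ w ∈ wordsLE K V n,
      (F (n + 1)).val w = (F n).val w ∧ (F (n + 1))⁻¹.val w = (F n)⁻¹.val w) :
    ∃ F' ∈ gaugeGroup 𝒱 ω, ∀ n, ∀ w ∈ wordsLE K V n,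
      F'.val w = (F n).val w ∧ F'⁻¹.val w = (F n)⁻¹.val w := by
  have mem n := Submonoid.val_mem_of_mem_units _ (hF n)
  have inv_mem n := Submonoid.inv_val_mem_of_mem_units _ (hF n)
  have stable n w hw := (hstable n w hw).1
  have inv_stable n w hw := (hstable n w hw).2
  let F' : (Module.End K (TensorAlgebra K V))ˣ :=
    ⟨wordLimit fun n => (F n).val, wordLimit fun n => (F n)⁻¹.val,
      wordLimit_mul_wordLimit_eq_one stable inv_stable (fun n => (inv_mem n).1)
        fun n => (F n).mul_inv,
      wordLimit_mul_wordLimit_eq_one inv_stable stable (fun n => (mem n).1)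
        fun n => (F n).inv_mul⟩
  exact ⟨F', Submonoid.mem_units_of_val_mem_inv_val_mem _ (wordLimit_mem_gaugeMonoid mem stable)
    (wordLimit_mem_gaugeMonoid inv_mem inv_stable), fun n w hw =>
      ⟨wordLimit_apply stable n w hw, wordLimit_apply inv_stable n w hw⟩⟩

end WordLimit

section GaugeFixing

variable {K : Type u} [Field K] {V : Type v} [AddCommGroup V] [Module K V]
  {𝒱 : ℤ → Submodule K V} {h𝒱 : DirectSum.IsInternal 𝒱} {ω : V →ₗ[K] V →ₗ[K] K}
  {Q h : Module.End K V} {D : Module.End K (TensorAlgebra K V)}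

theorem IsHodge.exists_gauge_sequence [CharZero K] (H : IsHodge h𝒱 ω Q h)
    (hD : IsCyclicDifferential h𝒱 ω Q D) :
    ∃ F : ℕ → (Module.End K (TensorAlgebra K V))ˣ, ∀ n,
      (F n ∈ gaugeGroup 𝒱 ω ∧
        IsSplitUpTo (harm Q h) (nonlin Q ((F n).val * D * (F n)⁻¹.val)) n) ∧
      ∀ w ∈ wordsLE K V n,
        (F (n + 1)).val w = (F n).val w ∧ (F (n + 1))⁻¹.val w = (F n)⁻¹.val w := by
  let Stage n := {F : (Module.End K (TensorAlgebra K V))ˣ // F ∈ gaugeGroup 𝒱 ω ∧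
    IsSplitUpTo (harm Q h) (nonlin Q (F.val * D * F⁻¹.val)) (n + 1)}
  have split_one : IsSplitUpTo (harm Q h) (nonlin Q D) 1 := fun w hw => by
    rw [compress_eqOn_wordsLE (κ := 0) hD.nonlin_eq_zero w hw, hD.nonlin_eq_zero w hw]
    simp [compress]
  have step n (F : Stage n) : ∃ F' : Stage (n + 1), ∀ w ∈ wordsLE K V (n + 1),
      F'.1.val w = F.1.val w ∧ F'.1⁻¹.val w = F.1⁻¹.val w := by
    obtain ⟨F, hF, hs⟩ := F
    obtain ⟨E, hE, hs', E_eq⟩ := H.exists_gauge_step (hD.conj hF) (Nat.le_add_left 1 n) hs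
    refine ⟨⟨E * F, mul_mem hE hF, ?_⟩, fun w hw => ⟨?_, ?_⟩⟩
    · simpa only [Units.val_mul, mul_inv_rev, mul_assoc] using hs'
    · have mem := (Submonoid.val_mem_of_mem_units _ hF).1.map_mem_wordsLE w hw
      exact (E_eq _ mem).1
    · rw [mul_inv_rev, Units.val_mul, Module.End.mul_apply, (E_eq w hw).2]
  choose next hnext using step
  let F n : Stage n := Nat.rec ⟨1, one_mem _, by simpa using split_one⟩ next n
  exact ⟨fun n => (F n).1, fun n =>
    ⟨⟨(F n).2.1, fun w hw => (F n).2.2 w (wordsLE_mono (Nat.le_succ n) hw)⟩,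
      fun w hw => hnext n (F n) w (wordsLE_mono (Nat.le_succ n) hw)⟩⟩

theorem IsHodge.exists_gauge_split [CharZero K] (H : IsHodge h𝒱 ω Q h)
    (hD : IsCyclicDifferential h𝒱 ω Q D) :
    ∃ F ∈ gaugeGroup 𝒱 ω, nonlin Q (F.val * D * F⁻¹.val) =
      compress (harm Q h) (nonlin Q (F.val * D * F⁻¹.val)) := by
  obtain ⟨F, hF⟩ := H.exists_gauge_sequence hD
  obtain ⟨F', hF', limit⟩ := exists_wordLimit_mem_gaugeGroup (fun n => (hF n).1.1)
    fun n => (hF n).2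
  have nonlin_eq n : ∀ w ∈ wordsLE K V n,
      nonlin Q (F'.val * D * F'⁻¹.val) w = nonlin Q ((F n).val * D * (F n)⁻¹.val) w := by
    intro w hw
    have mem := hD.map_mem_wordsLE _
      ((Submonoid.inv_val_mem_of_mem_units _ (hF n).1.1).1.map_mem_wordsLE w hw)
    simp only [nonlin, LinearMap.sub_apply, LinearMap.comp_apply, Module.End.mul_apply]
    rw [(limit n w hw).2, (limit n _ mem).1]
  refine ⟨F', hF', ext_wordsLE fun n w hw => ?_⟩
  rw [compress_eqOn_wordsLE (nonlin_eq n) w hw, nonlin_eq n w hw]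
  exact (hF n).1.2 w hw

end GaugeFixing

section GeneralizedInverse

variable {K : Type*} [Field K] {R : Type*} [Ring R] [Algebra K R] {Q h : R}

/-- The modification `(1 - Q h / 2) h (1 - h Q / 2)` of a generalized inverse `h` of a square-zero
element `Q`: it squares to zero, and it is self-adjoint whenever `h` is. -/
def squareZeroInverse (K : Type*) [Field K] [Algebra K R] (Q h : R) : R :=
  (1 - (2⁻¹ : K) • (Q * h)) * h * (1 - (2⁻¹ : K) • (h * Q))

theorem mul_one_sub_smul_of_mul_self (hQ : Q * Q = 0) (c : K) : Q * (1 - c • (Q * h)) = Q := by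
  rw [mul_sub, mul_one, mul_smul_comm, ← mul_assoc, hQ, zero_mul, smul_zero, sub_zero]

theorem one_sub_smul_mul_of_mul_self (hQ : Q * Q = 0) (c : K) : (1 - c • (h * Q)) * Q = Q := by
  rw [sub_mul, one_mul, smul_mul_assoc, mul_assoc, hQ, mul_zero, smul_zero, sub_zero]

theorem squareZeroInverse_mul_self [CharZero K] (hQ : Q * Q = 0) (hQh : h * Q * h = h) :
    squareZeroInverse K Q h * squareZeroInverse K Q h = 0 := by
  have halves : (2⁻¹ : K) + 2⁻¹ = 1 := by norm_num
  have middle : h * (1 - (2⁻¹ : K) • (h * Q)) * ((1 - (2⁻¹ : K) • (Q * h)) * h) = 0 := by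
    have left : h * (1 - (2⁻¹ : K) • (h * Q)) * (Q * h) = h * Q * h := by
      rw [← mul_assoc, mul_assoc h, one_sub_smul_mul_of_mul_self hQ]
    rw [sub_mul, one_mul, mul_sub, smul_mul_assoc, mul_smul_comm, ← mul_assoc _ (Q * h), left, hQh,
      mul_sub, mul_one, mul_smul_comm, sub_mul, smul_mul_assoc, ← mul_assoc, mul_assoc, mul_assoc h,
      ← mul_assoc, mul_assoc h h, ← mul_assoc h Q, hQh, sub_sub, ← add_smul, halves, one_smul,
      sub_self]
  calc squareZeroInverse K Q h * squareZeroInverse K Q h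
      = (1 - (2⁻¹ : K) • (Q * h)) * (h * (1 - (2⁻¹ : K) • (h * Q)) *
          ((1 - (2⁻¹ : K) • (Q * h)) * h)) * (1 - (2⁻¹ : K) • (h * Q)) := by
        simp only [squareZeroInverse, mul_assoc]
    _ = 0 := by rw [middle, mul_zero, zero_mul]

theorem mul_squareZeroInverse_mul (hQ : Q * Q = 0) (QhQ : Q * h * Q = Q) :
    Q * squareZeroInverse K Q h * Q = Q := by
  rw [squareZeroInverse, ← mul_assoc, ← mul_assoc, mul_one_sub_smul_of_mul_self hQ, mul_assoc,
    one_sub_smul_mul_of_mul_self hQ, QhQ]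

theorem squareZeroInverse_mul_mul (hQ : Q * Q = 0) (hQh : h * Q * h = h) :
    squareZeroInverse K Q h * Q * squareZeroInverse K Q h = squareZeroInverse K Q h := by
  rw [squareZeroInverse, mul_assoc _ _ Q, one_sub_smul_mul_of_mul_self hQ, ← mul_assoc, ← mul_assoc,
    mul_assoc _ Q, mul_one_sub_smul_of_mul_self hQ, mul_assoc _ h Q, mul_assoc _ (h * Q), hQh]

end GeneralizedInverse

section ExistsHodge

variable {K : Type u} [Field K] {V : Type v} [AddCommGroup V] [Module K V]
  {𝒱 : ℤ → Submodule K V}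

/-- A differential compatible with an odd symplectic form. -/
structure IsSymplecticDifferential (h𝒱 : DirectSum.IsInternal 𝒱) (ω : V →ₗ[K] V →ₗ[K] K)
    (Q : Module.End K V) : Prop where
  hasDegree_Q : HasDegree 𝒱 𝒱 1 Q
  Q_mul_Q : Q * Q = 0
  form_Q_left : ∀ x y, ω (Q x) y = -ω (parity h𝒱 x) (Q y)
  form_degree : ∀ a b x y, x ∈ 𝒱 a → y ∈ 𝒱 b → a + b ≠ 1 → ω x y = 0
  form_skew : ∀ x y, ω y x = -ω x y
  form_nondegenerate : ∀ x, x ≠ 0 → ∃ y, ω x y ≠ 0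

/-- The form `(x, y) ↦ ω(τ x, y)` twisted by the parity `τ`. An odd operator `A` has graded adjoint
`B` when `ω(A x, y) = ω(τ x, B y)`, that is, when `A` and `B` are an adjoint pair between the
twisted form and `ω`. -/
noncomputable abbrev twistedForm (h𝒱 : DirectSum.IsInternal 𝒱) (ω : V →ₗ[K] V →ₗ[K] K) :
    V →ₗ[K] V →ₗ[K] K :=
  ω ∘ₗ parity h𝒱

variable {h𝒱 : DirectSum.IsInternal 𝒱} {ω : V →ₗ[K] V →ₗ[K] K} {Q : Module.End K V}

theorem isAdjointPair_twistedForm {A B : Module.End K V} {e : ℤ} (he : Odd e)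
    (hA : HasDegree 𝒱 𝒱 e A) (h : LinearMap.IsAdjointPair (twistedForm h𝒱 ω) ω A B) :
    LinearMap.IsAdjointPair ω (twistedForm h𝒱 ω) A ⇑(-B) := by
  intro x y
  have anticomm : parity h𝒱 (A x) = -A (parity h𝒱 x) :=
    LinearMap.congr_fun (parity_mul_of_odd h𝒱 he hA) x
  rw [LinearMap.comp_apply, anticomm, map_neg, LinearMap.neg_apply, h, LinearMap.comp_apply,
    parity_parity, LinearMap.neg_apply, map_neg]

theorem isAdjointPair_squareZeroInverse {h : Module.End K V} (hhdeg : HasDegree 𝒱 𝒱 (-1) h)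
    (hQ : LinearMap.IsAdjointPair (twistedForm h𝒱 ω) ω Q ⇑(-Q))
    (hh : LinearMap.IsAdjointPair (twistedForm h𝒱 ω) ω h h) :
    LinearMap.IsAdjointPair (twistedForm h𝒱 ω) ω (squareZeroInverse K Q h : Module.End K V)
      (squareZeroInverse K Q h : Module.End K V) := by
  have hh' := isAdjointPair_twistedForm (by decide) hhdeg hh
  have left : LinearMap.IsAdjointPair ω ω (1 - (2⁻¹ : K) • (Q * h) : Module.End K V)
      (1 - (2⁻¹ : K) • (h * Q) : Module.End K V) := by
    rw [← neg_mul_neg h Q]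
    exact LinearMap.isAdjointPair_one.sub ((hh'.comp hQ).smul (2⁻¹ : K))
  have right : LinearMap.IsAdjointPair (twistedForm h𝒱 ω) (twistedForm h𝒱 ω)
      (1 - (2⁻¹ : K) • (h * Q) : Module.End K V) (1 - (2⁻¹ : K) • (Q * h) : Module.End K V) := by
    rw [← neg_mul_neg Q h]
    exact LinearMap.isAdjointPair_one.sub ((hQ.comp hh').smul (2⁻¹ : K))
  exact (right.comp hh).comp left

theorem exists_graded_generalizedInverse (h𝒱 : DirectSum.IsInternal 𝒱)
    (hQ : HasDegree 𝒱 𝒱 1 Q) : ∃ k, HasDegree 𝒱 𝒱 (-1) k ∧ Q * k * Q = Q := by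
  have componentwise : ∀ i : ℤ, ∃ φ : 𝒱 i →ₗ[K] 𝒱 (i + -1),
      ∀ (x : V) (_ : x ∈ 𝒱 (i + -1)) (hx : Q x ∈ 𝒱 i), Q (φ ⟨Q x, hx⟩) = Q x := by
    intro i
    let q : 𝒱 (i + -1) →ₗ[K] 𝒱 i :=
      Q.restrict fun x hx => by simpa only [neg_add_cancel_right] using hQ _ x hx
    obtain ⟨r, hr⟩ := q.rangeRestrict.exists_rightInverse_of_surjective q.range_rangeRestrict
    obtain ⟨φ, hφ⟩ := LinearMap.exists_extend r
    refine ⟨φ, fun x hx _ => ?_⟩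
    have extends_r : φ (q ⟨x, hx⟩) = r (q.rangeRestrict ⟨x, hx⟩) :=
      LinearMap.congr_fun hφ (q.rangeRestrict ⟨x, hx⟩)
    have section_r : Q (r (q.rangeRestrict ⟨x, hx⟩)) = Q x :=
      congrArg (fun z : LinearMap.range q => ((z : 𝒱 i) : V))
        (LinearMap.congr_fun hr (q.rangeRestrict ⟨x, hx⟩))
    rw [← extends_r] at section_r
    exact section_r
  choose φ hφ using componentwise
  have apply_mem {i : ℤ} {x : V} (hx : x ∈ 𝒱 i) :
      assemble h𝒱 (fun i => (𝒱 (i + -1)).subtype ∘ₗ φ i) x = φ i ⟨x, hx⟩ :=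
    assemble_apply h𝒱 _ hx
  refine ⟨assemble h𝒱 fun i => (𝒱 (i + -1)).subtype ∘ₗ φ i, fun i x hx => ?_, ?_⟩
  · rw [apply_mem hx]
    exact (φ i _).2
  · refine ext_homogeneous h𝒱 fun i x hx => ?_
    rw [Module.End.mul_apply, Module.End.mul_apply, apply_mem (hQ i x hx)]
    exact hφ (i + 1) x (by simpa only [add_neg_cancel_right] using hx) _

namespace IsSymplecticDifferential

theorem isAdjointPair (S : IsSymplecticDifferential h𝒱 ω Q) :
    LinearMap.IsAdjointPair (twistedForm h𝒱 ω) ω Q ⇑(-Q) := fun x y => by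
  rw [S.form_Q_left, LinearMap.neg_apply, map_neg, LinearMap.comp_apply]

theorem form_parity (S : IsSymplecticDifferential h𝒱 ω Q) (x y : V) :
    ω (parity h𝒱 x) (parity h𝒱 y) = -ω x y := by
  have homogeneous : ω.compl₁₂ (parity h𝒱) (parity h𝒱) = -ω := by
    refine ext_homogeneous h𝒱 fun i x hx => ext_homogeneous h𝒱 fun j y hy => ?_
    rw [LinearMap.compl₁₂_apply, parity_apply h𝒱 hx, parity_apply h𝒱 hy]
    by_cases hij : i + j = 1
    · simp only [map_smul, LinearMap.smul_apply, smul_smul, LinearMap.neg_apply]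
      rw [← zpow_add₀ (by simp), add_comm, hij, zpow_one, neg_one_smul]
    · simp [S.form_degree i j x y hx hy hij]
  exact LinearMap.congr_fun₂ homogeneous x y

theorem ext_form (S : IsSymplecticDifferential h𝒱 ω Q) {x y : V} (h : ∀ z, ω x z = ω y z) :
    x = y := by
  by_contra hxy
  obtain ⟨z, hz⟩ := S.form_nondegenerate (x - y) (sub_ne_zero.2 hxy)
  exact hz (by simp [h z])

theorem isHodge_squareZeroInverse [CharZero K] (S : IsSymplecticDifferential h𝒱 ω Q)
    {h : Module.End K V} (hdeg : HasDegree 𝒱 𝒱 (-1) h) (QhQ : Q * h * Q = Q)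
    (hQh : h * Q * h = h) (hadj : LinearMap.IsAdjointPair (twistedForm h𝒱 ω) ω h h) :
    IsHodge h𝒱 ω Q (squareZeroInverse K Q h) where
  hasDegree_Q := S.hasDegree_Q
  hasDegree_h :=
    ((hasDegree_id.sub ((S.hasDegree_Q.comp hdeg (by norm_num)).smul _)).comp hdeg
      (by norm_num : -1 + 0 = -1)).comp
      (hasDegree_id.sub ((hdeg.comp S.hasDegree_Q (by norm_num)).smul _)) (by norm_num)
  Q_mul_Q := S.Q_mul_Q
  h_mul_h := squareZeroInverse_mul_self S.Q_mul_Q hQh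
  Q_mul_h_mul_Q := mul_squareZeroInverse_mul S.Q_mul_Q QhQ
  h_mul_Q_mul_h := squareZeroInverse_mul_mul S.Q_mul_Q hQh
  form_Q_left := S.form_Q_left
  form_h_left := isAdjointPair_squareZeroInverse hdeg S.isAdjointPair hadj

theorem exists_isHodge_of_isAdjointPair [CharZero K] (S : IsSymplecticDifferential h𝒱 ω Q)
    {k : Module.End K V} (hdeg : HasDegree 𝒱 𝒱 (-1) k) (QkQ : Q * k * Q = Q)
    (hadj : LinearMap.IsAdjointPair (twistedForm h𝒱 ω) ω k k) : ∃ h, IsHodge h𝒱 ω Q h := by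
  refine ⟨_, S.isHodge_squareZeroInverse (h := k * Q * k)
    ((hdeg.comp S.hasDegree_Q (by norm_num)).comp hdeg (by norm_num : -1 + 0 = -1)) ?_ ?_ ?_⟩
  · rw [← mul_assoc, ← mul_assoc, QkQ, QkQ]
  · calc k * Q * k * Q * (k * Q * k) = k * (Q * k * Q) * k * Q * k := by simp only [mul_assoc]
      _ = k * Q * k * Q * k := by rw [QkQ]
      _ = k * (Q * k * Q) * k := by simp only [mul_assoc]
      _ = k * Q * k := by rw [QkQ]
  · have hQ := isAdjointPair_twistedForm odd_one S.hasDegree_Q S.isAdjointPair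
    rw [neg_neg] at hQ
    exact (hadj.comp hQ).comp hadj

theorem isAdjointPair_of_homotopy (S : IsSymplecticDifferential h𝒱 ω Q) {R P : Module.End K V}
    (hR : HasDegree 𝒱 𝒱 (-1) R) (hsum : Q * R + R * Q + P = 1) (QRQ : Q * R * Q = Q)
    (hPU : ∀ x y, ω (P x) (R (Q y)) = 0) (hUU : ∀ x y, ω (R (Q x)) (R (Q y)) = 0) :
    LinearMap.IsAdjointPair (twistedForm h𝒱 ω) ω (R * Q * R) (R * Q * R) := by
  intro x y
  have sum_apply z : Q (R z) + R (Q z) + P z = z := LinearMap.congr_fun hsum z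
  have QRQ_apply z : Q (R (Q z)) = Q z := LinearMap.congr_fun QRQ z
  have parity_Q z : parity h𝒱 (Q z) = -Q (parity h𝒱 z) :=
    LinearMap.congr_fun (parity_mul_of_odd h𝒱 odd_one S.hasDegree_Q) z
  have parity_R z : parity h𝒱 (R z) = -R (parity h𝒱 z) :=
    LinearMap.congr_fun (parity_mul_of_odd h𝒱 (by decide) hR) z
  have form_RQ z w : ω (R (Q z)) w = ω (R (Q z)) (Q (R w)) := by
    conv_lhs => rw [← sum_apply w]
    rw [map_add, map_add, hUU, S.form_skew (P w), hPU, neg_zero, add_zero, add_zero]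
  have form_RQ_right z w : ω z (R (Q w)) = ω (Q (R z)) (R (Q w)) := by
    rw [S.form_skew (R (Q w)), form_RQ, ← S.form_skew]
  calc ω ((R * Q * R) x) y
      = ω (R (Q (R x))) (Q (R (Q (R y)))) := by
        simp only [Module.End.mul_apply, QRQ_apply]
        exact form_RQ _ _
    _ = -ω (Q (parity h𝒱 (R (Q (R x))))) (R (Q (R y))) := by
        rw [S.form_Q_left, parity_parity, neg_neg]
    _ = ω (Q (R (parity h𝒱 x))) (R (Q (R y))) := by
        simp only [parity_R, parity_Q, map_neg, neg_neg, LinearMap.neg_apply, QRQ_apply]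
    _ = twistedForm h𝒱 ω x ((R * Q * R) y) := (form_RQ_right _ _).symm

theorem exists_isHodge_of_homotopy [CharZero K] (S : IsSymplecticDifferential h𝒱 ω Q)
    {R P : Module.End K V} (hR : HasDegree 𝒱 𝒱 (-1) R) (hsum : Q * R + R * Q + P = 1)
    (hQP : Q * P = 0) (hPU : ∀ x y, ω (P x) (R (Q y)) = 0)
    (hUU : ∀ x y, ω (R (Q x)) (R (Q y)) = 0) : ∃ h, IsHodge h𝒱 ω Q h := by
  have QRQ : Q * R * Q = Q := by
    have := congrArg (Q * ·) hsum
    simpa only [mul_add, ← mul_assoc, S.Q_mul_Q, hQP, zero_mul, zero_add, add_zero, mul_one]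
      using this
  refine S.exists_isHodge_of_isAdjointPair (k := R * Q * R)
    ((hR.comp S.hasDegree_Q (by norm_num)).comp hR (by norm_num : -1 + 0 = -1)) ?_
    (S.isAdjointPair_of_homotopy hR hsum QRQ hPU hUU)
  rw [← mul_assoc, ← mul_assoc, QRQ, QRQ]

theorem component_pairing_injective (S : IsSymplecticDifferential h𝒱 ω Q) {i j : ℤ}
    (hij : i + j = 1) : Function.Injective (ω.compl₁₂ (𝒱 i).subtype (𝒱 j).subtype) := by
  refine (injective_iff_map_eq_zero _).2 fun x hx => Subtype.ext (S.ext_form fun z => ?_)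
  have form_eq_zero : ω (x : V) = 0 := by
    refine ext_homogeneous h𝒱 fun l y hy => ?_
    by_cases hl : l = j
    · subst hl
      exact LinearMap.congr_fun hx ⟨y, hy⟩
    · exact S.form_degree i l _ _ x.2 hy (by omega)
  simp [form_eq_zero]

theorem component_pairing_isPerfPair (S : IsSymplecticDifferential h𝒱 ω Q) {i j : ℤ}
    [FiniteDimensional K (𝒱 i)] (hij : i + j = 1) :
    (ω.compl₁₂ (𝒱 i).subtype (𝒱 j).subtype).IsPerfPair := by
  refine .of_injective (S.component_pairing_injective hij) ?_
  have flip_eq : (ω.compl₁₂ (𝒱 i).subtype (𝒱 j).subtype).flip =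
      -ω.compl₁₂ (𝒱 j).subtype (𝒱 i).subtype := by
    ext x y
    exact S.form_skew _ _
  rw [flip_eq]
  exact neg_injective.comp (S.component_pairing_injective (by rw [add_comm, hij]))

theorem exists_component_adjoint (S : IsSymplecticDifferential h𝒱 ω Q)
    [∀ i, FiniteDimensional K (𝒱 i)] (k : Module.End K V) (i : ℤ) :
    ∃ ψ : 𝒱 i →ₗ[K] 𝒱 (i + -1), ∀ (x : 𝒱 i), ∀ y ∈ 𝒱 (2 - i),
      ω (ψ x) y = ω (parity h𝒱 x) (k y) := by
  let p := ω.compl₁₂ (𝒱 (i + -1)).subtype (𝒱 (2 - i)).subtype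
  have : p.IsPerfPair := S.component_pairing_isPerfPair (by ring)
  let form_k := ω.compl₁₂ (parity h𝒱 ∘ₗ (𝒱 i).subtype) (k ∘ₗ (𝒱 (2 - i)).subtype)
  refine ⟨p.toPerfPair.symm.toLinearMap ∘ₗ form_k, fun x y hy => ?_⟩
  exact LinearMap.congr_fun (p.toPerfPair.apply_symm_apply (form_k x)) ⟨y, hy⟩

theorem exists_graded_adjoint (S : IsSymplecticDifferential h𝒱 ω Q)
    [∀ i, FiniteDimensional K (𝒱 i)] {k : Module.End K V} (hk : HasDegree 𝒱 𝒱 (-1) k) :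
    ∃ k' : Module.End K V, HasDegree 𝒱 𝒱 (-1) k' ∧
      LinearMap.IsAdjointPair (twistedForm h𝒱 ω) ω k' k := by
  choose ψ hψ using S.exists_component_adjoint k
  let k' : Module.End K V := assemble h𝒱 fun i => (𝒱 (i + -1)).subtype ∘ₗ ψ i
  have k'_apply {i : ℤ} {x : V} (hx : x ∈ 𝒱 i) : k' x = ψ i ⟨x, hx⟩ := assemble_apply h𝒱 _ hx
  have degree_k' : HasDegree 𝒱 𝒱 (-1) k' := fun i x hx => by
    rw [k'_apply hx]
    exact (ψ i _).2
  refine ⟨k', degree_k', ?_⟩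
  rw [LinearMap.isAdjointPair_iff_comp_eq_compl₂]
  refine ext_homogeneous h𝒱 fun i x hx => ext_homogeneous h𝒱 fun j y hy => ?_
  rw [LinearMap.comp_apply, LinearMap.compl₂_apply, LinearMap.comp_apply]
  by_cases hij : j = 2 - i
  · subst hij
    rw [k'_apply hx, hψ i ⟨x, hx⟩ y hy]
  · rw [S.form_degree _ _ _ _ (degree_k' i x hx) hy (by omega), parity_apply h𝒱 hx, map_smul,
      LinearMap.smul_apply, S.form_degree _ _ _ _ hx (hk j y hy) (by omega), smul_zero]

theorem isAdjointPair_symm (S : IsSymplecticDifferential h𝒱 ω Q) {A B : Module.End K V} {e : ℤ}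
    (he : Odd e) (hA : HasDegree 𝒱 𝒱 e A)
    (h : LinearMap.IsAdjointPair (twistedForm h𝒱 ω) ω A B) :
    LinearMap.IsAdjointPair (twistedForm h𝒱 ω) ω B A := by
  intro x y
  have anticomm : parity h𝒱 (A (parity h𝒱 y)) = -A y := by
    rw [← Module.End.mul_apply, parity_mul_of_odd h𝒱 he hA, LinearMap.neg_apply,
      Module.End.mul_apply, parity_parity]
  calc ω (B x) y = -ω (A (parity h𝒱 y)) x := by
        rw [h, LinearMap.comp_apply, parity_parity, ← S.form_skew]
    _ = ω x (A (parity h𝒱 y)) := (S.form_skew _ _).symm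
    _ = ω (parity h𝒱 x) (A y) := by
        rw [← neg_neg (ω x _), ← S.form_parity, anticomm, map_neg, neg_neg]

theorem exists_isHodge_of_finite [CharZero K] (S : IsSymplecticDifferential h𝒱 ω Q)
    [∀ i, FiniteDimensional K (𝒱 i)] : ∃ h, IsHodge h𝒱 ω Q h := by
  obtain ⟨k, hk, QkQ⟩ := exists_graded_generalizedInverse h𝒱 S.hasDegree_Q
  obtain ⟨k', hk', hadj⟩ := S.exists_graded_adjoint hk
  have Qk'Q : Q * k' * Q = Q := by
    ext x
    refine S.ext_form fun y => ?_
    have := (S.isAdjointPair.comp (isAdjointPair_twistedForm (by decide) hk' hadj)).comp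
      S.isAdjointPair x y
    have QkQ_apply : Q (k (Q y)) = Q y := LinearMap.congr_fun QkQ y
    rw [S.isAdjointPair]
    simpa [QkQ_apply] using this
  refine S.exists_isHodge_of_isAdjointPair (k := (2⁻¹ : K) • (k + k')) ((hk.add hk').smul _) ?_ ?_
  · rw [mul_smul_comm, smul_mul_assoc, mul_add, add_mul, QkQ, Qk'Q, ← two_smul K, smul_smul,
      inv_mul_cancel₀ two_ne_zero, one_smul]
  · have := ((S.isAdjointPair_symm (by decide) hk' hadj).add hadj).smul (2⁻¹ : K)
    rw [add_comm ⇑k' ⇑k] at this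
    exact this

end IsSymplecticDifferential

end ExistsHodge

section Translation

open TensorAlgebra

variable {K : Type u} [Field K] {V : Type v} [AddCommGroup V] [Module K V]
  {W : Type v} [AddCommGroup W] [Module K W]
  {𝒱 : ℤ → Submodule K V} {h𝒱 : DirectSum.IsInternal 𝒱} {ω : V →ₗ[K] V →ₗ[K] K}
  {Q : Module.End K V} {D : Module.End K (TensorAlgebra K V)}

theorem word_parity_left (h𝒱 : DirectSum.IsInternal 𝒱) {n j : ℕ} (hj : j ≤ n) {d : ℕ → ℤ}
    {o : ℕ → V} (ho : ∀ i, o i ∈ 𝒱 (d i)) (x : ℕ → V) :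
    word K n (fun i => if i < j then parity h𝒱 (o i) else x i) =
      (-1 : K) ^ (∑ i ∈ Finset.range j, d i) • word K n (fun i => if i < j then o i else x i) := by
  induction j generalizing n d o x with
  | zero => simp
  | succ j ih =>
    obtain ⟨n, rfl⟩ := Nat.exists_eq_succ_of_ne_zero (Nat.ne_zero_of_lt hj)
    have tail := ih (Nat.le_of_succ_le_succ hj) (fun i => ho (i + 1)) fun i => x (i + 1)
    rw [Finset.sum_range_succ', zpow_add₀ (by simp)]
    simp [word_succ, parity_apply h𝒱 (ho 0), tail, smul_smul, mul_comm]

theorem ofFamily_one {m : MultFamily K V W} (hm : m 0 = 0) :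
    ofFamily m (1 : TensorAlgebra K V) = 0 := by
  rw [← word_zero (K := K) fun _ => (0 : V), ofFamily_word, hm, zero_apply]

theorem insertionSum_eq (h𝒱 : DirectSum.IsInternal 𝒱) (g : MultFamily K V W)
    {m : MultFamily K V V} (hm : m 0 = 0) (n : ℕ) {d : ℕ → ℤ} {o : ℕ → V}
    (ho : ∀ i, o i ∈ 𝒱 (d i)) :
    insertionSum g m n d o =
      ofFamily g (coderivation (parity h𝒱) (ofFamily m) (word K n o)) := by
  rw [coderivation_word _ (ofFamily_one hm), map_sum, insertionSum]
  refine Finset.sum_congr rfl fun l _ => ?_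
  rw [map_sum]
  refine Finset.sum_congr rfl fun j hj => ?_
  rw [word_parity_left h𝒱 (Finset.mem_range.1 hj).le ho, map_smul, ofFamily_word, ofFamily_word]

/-- The square of an odd coderivation is an ordinary coderivation, and a coderivation is determined
by its corestriction to letters. -/
theorem IsCoderivation.mul_self_eq_zero (hD : IsCoderivation (tparity h𝒱) D)
    (hdeg : HasDegree (wordsOfDegree 𝒱) (wordsOfDegree 𝒱) 1 D) (h : letter ∘ₗ D ∘ₗ D = 0) :
    D * D = 0 := by
  have tmap_one : (tmap (LinearMap.id : V →ₗ[K] V)).toLinearMap = LinearMap.id := by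
    rw [tmap_id]; rfl
  have tparity_sq : tparity h𝒱 ∘ₗ tparity h𝒱 = LinearMap.id := by
    rw [tparity, ← AlgHom.comp_toLinearMap, ← tmap_comp, ← Module.End.mul_eq_comp,
      parity_mul_self]
    exact tmap_one
  have comul_D : comul ∘ₗ D = conv (TensorProduct.mk K _ _) D LinearMap.id +
      conv (TensorProduct.mk K _ _) (tparity h𝒱) D := by
    rw [hD.comul_comp, LinearMap.add_comp, map_comp_comul, map_comp_comul]
  have square : IsCoderivation (tmap (LinearMap.id : V →ₗ[K] V)).toLinearMap (D ∘ₗ D) := by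
    refine ⟨by simp [hD.map_one], ?_, ?_⟩
    · rw [← LinearMap.comp_assoc, hD.counit_comp, LinearMap.zero_comp]
    · rw [← LinearMap.comp_assoc, comul_D, LinearMap.add_comp, hD.conv_comp, hD.conv_comp,
        tparity_comp h𝒱 hdeg, tparity_sq, tmap_one, LinearMap.add_comp, map_comp_comul,
        map_comp_comul, zpow_one, map_smul, LinearMap.smul_apply, LinearMap.id_comp]
      module
  calc D * D = coderivation LinearMap.id (letter ∘ₗ D ∘ₗ D) := square.eq_coderivation
    _ = 0 := by rw [h, coderivation, prefixInsertion, LinearMap.comp_zero, map_zero,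
      LinearMap.zero_apply, map_zero]

theorem letter_word (n : ℕ) (o : ℕ → V) :
    letter (word K n o) = if n = 1 then o 0 else 0 := by
  match n with
  | 0 => simp
  | 1 => simp [word_one]
  | n + 2 => simp [word_succ, counit_mul]

theorem conv_letter_right_word (g : TensorAlgebra K V →ₗ[K] V) (n : ℕ) (o : ℕ → V) :
    conv ω g letter (word K (n + 1) o) = ω (g (word K n o)) (o n) := by
  rw [conv_word, Finset.sum_eq_single n]
  · simp [letter_word]
  · intro k _ hk
    rw [letter_word, if_neg (by omega), map_zero]
  · simp

theorem invariance_word (h𝒱 : DirectSum.IsInternal 𝒱) (g : TensorAlgebra K V →ₗ[K] V) (k : ℕ)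
    (x : ℕ → V) :
    (conv ω g letter + conv ω (parity h𝒱 ∘ₗ letter) g) (word K (k + 1) x) =
      ω (g (word K k x)) (x k) + ω (parity h𝒱 (x 0)) (g (word K k fun i => x (i + 1))) := by
  rw [LinearMap.add_apply, conv_letter_right_word, word_succ, conv_letter_mul]

theorem mem_invariantMaps_parity_iff (h𝒱 : DirectSum.IsInternal 𝒱)
    (hω : ∀ x y, ω y x = -ω x y) {g : TensorAlgebra K V →ₗ[K] V} (hg : g 1 = 0) :
    g ∈ invariantMaps ω (parity h𝒱) ↔
      ∀ k : ℕ, 1 ≤ k → ∀ (d : ℕ → ℤ) (o : ℕ → V), (∀ i, o i ∈ 𝒱 (d i)) →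
        ω (o 0) (g (word K k fun i => o (i + 1))) = (-1 : K) ^ d 1 *
          ω (o 1) (g (word K k fun i => if i + 1 = k then o 0 else o (i + 2))) := by
  rw [mem_invariantMaps]
  constructor
  · intro h k hk d o ho
    have rotated := invariance_word (ω := ω) h𝒱 g k fun i => if i = k then o 0 else o (i + 1)
    rw [h, LinearMap.zero_apply, if_pos rfl, if_neg (by omega), parity_apply h𝒱 (ho (0 + 1)),
      word_congr (o' := fun i => o (i + 1)) fun i hi => if_neg hi.ne] at rotated
    rw [hω, neg_eq_of_add_eq_zero_right rotated.symm, map_smul, LinearMap.smul_apply]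
    rfl
  · intro h
    refine ext_homogeneous_words h𝒱 fun n d x hx => ?_
    match n with
    | 0 => simp [hg]
    | 1 =>
      rw [← zero_add 1, invariance_word]
      simp [hg]
    | k + 2 =>
      have cyclic := h (k + 1) (by omega) (fun i => if i = 0 then d (k + 1) else d (i - 1))
        (fun i => if i = 0 then x (k + 1) else x (i - 1)) fun i => by split_ifs <;> exact hx _
      simp only [if_true, Nat.add_one_ne_zero, if_false, Nat.add_sub_cancel, one_ne_zero,
        Nat.sub_self] at cyclic
      rw [invariance_word, LinearMap.zero_apply, parity_apply h𝒱 (hx 0), hω, cyclic, map_smul,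
        LinearMap.smul_apply, smul_eq_mul, word_congr (o := fun i => x (i + 1)) fun i _ => ?_]
      · exact neg_add_cancel _
      · split_ifs with hi
        · rw [hi]
        · rfl

namespace IsCyclicDifferential

theorem letter_apply_ι (hD : IsCyclicDifferential h𝒱 ω Q D) (x : V) :
    letter (D (ι K x)) = Q x := by
  rw [hD.map_ι, letter_ι]

theorem hasDegree_linearPart (hD : IsCyclicDifferential h𝒱 ω Q D) : HasDegree 𝒱 𝒱 1 Q := by
  rw [show Q = letter ∘ₗ D ∘ₗ ι K from LinearMap.ext fun x => (hD.letter_apply_ι x).symm]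
  exact hasDegree_letter.comp (hD.hasDegree.comp hasDegree_ι (zero_add 1)) (add_zero 1)

theorem isSymplecticDifferential (hD : IsCyclicDifferential h𝒱 ω Q D)
    (form_degree : ∀ a b x y, x ∈ 𝒱 a → y ∈ 𝒱 b → a + b ≠ 1 → ω x y = 0)
    (form_skew : ∀ x y, ω y x = -ω x y) (form_nondegenerate : ∀ x, x ≠ 0 → ∃ y, ω x y ≠ 0) :
    IsSymplecticDifferential h𝒱 ω Q where
  hasDegree_Q := hD.hasDegree_linearPart
  Q_mul_Q := by
    ext x
    simpa [hD.map_ι] using congrArg letter (LinearMap.congr_fun hD.mul_self (ι K x))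
  form_Q_left x y := by
    have h := invariance_word (ω := ω) h𝒱 (letter ∘ₗ D) 1 fun i => if i = 0 then x else y
    rw [mem_invariantMaps.1 (hD.isCoderivation.pairing_comp_eq_zero_iff.1 hD.pairing_comp)] at h
    exact eq_neg_of_add_eq_zero_left (by simpa [word_one, hD.map_ι] using h.symm)
  form_degree := form_degree
  form_skew := form_skew
  form_nondegenerate := form_nondegenerate

end IsCyclicDifferential

/-- The family of operations `V^{⊗ n} → W` given by a linear map on the tensor algebra. -/
noncomputable def toFamily (g : TensorAlgebra K V →ₗ[K] W) : MultFamily K V W :=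
  fun n => g.compMultilinearMap (tprod K V n)

theorem toFamily_apply (g : TensorAlgebra K V →ₗ[K] W) (n : ℕ) (o : ℕ → V) :
    toFamily g n (fun i => o i) = g (word K n o) := rfl

theorem toFamily_one (g : TensorAlgebra K V →ₗ[K] W) (x : V) :
    toFamily g 1 (fun _ => x) = g (ι K x) := by
  rw [← word_one (K := K) fun _ => x, ← toFamily_apply]

theorem toFamily_zero {g : TensorAlgebra K V →ₗ[K] W} (hg : g 1 = 0) : toFamily g 0 = 0 := by
  ext o
  rw [Subsingleton.elim o fun _ => 0, toFamily_apply g 0 fun _ => 0, word_zero, hg,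
    zero_apply]

theorem ofFamily_toFamily (g : TensorAlgebra K V →ₗ[K] W) : ofFamily (toFamily g) = g :=
  ext_words fun n o => by rw [ofFamily_word, toFamily_apply]

theorem exists_extend_letters {n : ℕ} {d : Fin n → ℤ} {o : Fin n → V}
    (ho : ∀ i, o i ∈ 𝒱 (d i)) :
    ∃ (d' : ℕ → ℤ) (o' : ℕ → V),
      (∀ i, o' i ∈ 𝒱 (d' i)) ∧ (d = fun i : Fin n => d' i) ∧ o = fun i : Fin n => o' i := by
  refine ⟨fun i => if h : i < n then d ⟨i, h⟩ else 0, fun i => if h : i < n then o ⟨i, h⟩ else 0,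
    fun i => ?_, by simp, by simp⟩
  by_cases h : i < n
  · simpa [h] using ho ⟨i, h⟩
  · simp [h]

theorem toFamily_hasDegree {g : TensorAlgebra K V →ₗ[K] W} {𝒲 : ℤ → Submodule K W} {e : ℤ}
    (hg : HasDegree (wordsOfDegree 𝒱) 𝒲 e g) : (toFamily g).HasDegree 𝒱 𝒲 e := by
  intro n d o ho
  obtain ⟨d', o', ho', rfl, rfl⟩ := exists_extend_letters ho
  rw [toFamily_apply, ← Finset.sum_range]
  exact hg.apply_word n ho'

end Translation

section Algebra

open TensorAlgebra

variable {K : Type u} [Field K]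

/-- The bar differential of a cyclic `A_∞`-algebra: the odd coderivation of the bar coalgebra whose
components are the operations `m_n`. -/
noncomputable def barDifferential (A : CyclicAInftyAlgebra.{u, v} K) :
    Module.End K (TensorAlgebra K A.carrier) :=
  coderivation (parity A.isInternal) (ofFamily A.m)

theorem isCoderivation_barDifferential (A : CyclicAInftyAlgebra.{u, v} K) :
    IsCoderivation (tparity A.isInternal) (barDifferential A) :=
  isCoderivation_coderivation _ (ofFamily_one A.m_zero)

theorem letter_comp_barDifferential (A : CyclicAInftyAlgebra.{u, v} K) :
    letter ∘ₗ barDifferential A = ofFamily A.m :=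
  letter_comp_coderivation _ _

theorem hasDegree_barDifferential (A : CyclicAInftyAlgebra.{u, v} K) :
    HasDegree (wordsOfDegree A.grading) (wordsOfDegree A.grading) 1 (barDifferential A) := by
  refine hasDegree_coderivation (hasDegree_parity A.isInternal)
    (hasDegree_of_words fun n d o ho => ?_)
  rw [ofFamily_word, Finset.sum_range]
  exact A.m_degree n _ _ fun i => ho i

theorem barDifferential_mul_self (A : CyclicAInftyAlgebra.{u, v} K) :
    barDifferential A * barDifferential A = 0 := by
  have hD := isCoderivation_barDifferential A
  refine hD.mul_self_eq_zero (hasDegree_barDifferential A) ?_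
  rw [← LinearMap.comp_assoc, letter_comp_barDifferential]
  refine ext_homogeneous_words A.isInternal fun n d o ho => ?_
  rcases n.eq_zero_or_pos with rfl | hn
  · simp [hD.map_one]
  · rw [LinearMap.comp_apply, barDifferential, ← insertionSum_eq A.isInternal A.m A.m_zero n ho,
      A.relation n hn d o ho, LinearMap.zero_apply]

theorem isCyclicDifferential_barDifferential (A : CyclicAInftyAlgebra.{u, v} K) :
    IsCyclicDifferential A.isInternal A.ω A.Q (barDifferential A) where
  isCoderivation := isCoderivation_barDifferential A
  hasDegree := hasDegree_barDifferential A
  mul_self := barDifferential_mul_self A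
  pairing_comp := by
    rw [(isCoderivation_barDifferential A).pairing_comp_eq_zero_iff, letter_comp_barDifferential,
      mem_invariantMaps_parity_iff A.isInternal A.ω_skew (ofFamily_one A.m_zero)]
    intro k hk d o ho
    rw [ofFamily_word, ofFamily_word]
    exact A.cyclic k hk d o ho
  map_ι x := by
    rw [← word_one (K := K) fun _ => x, barDifferential,
      coderivation_word _ (ofFamily_one A.m_zero)]
    simp only [Finset.Icc_self, Nat.reduceAdd, ofFamily_word, Finset.sum_singleton,
      Nat.add_one_sub_one, Finset.range_one, word_one, lt_self_iff_false, ↓reduceIte, ι_inj]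
    rfl

theorem isSymplecticDifferential_Q (A : CyclicAInftyAlgebra.{u, v} K) :
    IsSymplecticDifferential A.isInternal A.ω A.Q :=
  (isCyclicDifferential_barDifferential A).isSymplecticDifferential A.ω_degree A.ω_skew
    A.ω_nondegenerate

theorem exists_isHodge [CharZero K] (A : CyclicAInftyAlgebra.{u, v} K)
    (hA : (∀ i : ℤ, FiniteDimensional K (A.grading i)) ∨
      ∃ Qp : A.carrier →ₗ[K] A.carrier, A.IsCompatibleHomotopy Qp) :
    ∃ h, IsHodge A.isInternal A.ω A.Q h := by
  rcases hA with _ | ⟨R, hR, P, hsum, -, hQP, hPU, hUU⟩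
  · exact (isSymplecticDifferential_Q A).exists_isHodge_of_finite
  · exact (isSymplecticDifferential_Q A).exists_isHodge_of_homotopy
      (fun i x hx => by simpa [sub_eq_add_neg] using hR i x hx) hsum hQP hPU hUU

end Algebra

section StrictIdempotent

variable {K : Type u} [Field K]

theorem map_insertionSum {V W U : Type v} [AddCommGroup V] [Module K V] [AddCommGroup W]
    [Module K W] [AddCommGroup U] [Module K U] (φ : W →ₗ[K] U) (g : MultFamily K V W)
    (m : MultFamily K V V) (n : ℕ) (d : ℕ → ℤ) (o : ℕ → V) :
    φ (insertionSum g m n d o) = insertionSum (fun n => φ.compMultilinearMap (g n)) m n d o := by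
  simp only [insertionSum, map_sum, map_smul]
  rfl

theorem map_compositionSum {V W U : Type v} [AddCommGroup V] [Module K V] [AddCommGroup W]
    [Module K W] [AddCommGroup U] [Module K U] (φ : W →ₗ[K] U) {m : MultFamily K W W}
    {m' : MultFamily K U U} (hφ : ∀ n o, φ (m n o) = m' n fun i => φ (o i))
    (f : MultFamily K V W) (n : ℕ) (o : ℕ → V) :
    φ (compositionSum m f n o) = compositionSum m' (fun n => φ.compMultilinearMap (f n)) n o := by
  simp only [compositionSum, map_sum, hφ, LinearMap.compMultilinearMap_apply]

theorem isInternal_comap_range {V : Type v} [AddCommGroup V] [Module K V]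
    {𝒱 : ℤ → Submodule K V} (h𝒱 : DirectSum.IsInternal 𝒱) {e : Module.End K V}
    (idem : IsIdempotentElem e) (degree : HasDegree 𝒱 𝒱 0 e) :
    DirectSum.IsInternal fun i => (𝒱 i).comap (LinearMap.range e).subtype := by
  rw [DirectSum.isInternal_submodule_iff_iSupIndep_and_iSup_eq_top] at h𝒱 ⊢
  refine ⟨fun i => Submodule.disjoint_def.2 fun x hx hx' => Subtype.ext ?_,
    Submodule.eq_top_iff'.2 fun x => ?_⟩
  · have sup_le : (⨆ j, ⨆ (_ : j ≠ i), (𝒱 j).comap (LinearMap.range e).subtype) ≤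
        (⨆ j, ⨆ (_ : j ≠ i), 𝒱 j).comap (LinearMap.range e).subtype :=
      iSup₂_le fun j hj => Submodule.comap_mono (le_iSup₂_of_le j hj le_rfl)
    exact Submodule.disjoint_def.1 (h𝒱.1 i) x hx (sup_le hx')
  · have le_sup : (⨆ i, 𝒱 i) ≤
        (⨆ i, (𝒱 i).comap (LinearMap.range e).subtype).comap e.rangeRestrict :=
      iSup_le fun i y hy => Submodule.mem_iSup_of_mem
        (p := fun i => (𝒱 i).comap (LinearMap.range e).subtype) i (by simpa using degree i y hy)
    obtain ⟨_, y, rfl⟩ := x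
    have fixed : e.rangeRestrict (e y) = ⟨e y, y, rfl⟩ :=
      Subtype.ext (LinearMap.congr_fun idem.eq y)
    rw [← fixed]
    exact le_sup (h𝒱.2 ▸ Submodule.mem_top)

theorem prod_rangeRestrict_bijective {V : Type v} [AddCommGroup V] [Module K V]
    {e e' : Module.End K V} (idem : IsIdempotentElem e) (add_eq_one : e + e' = 1) :
    Function.Bijective (e.rangeRestrict.prod e'.rangeRestrict) := by
  obtain rfl : e' = 1 - e := eq_sub_of_add_eq' add_eq_one
  have idem_apply (x : V) : e (e x) = e x := LinearMap.congr_fun idem.eq x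
  constructor
  · intro x y hxy
    have h : e x = e y := congrArg (fun p => (p.1 : V)) hxy
    have h' : x - e x = y - e y := congrArg (fun p => (p.2 : V)) hxy
    rwa [h, sub_left_inj] at h'
  · rintro ⟨⟨_, x, rfl⟩, ⟨_, y, rfl⟩⟩
    exact ⟨e x + (1 - e) y, Prod.ext (Subtype.ext (by simp [idem_apply]))
      (Subtype.ext (by simp [idem_apply]))⟩

/-- A self-adjoint idempotent of degree zero which commutes strictly with all operations; its image
is a cyclic `A_∞`-subalgebra. -/
structure IsStrictIdempotent (B : CyclicAInftyAlgebra.{u, v} K) (e : Module.End K B.carrier) :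
    Prop where
  hasDegree : HasDegree B.grading B.grading 0 e
  isIdempotentElem : IsIdempotentElem e
  map_m : ∀ n (o : Fin n → B.carrier), e (B.m n o) = B.m n fun i => e (o i)
  form_left : ∀ x y, B.ω (e x) y = B.ω x (e y)

/-- A linear map of degree zero which preserves the operations and the symplectic form, that is,
a cyclic `A_∞`-morphism without higher components. -/
structure IsStrictHom (B C : CyclicAInftyAlgebra.{u, v} K) (φ : B.carrier →ₗ[K] C.carrier) :
    Prop where
  hasDegree : HasDegree B.grading C.grading 0 φ
  map_m : ∀ n (o : Fin n → B.carrier), φ (B.m n o) = C.m n fun i => φ (o i)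
  map_ω : ∀ x y, C.ω (φ x) (φ y) = B.ω x y

/-- The composition of a cyclic `A_∞`-morphism with a strict one. -/
def IsStrictHom.comp {A B C : CyclicAInftyAlgebra.{u, v} K} {φ : B.carrier →ₗ[K] C.carrier}
    (hφ : IsStrictHom B C φ) (F : CyclicAInftyAlgebra.Hom A B) : CyclicAInftyAlgebra.Hom A C where
  f n := φ.compMultilinearMap (F.f n)
  f_zero := by
    rw [F.f_zero]
    exact MultilinearMap.ext fun _ => map_zero φ
  f_degree n d o ho := by
    have h := hφ.hasDegree _ _ (F.f_degree n d o ho)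
    rwa [add_zero] at h
  relation n hn d o ho := by
    rw [← map_compositionSum φ hφ.map_m, ← map_insertionSum, F.relation n hn d o ho]
  map_ω x y := (hφ.map_ω _ _).trans (F.map_ω x y)
  map_ω_higher n hn o := by
    simp only [LinearMap.compMultilinearMap_apply, hφ.map_ω]
    exact F.map_ω_higher n hn o

namespace IsStrictIdempotent

variable {B : CyclicAInftyAlgebra.{u, v} K} {e e' : Module.End K B.carrier}

theorem apply_coe (he : IsStrictIdempotent B e) (x : LinearMap.range e) :
    e (x : B.carrier) = x := by
  obtain ⟨_, y, rfl⟩ := x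
  exact LinearMap.congr_fun he.isIdempotentElem.eq y

/-- The operations on the image of a strict idempotent. -/
def imageOps (_ : IsStrictIdempotent B e) : MultFamily K (LinearMap.range e) (LinearMap.range e) :=
  fun n => e.rangeRestrict.compMultilinearMap
    ((B.m n).compLinearMap fun _ => (LinearMap.range e).subtype)

theorem coe_imageOps (he : IsStrictIdempotent B e) (n : ℕ) (o : Fin n → LinearMap.range e) :
    (he.imageOps n o : B.carrier) = B.m n fun i => (o i : B.carrier) := by
  change e (B.m n fun i => (o i : B.carrier)) = _
  rw [he.map_m]
  exact congrArg _ (funext fun i => he.apply_coe (o i))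

/-- The image of a strict idempotent as a cyclic `A_∞`-algebra. -/
def image (he : IsStrictIdempotent B e) : CyclicAInftyAlgebra.{u, v} K where
  carrier := LinearMap.range e
  grading i := (B.grading i).comap (LinearMap.range e).subtype
  isInternal := isInternal_comap_range B.isInternal he.isIdempotentElem he.hasDegree
  m := he.imageOps
  m_zero := by
    ext o
    rw [he.coe_imageOps, B.m_zero]
    rfl
  m_degree n d o ho := by
    rw [Submodule.mem_comap, Submodule.subtype_apply, he.coe_imageOps]
    exact B.m_degree n d _ ho
  relation n hn d o ho := by
    have h := B.relation n hn d (fun i => (o i : B.carrier)) ho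
    apply Subtype.ext
    rw [← Submodule.subtype_apply, map_insertionSum, Submodule.coe_zero, ← h]
    simp only [insertionSum, LinearMap.compMultilinearMap_apply, Submodule.subtype_apply,
      he.coe_imageOps, apply_ite (Subtype.val (p := (· ∈ LinearMap.range e)))]
  ω := B.ω.compl₁₂ (LinearMap.range e).subtype (LinearMap.range e).subtype
  ω_degree a b x y hx hy := B.ω_degree a b _ _ hx hy
  ω_skew x y := B.ω_skew _ _
  ω_nondegenerate x hx := by
    obtain ⟨y, hy⟩ := B.ω_nondegenerate (x : B.carrier) fun h => hx (Subtype.ext h)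
    refine ⟨e.rangeRestrict y, ?_⟩
    change B.ω x (e y) ≠ 0
    rwa [← he.form_left, he.apply_coe]
  cyclic k hk d o ho := by
    simp only [LinearMap.compl₁₂_apply, Submodule.subtype_apply, he.coe_imageOps,
      apply_ite (Subtype.val (p := (· ∈ LinearMap.range e)))]
    exact B.cyclic k hk d _ ho

theorem rangeRestrict_m (he : IsStrictIdempotent B e) (n : ℕ) (o : Fin n → B.carrier) :
    e.rangeRestrict (B.m n o) = he.image.m n fun i => e.rangeRestrict (o i) :=
  Subtype.ext ((he.map_m n o).trans (he.coe_imageOps n fun i => e.rangeRestrict (o i)).symm)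

theorem coe_image_Q (he : IsStrictIdempotent B e) (z : LinearMap.range e) :
    (show LinearMap.range e from he.image.Q z : B.carrier) = B.Q (z : B.carrier) :=
  he.coe_imageOps 1 fun _ => z

theorem image_isMinimal (he : IsStrictIdempotent B e) (hQ : B.Q ∘ₗ e = 0) :
    he.image.IsMinimal := by
  refine MultilinearMap.ext fun (o : Fin 1 → LinearMap.range e) => ?_
  obtain ⟨y, hy⟩ := (o 0).2
  rw [show o = fun _ => o 0 from funext fun i => by rw [Subsingleton.elim i 0]]
  refine Subtype.ext ((he.coe_image_Q (o 0)).trans ?_)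
  rw [← hy]
  exact LinearMap.congr_fun hQ y

theorem image_isLinearContractible (he : IsStrictIdempotent B e)
    (hm : ∀ n, 2 ≤ n → ∀ o, e (B.m n o) = 0) {k : Module.End K B.carrier}
    (hk : ∀ x, B.Q x = 0 → e x = x → B.Q (e (k x)) = x) : he.image.IsLinearContractible := by
  refine ⟨fun n hn => MultilinearMap.ext fun (o : Fin n → LinearMap.range e) =>
    Subtype.ext (hm n hn fun i => (o i : B.carrier)), fun (o : LinearMap.range e) ho => ?_⟩
  have closed : B.Q (o : B.carrier) = 0 := (he.coe_image_Q o).symm.trans (congrArg Subtype.val ho)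
  exact ⟨e.rangeRestrict (k o),
    Subtype.ext ((he.coe_image_Q _).trans (hk o closed (he.apply_coe o)))⟩

theorem isStrictHom_prod (he : IsStrictIdempotent B e) (he' : IsStrictIdempotent B e')
    (add_eq_one : e + e' = 1) :
    IsStrictHom B (he.image.directSum he'.image) (e.rangeRestrict.prod e'.rangeRestrict) where
  hasDegree i x hx := ⟨he.hasDegree i x hx, he'.hasDegree i x hx⟩
  map_m n o := Prod.ext (he.rangeRestrict_m n o) (he'.rangeRestrict_m n o)
  map_ω x y := by
    calc B.ω (e x) (e y) + B.ω (e' x) (e' y)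
        = B.ω x ((e * e) y) + B.ω x ((e' * e') y) := by rw [he.form_left, he'.form_left]; rfl
      _ = B.ω x ((e + e') y) := by
        rw [he.isIdempotentElem.eq, he'.isIdempotentElem.eq, ← map_add, LinearMap.add_apply]
      _ = B.ω x y := by rw [add_eq_one, Module.End.one_apply]

end IsStrictIdempotent

end StrictIdempotent

section Splitting

open TensorAlgebra

variable {K : Type u} [Field K] {A : CyclicAInftyAlgebra.{u, v} K}
  {D : Module.End K (TensorAlgebra K A.carrier)} {h : Module.End K A.carrier}

/-- The cyclic `A_∞`-algebra with the same underlying symplectic space as `A` and a prescribed bar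
differential. -/
noncomputable def algebraOfDifferential (A : CyclicAInftyAlgebra.{u, v} K)
    {D : Module.End K (TensorAlgebra K A.carrier)}
    (hD : IsCyclicDifferential A.isInternal A.ω A.Q D) : CyclicAInftyAlgebra.{u, v} K where
  carrier := A.carrier
  grading := A.grading
  isInternal := A.isInternal
  m := toFamily (letter ∘ₗ D)
  m_zero := toFamily_zero (by simp [hD.isCoderivation.map_one])
  m_degree := toFamily_hasDegree (hasDegree_letter.comp hD.hasDegree (add_zero 1))
  relation n _ d o ho := by
    rw [insertionSum_eq A.isInternal _ (toFamily_zero (by simp [hD.isCoderivation.map_one])) n ho,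
      ofFamily_toFamily, ← hD.isCoderivation.eq_coderivation]
    exact congrArg letter (LinearMap.congr_fun hD.mul_self (word K n o)) |>.trans (map_zero _)
  ω := A.ω
  ω_degree := A.ω_degree
  ω_skew := A.ω_skew
  ω_nondegenerate := A.ω_nondegenerate
  cyclic := (mem_invariantMaps_parity_iff (g := letter ∘ₗ D) A.isInternal A.ω_skew
    (by simp [hD.isCoderivation.map_one])).1
    (hD.isCoderivation.pairing_comp_eq_zero_iff.1 hD.pairing_comp)

theorem algebraOfDifferential_Q (hD : IsCyclicDifferential A.isInternal A.ω A.Q D) :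
    (algebraOfDifferential A hD).Q = A.Q :=
  LinearMap.ext fun x => (toFamily_one (letter ∘ₗ D) x).trans (hD.letter_apply_ι x)

theorem compositionSum_eq {V : Type v} [AddCommGroup V] [Module K V]
    {F : Module.End K (TensorAlgebra K V)} (hF : IsCoalgHom F)
    (g : TensorAlgebra K V →ₗ[K] V) (n : ℕ) (o : ℕ → V) :
    compositionSum (toFamily g) (toFamily (letter ∘ₗ F)) n o = g (F (word K n o)) := by
  rw [hF.word_eq_sum_tprod, map_sum]
  rfl

theorem sum_form_eq_zero {V : Type v} [AddCommGroup V] [Module K V] {ω : V →ₗ[K] V →ₗ[K] K}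
    {F : Module.End K (TensorAlgebra K V)} (hF : IsCoalgHom F)
    (hω : pairing ω ∘ₗ F = pairing ω) {n : ℕ} (hn : 3 ≤ n) (o : ℕ → V) :
    ∑ k ∈ Finset.Ico 1 n, ω (letter (F (word K k o)))
      (letter (F (word K (n - k) fun i => o (k + i)))) = 0 := by
  have invariant := LinearMap.congr_fun hω (word K n o)
  obtain ⟨n, rfl⟩ := Nat.exists_eq_add_of_le' (Nat.one_le_of_lt hn)
  have pairing_word : pairing ω (word K (n + 1) o) = 0 := by
    rw [pairing, conv_letter_right_word, letter_word, if_neg (by omega), map_zero,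
      LinearMap.zero_apply]
  rw [pairing_word, pairing, hF.conv_comp, conv_word, Finset.range_eq_Ico,
    Finset.sum_Ico_succ_top (by omega), Finset.sum_eq_sum_Ico_succ_bot (by omega)] at invariant
  simpa [hF.map_one] using invariant

theorem toFamily_letter_comp_one {V : Type v} [AddCommGroup V] [Module K V]
    {F : Module.End K (TensorAlgebra K V)} (hF : ∀ x, F (ι K x) = ι K x) (x : V) :
    toFamily (letter ∘ₗ F) 1 (fun _ => x) = x := by
  rw [toFamily_one, LinearMap.comp_apply, hF, letter_ι]

theorem letter_comp_apply_one {V : Type v} [AddCommGroup V] [Module K V]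
    {F : Module.End K (TensorAlgebra K V)} (hF : F 1 = 1) : (letter ∘ₗ F) 1 = 0 := by
  rw [LinearMap.comp_apply, hF, letter_one]

/-- A gauge transformation as a cyclic `A_∞`-morphism onto the gauge-transformed algebra. -/
noncomputable def gaugeHom {F : (Module.End K (TensorAlgebra K A.carrier))ˣ}
    (hF : F ∈ gaugeGroup A.grading A.ω) :
    CyclicAInftyAlgebra.Hom A
      (algebraOfDifferential A ((isCyclicDifferential_barDifferential A).conj hF)) where
  f := toFamily (letter ∘ₗ F.val)
  f_zero := toFamily_zero (letter_comp_apply_one (Submonoid.val_mem_of_mem_units _ hF).1.map_one)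
  f_degree := toFamily_hasDegree
    (hasDegree_letter.comp (Submonoid.val_mem_of_mem_units _ hF).2.1 (add_zero 0))
  relation n _ d o ho := by
    refine (compositionSum_eq (Submonoid.val_mem_of_mem_units _ hF).1 _ n o).trans ?_
    rw [insertionSum_eq A.isInternal _ A.m_zero n ho, ofFamily_toFamily, LinearMap.comp_apply,
      Module.End.mul_apply, inv_apply_apply]
    rfl
  map_ω x y := congrArg₂ (fun x y => A.ω x y)
    (toFamily_letter_comp_one (Submonoid.val_mem_of_mem_units _ hF).2.2.2 x)
    (toFamily_letter_comp_one (Submonoid.val_mem_of_mem_units _ hF).2.2.2 y)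
  map_ω_higher n hn o := sum_form_eq_zero (Submonoid.val_mem_of_mem_units _ hF).1
    (Submonoid.val_mem_of_mem_units _ hF).2.2.1 hn o

theorem isStrictIdempotent_of_comp (hD : IsCyclicDifferential A.isInternal A.ω A.Q D)
    {e : Module.End K A.carrier} (degree : HasDegree A.grading A.grading 0 e)
    (idem : IsIdempotentElem e)
    (comp_eq : e ∘ₗ letter ∘ₗ D = (letter ∘ₗ D) ∘ₗ (tmap e).toLinearMap)
    (form_left : ∀ x y, A.ω (e x) y = A.ω x (e y)) :
    IsStrictIdempotent (algebraOfDifferential A hD) e where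
  hasDegree := degree
  isIdempotentElem := idem
  map_m n o := (LinearMap.congr_fun comp_eq (tprod K A.carrier n o)).trans
    (congrArg (letter ∘ₗ D) (tmap_tprod e n o))
  form_left := form_left

theorem IsHodge.harm_comp_letter_comp {V : Type v} [AddCommGroup V] [Module K V]
    {𝒱 : ℤ → Submodule K V} {h𝒱 : DirectSum.IsInternal 𝒱} {ω : V →ₗ[K] V →ₗ[K] K}
    {Q h : Module.End K V} (H : IsHodge h𝒱 ω Q h) {D : Module.End K (TensorAlgebra K V)}
    (split : nonlin Q D = compress (harm Q h) (nonlin Q D)) :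
    harm Q h ∘ₗ letter ∘ₗ D = (letter ∘ₗ D) ∘ₗ (tmap (harm Q h)).toLinearMap := by
  have harm_comp_Q : harm Q h ∘ₗ Q = 0 := H.harm_mul_Q
  have Q_comp_harm : Q ∘ₗ harm Q h = 0 := H.Q_mul_harm
  rw [letter_comp_eq_add_nonlin Q D, LinearMap.comp_add, LinearMap.add_comp, LinearMap.comp_assoc,
    letter_comp_tmap, ← LinearMap.comp_assoc, ← LinearMap.comp_assoc, harm_comp_Q, Q_comp_harm,
    split, comp_compress, compress_comp_tmap, H.isIdempotentElem_harm.eq]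

theorem isStrictIdempotent_harm (H : IsHodge A.isInternal A.ω A.Q h)
    (hD : IsCyclicDifferential A.isInternal A.ω A.Q D)
    (split : nonlin A.Q D = compress (harm A.Q h) (nonlin A.Q D)) :
    IsStrictIdempotent (algebraOfDifferential A hD) (harm A.Q h) :=
  isStrictIdempotent_of_comp hD H.hasDegree_harm H.isIdempotentElem_harm
    (H.harm_comp_letter_comp split) H.form_harm

theorem comp_tmap_zero {V : Type v} [AddCommGroup V] [Module K V] {μ : TensorAlgebra K V →ₗ[K] V}
    (hμ : μ 1 = 0) : μ ∘ₗ (tmap (0 : Module.End K V)).toLinearMap = 0 := by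
  refine ext_words fun n o => ?_
  rw [LinearMap.comp_apply, AlgHom.toLinearMap_apply, tmap_word]
  rcases n with _ | n
  · rw [word_zero, hμ, LinearMap.zero_apply]
  · rw [word_eq_zero n.succ_pos (LinearMap.zero_apply _), map_zero, LinearMap.zero_apply]

theorem IsHodge.numOp_comp_letter_comp {V : Type v} [AddCommGroup V] [Module K V]
    {𝒱 : ℤ → Submodule K V} {h𝒱 : DirectSum.IsInternal 𝒱} {ω : V →ₗ[K] V →ₗ[K] K}
    {Q h : Module.End K V} (H : IsHodge h𝒱 ω Q h) {D : Module.End K (TensorAlgebra K V)}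
    (nonlin_one : nonlin Q D 1 = 0) (split : nonlin Q D = compress (harm Q h) (nonlin Q D)) :
    numOp Q h ∘ₗ letter ∘ₗ D = (letter ∘ₗ D) ∘ₗ (tmap (numOp Q h)).toLinearMap := by
  have numOp_comp_Q : numOp Q h ∘ₗ Q = Q := H.numOp_mul_Q
  have Q_comp_numOp : Q ∘ₗ numOp Q h = Q := H.Q_mul_numOp
  rw [letter_comp_eq_add_nonlin Q D, LinearMap.comp_add, LinearMap.add_comp, LinearMap.comp_assoc,
    letter_comp_tmap, ← LinearMap.comp_assoc, ← LinearMap.comp_assoc, numOp_comp_Q, Q_comp_numOp,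
    split, comp_compress, compress_comp_tmap, H.numOp_mul_harm, H.harm_mul_numOp,
    comp_tmap_zero nonlin_one, LinearMap.zero_comp, LinearMap.comp_zero]

theorem isStrictIdempotent_numOp (H : IsHodge A.isInternal A.ω A.Q h)
    (hD : IsCyclicDifferential A.isInternal A.ω A.Q D)
    (split : nonlin A.Q D = compress (harm A.Q h) (nonlin A.Q D)) :
    IsStrictIdempotent (algebraOfDifferential A hD) (numOp A.Q h) :=
  isStrictIdempotent_of_comp hD H.hasDegree_numOp H.isIdempotentElem_numOp
    (H.numOp_comp_letter_comp (hD.nonlin_eq_zero 1 (one_mem_wordsLE 1)) split) H.form_numOp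

theorem isMinimal_image_harm (H : IsHodge A.isInternal A.ω A.Q h)
    (hD : IsCyclicDifferential A.isInternal A.ω A.Q D)
    (split : nonlin A.Q D = compress (harm A.Q h) (nonlin A.Q D)) :
    (isStrictIdempotent_harm H hD split).image.IsMinimal :=
  (isStrictIdempotent_harm H hD split).image_isMinimal
    ((congrArg (· ∘ₗ harm A.Q h) (algebraOfDifferential_Q hD)).trans H.Q_mul_harm)

theorem isLinearContractible_image_numOp (H : IsHodge A.isInternal A.ω A.Q h)
    (hD : IsCyclicDifferential A.isInternal A.ω A.Q D)
    (split : nonlin A.Q D = compress (harm A.Q h) (nonlin A.Q D)) :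
    (isStrictIdempotent_numOp H hD split).image.IsLinearContractible := by
  have contraction (x : A.carrier) (closed : A.Q x = 0) (fixed : numOp A.Q h x = x) :
      A.Q (numOp A.Q h (h x)) = x := by
    calc A.Q (numOp A.Q h (h x)) = A.Q (h x) := LinearMap.congr_fun H.Q_mul_numOp (h x)
      _ = numOp A.Q h x := by simp [numOp, closed]
      _ = x := fixed
  have higher (n : ℕ) (hn : 2 ≤ n) (o : Fin n → A.carrier) :
      numOp A.Q h ((letter ∘ₗ D) (tprod K A.carrier n o)) = 0 := by
    obtain ⟨o, ho⟩ := exists_word_eq_tprod (K := K) n o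
    rw [← ho, letter_comp_eq_add_nonlin A.Q D, split, LinearMap.add_apply, LinearMap.comp_apply,
      letter_word, if_neg (by omega), map_zero, zero_add, ← LinearMap.comp_apply, comp_compress,
      H.numOp_mul_harm, LinearMap.zero_comp, LinearMap.zero_apply]
  have Q_eq := LinearMap.congr_fun (algebraOfDifferential_Q hD)
  exact (isStrictIdempotent_numOp H hD split).image_isLinearContractible higher (k := h)
    fun x closed fixed => (Q_eq _).trans (contraction x ((Q_eq x).symm.trans closed) fixed)

/-- The gauge transformation followed by the projections to the harmonic part and its
complement. -/
noncomputable def splitHom (H : IsHodge A.isInternal A.ω A.Q h)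
    {F : (Module.End K (TensorAlgebra K A.carrier))ˣ} (hF : F ∈ gaugeGroup A.grading A.ω)
    (split : nonlin A.Q (F.val * barDifferential A * F⁻¹.val) =
      compress (harm A.Q h) (nonlin A.Q (F.val * barDifferential A * F⁻¹.val))) :
    CyclicAInftyAlgebra.Hom A
      ((isStrictIdempotent_harm H ((isCyclicDifferential_barDifferential A).conj hF)
          split).image.directSum
        (isStrictIdempotent_numOp H ((isCyclicDifferential_barDifferential A).conj hF)
          split).image) :=
  ((isStrictIdempotent_harm H _ split).isStrictHom_prod (isStrictIdempotent_numOp H _ split)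
    (harm_add_numOp A.Q h)).comp (gaugeHom hF)

theorem splitHom_isIso (H : IsHodge A.isInternal A.ω A.Q h)
    {F : (Module.End K (TensorAlgebra K A.carrier))ˣ} (hF : F ∈ gaugeGroup A.grading A.ω)
    (split : nonlin A.Q (F.val * barDifferential A * F⁻¹.val) =
      compress (harm A.Q h) (nonlin A.Q (F.val * barDifferential A * F⁻¹.val))) :
    (splitHom H hF split).IsIso := by
  have linear : (fun x : A.carrier => (splitHom H hF split).f 1 fun _ => x) =
      (harm A.Q h).rangeRestrict.prod (numOp A.Q h).rangeRestrict :=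
    funext fun x => congrArg ((harm A.Q h).rangeRestrict.prod (numOp A.Q h).rangeRestrict)
      (toFamily_letter_comp_one (Submonoid.val_mem_of_mem_units _ hF).2.2.2 x)
  rw [AInftyAlgebra.Hom.IsIso, linear]
  exact prod_rangeRestrict_bijective H.isIdempotentElem_harm (harm_add_numOp A.Q h)

end Splitting

end BarCoalgebra

/-- Decomposition theorem for cyclic `A_∞`-algebras. The hypothesis is needed only to exclude
infinite-dimensional pathologies: it holds if every homogeneous component is finite-dimensional, and
also, with no bound on dimensions, if `m_1` has a homotopy operator compatible with `ω`. -/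
theorem theorem4p9 {K : Type u} [Field K] [CharZero K] (A : CyclicAInftyAlgebra.{u, v} K)
    (hA : (∀ i : ℤ, FiniteDimensional K (A.grading i)) ∨
      ∃ Qp : A.carrier →ₗ[K] A.carrier, A.IsCompatibleHomotopy Qp) :
    ∃ M C : CyclicAInftyAlgebra.{u, v} K,
      M.IsMinimal ∧ C.IsLinearContractible ∧
      ∃ F : CyclicAInftyAlgebra.Hom A (M.directSum C), F.IsIso := by
  obtain ⟨h, H⟩ := BarCoalgebra.exists_isHodge A hA
  have hD := BarCoalgebra.isCyclicDifferential_barDifferential A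
  obtain ⟨F, hF, split⟩ := H.exists_gauge_split hD
  exact ⟨_, _, BarCoalgebra.isMinimal_image_harm H (hD.conj hF) split,
    BarCoalgebra.isLinearContractible_image_numOp H (hD.conj hF) split,
    BarCoalgebra.splitHom H hF split, BarCoalgebra.splitHom_isIso H hF split⟩
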